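/- Let $G$ be a finite simple bipartite graph with colour classes $A$ and $B$, $n=|V(G)|$, $m=|E(G)|$, and let $b:V(G)\to\mathbb{Z}_{\ge 0}$. A $b$-matching is a set $M\subseteq E(G)$ such that at most $b(v)$ edges of $M$ are incident with each vertex $v$; it is maximum if it has the greatest number of edges. An edge is allowed if some maximum $b$-matching contains it, and forbidden otherwise; an allowed edge is inevitable if every maximum $b$-matching contains it, and flexible otherwise. The flexible components of $G$ are the subgraphs $G[V(C)]$, where $C$ runs over the connected components of the spanning subgraph $(V(G),\{\text{flexible edges}\})$. Let $D$ be the set of vertices $v$ that are incident with fewer than $b(v)$ edges of some maximum $b$-matching. A flexible component $C$ is inconsistent and hooked up by a colour class $W$ if $V(C)\cap D\cap W\ne\emptyset$, or if $V(C)=\{v\}$ with $b(v)=0$ and $v$ has a neighbour in $D\cap W$; it is inconsistent if this holds for $W=A$ or $W=B$, and consistent otherwise. For flexible components $C_1,C_2$ write $C_1\preceq^{\circ}_A C_2$ if $C_1=C_2$, or there is an inevitable edge between $V(C_1)\cap A$ and $V(C_2)\cap B$, or there is a forbidden edge between $V(C_2)\cap A$ and $V(C_1)\cap B$; and let $\preceq_A$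 be the transitive closure of $\preceq^{\circ}_A$. Then $\preceq_A$ is a partial order on the set of flexible components. Moreover, there are a program for a unit-cost random access machine (whose arithmetic may even be restricted to successor, predecessor and comparison) and a constant $c$ such that, for all $G$, $A$, $B$, $b$ as above and every maximum $b$-matching $M$, given $n$, $m$, the colour classes, $b$, a list of the edges of $G$ in any order, and a mark on each edge of $M$, the program halts within $c\,(n+m+1)$ steps and outputs the $b$-matching Dulmage–Mendelsohn decomposition of $G$, that is: 1. the flexible components, as their number $k$ and, for each vertex, the number in $\{0,\dots,k-1\}$ of its flexible component; 2. for each flexible component, whether it is consistent or inconsistent, and whether it is inconsistent and hooked up by $A$, respectively by $B$; 3. the poset, as a list of at most $m$ pairs of flexible components whose reflexive transitive closure is $\preceq_A$. -/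

import Mathlib

namespace BDM

section Matchings

variable {V : Type*} [DecidableEq V]

/-- The number of edges of `M` incident with `v`. -/
def matchDeg (M : Finset (Sym2 V)) (v : V) : ℕ := (M.filter (fun e => v ∈ e)).card

/-- A `b`-matching: a set of edges with at most `b v` members at each vertex `v`. -/
def IsBMatching (G : SimpleGraph V) (b : V → ℕ) (M : Finset (Sym2 V)) : Prop :=
  (∀ e ∈ M, e ∈ G.edgeSet) ∧ ∀ v, matchDeg M v ≤ b v

/-- A `b`-matching with the greatest number of edges. -/
def IsMaxBMatching (G : SimpleGraph V) (b : V → ℕ) (M : Finset (Sym2 V)) : Prop :=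
  IsBMatching G b M ∧ ∀ N : Finset (Sym2 V), IsBMatching G b N → N.card ≤ M.card

/-- `v` is `M`-loose. -/
def IsLooseVertex (b : V → ℕ) (M : Finset (Sym2 V)) (v : V) : Prop := matchDeg M v < b v

/-- The edge `e` lies in some maximum `b`-matching. -/
def IsAllowed (G : SimpleGraph V) (b : V → ℕ) (e : Sym2 V) : Prop :=
  ∃ M, IsMaxBMatching G b M ∧ e ∈ M

/-- The edge `e` lies in no maximum `b`-matching. -/
def IsForbidden (G : SimpleGraph V) (b : V → ℕ) (e : Sym2 V) : Prop :=
  e ∈ G.edgeSet ∧ ¬ IsAllowed G b e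

/-- The allowed edge `e` lies in every maximum `b`-matching. -/
def IsInevitable (G : SimpleGraph V) (b : V → ℕ) (e : Sym2 V) : Prop :=
  IsAllowed G b e ∧ ∀ M, IsMaxBMatching G b M → e ∈ M

/-- The edge `e` is allowed but not inevitable. -/
def IsFlexible (G : SimpleGraph V) (b : V → ℕ) (e : Sym2 V) : Prop :=
  IsAllowed G b e ∧ ¬ IsInevitable G b e

/-- The spanning subgraph of `G` formed by the flexible edges. -/
def flexGraph (G : SimpleGraph V) (b : V → ℕ) : SimpleGraph V :=
  SimpleGraph.fromEdgeSet {e | IsFlexible G b e}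

/-- The flexible components of `G`. A flexible component is the subgraph of `G` induced by the
vertex set `C.supp` of a connected component `C` of `flexGraph G b`; it is represented by `C`. -/
abbrev FlexComp (G : SimpleGraph V) (b : V → ℕ) : Type _ := (flexGraph G b).ConnectedComponent

/-- The set of vertices that are `M`-loose for some maximum `b`-matching `M`. -/
def looseSet (G : SimpleGraph V) (b : V → ℕ) : Set V :=
  {v | ∃ M, IsMaxBMatching G b M ∧ IsLooseVertex b M v}

/-- `C` has a vertex in `looseSet G b`, or its sole vertex `v` has `b v = 0` and is a neighbour of
`looseSet G b` (such a `v` is never itself in `looseSet G b`). -/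
def IsInconsistent (G : SimpleGraph V) (b : V → ℕ) (C : FlexComp G b) : Prop :=
  (∃ v ∈ C.supp, v ∈ looseSet G b) ∨
    ∃ v, C.supp = {v} ∧ b v = 0 ∧ ∃ w ∈ looseSet G b, G.Adj v w

/-- The flexible component `C` is inconsistent and is hooked up by the vertex set `W`. -/
def IsHookedUp (G : SimpleGraph V) (b : V → ℕ) (W : Set V) (C : FlexComp G b) : Prop :=
  (∃ v ∈ C.supp, v ∈ looseSet G b ∧ v ∈ W) ∨
    ∃ v, C.supp = {v} ∧ b v = 0 ∧ ∃ w ∈ looseSet G b, w ∈ W ∧ G.Adj v w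

/-- The generating relation of the order: `C = D`, or there is an inevitable edge between
`C ∩ W` and `D \ W`, or there is a forbidden edge between `D ∩ W` and `C \ W`. -/
def flexStep (G : SimpleGraph V) (b : V → ℕ) (W : Set V) (C D : FlexComp G b) : Prop :=
  C = D ∨
    (∃ u ∈ C.supp ∩ W, ∃ v ∈ D.supp \ W, IsInevitable G b s(u, v)) ∨
    (∃ u ∈ D.supp ∩ W, ∃ v ∈ C.supp \ W, IsForbidden G b s(u, v))

/-- The relation `C ⪯ D` on flexible components with respect to the colour class `W`: there is a
finite chain from `C` to `D` of steps `flexStep`. -/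
def flexOrder (G : SimpleGraph V) (b : V → ℕ) (W : Set V) : FlexComp G b → FlexComp G b → Prop :=
  Relation.ReflTransGen (flexStep G b W)

end Matchings

/-! A unit-cost random access machine, in structured form. A program uses finitely many registers
and finitely many arrays, both holding natural numbers. The only arithmetic is successor,
predecessor and comparison, so that in `t` steps no stored number exceeds the maximum of the
input numbers and the program's constants by more than `t`. -/

/-- The contents of the registers and of the arrays. -/
structure State where
  reg : ℕ → ℕ
  arr : ℕ → ℕ → ℕ

/-- Write `z` into register `x`. -/
def State.setReg (s : State) (x z : ℕ) : State :=
  ⟨Function.update s.reg x z, s.arr⟩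

/-- Write `z` into cell `i` of array `a`. -/
def State.setArr (s : State) (a i z : ℕ) : State :=
  ⟨s.reg, Function.update s.arr a (Function.update (s.arr a) i z)⟩

/-- Expressions: constants, registers, array cells, successor and (truncated) predecessor. -/
inductive Expr where
  | const (c : ℕ)
  | reg (x : ℕ)
  | get (a : ℕ) (i : Expr)
  | succ (e : Expr)
  | pred (e : Expr)

def Expr.eval (s : State) : Expr → ℕ
  | .const c => c
  | .reg x => s.reg x
  | .get a i => s.arr a (i.eval s)
  | .succ e => e.eval s + 1
  | .pred e => e.eval s - 1

/-- The time to evaluate an expression: one unit for each operation. -/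
def Expr.cost : Expr → ℕ
  | .const _ => 1
  | .reg _ => 1
  | .get _ i => i.cost + 1
  | .succ e => e.cost + 1
  | .pred e => e.cost + 1

inductive Test where
  | lt (e f : Expr)
  | eq (e f : Expr)

def Test.holds (s : State) : Test → Prop
  | .lt e f => e.eval s < f.eval s
  | .eq e f => e.eval s = f.eval s

def Test.cost : Test → ℕ
  | .lt e f => e.cost + f.cost + 1
  | .eq e f => e.cost + f.cost + 1

inductive Prog where
  | skip
  | assign (x : ℕ) (e : Expr)
  | store (a : ℕ) (i e : Expr)
  | seq (p q : Prog)
  | cond (c : Test) (p q : Prog)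
  | loop (c : Test) (p : Prog)

/-- `Exec p s s' t`: the program `p`, started in the state `s`, halts in the state `s'` after
exactly `t` units of time. -/
inductive Exec : Prog → State → State → ℕ → Prop where
  | skip (s : State) : Exec .skip s s 1
  | assign (s : State) (x : ℕ) (e : Expr) :
      Exec (.assign x e) s (s.setReg x (e.eval s)) (e.cost + 1)
  | store (s : State) (a : ℕ) (i e : Expr) :
      Exec (.store a i e) s (s.setArr a (i.eval s) (e.eval s)) (i.cost + e.cost + 1)
  | seq {p q : Prog} {s s' s'' : State} {t t' : ℕ} :
      Exec p s s' t → Exec q s' s'' t' → Exec (.seq p q) s s'' (t + t')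
  | cond_true {c : Test} {p q : Prog} {s s' : State} {t : ℕ} :
      c.holds s → Exec p s s' t → Exec (.cond c p q) s s' (c.cost + t)
  | cond_false {c : Test} {p q : Prog} {s s' : State} {t : ℕ} :
      ¬ c.holds s → Exec q s s' t → Exec (.cond c p q) s s' (c.cost + t)
  | loop_true {c : Test} {p : Prog} {s s' s'' : State} {t t' : ℕ} :
      c.holds s → Exec p s s' t → Exec (.loop c p) s' s'' t' →
        Exec (.loop c p) s s'' (c.cost + t + t')
  | loop_false {c : Test} {p : Prog} {s : State} :
      ¬ c.holds s → Exec (.loop c p) s s c.cost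

/-- `ends` lists the edges of `G`, each exactly once, by their two ends (in either order). -/
def IsEdgeList {n m : ℕ} (G : SimpleGraph (Fin n)) (ends : Fin m → Fin n × Fin n) : Prop :=
  Function.Injective (fun k => s((ends k).1, (ends k).2)) ∧
    Set.range (fun k => s((ends k).1, (ends k).2)) = G.edgeSet

/-- An array that holds `f 0, …, f (n - 1)`, followed by zeros. -/
def word {n : ℕ} (f : Fin n → ℕ) (i : ℕ) : ℕ := if h : i < n then f ⟨i, h⟩ else 0

/-- The input. Registers 0 and 1 hold the numbers of vertices and edges; array 0 marks the vertices
in the colour class `A`, array 1 holds `b`, arrays 2 and 3 hold the two ends of each edge, and array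
4 marks the edges in `M`. All other registers and cells hold 0. -/
def inputState {n m : ℕ} (A : Finset (Fin n)) (b : Fin n → ℕ) (M : Finset (Sym2 (Fin n)))
    (ends : Fin m → Fin n × Fin n) : State where
  reg
    | 0 => n
    | 1 => m
    | _ => 0
  arr
    | 0 => word fun v => if v ∈ A then 1 else 0
    | 1 => word b
    | 2 => word fun k => ((ends k).1 : ℕ)
    | 3 => word fun k => ((ends k).2 : ℕ)
    | 4 => word fun k => if s((ends k).1, (ends k).2) ∈ M then 1 else 0
    | _ => fun _ => 0

/-- The state `s` holds the decomposition. Register 2 holds the number of flexible components,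
which are numbered from 0 by `φ`; array 5 holds the number of the component of each vertex. Arrays
6, 7 and 8 mark the components that are inconsistent, inconsistent and hooked up by `A`, and
inconsistent and hooked up by the complement of `A`. Register 3 holds the length, at most `m`, of
a list of pairs of components, given in arrays 9 and 10, whose reflexive transitive closure is the
order `flexOrder G b A`. -/
def IsDecomposition {n : ℕ} (m : ℕ) (G : SimpleGraph (Fin n)) (A : Finset (Fin n))
    (b : Fin n → ℕ) (s : State) : Prop :=
  ∃ φ : FlexComp G b ≃ Fin (s.reg 2),
    (∀ v : Fin n, s.arr 5 v = φ ((flexGraph G b).connectedComponentMk v)) ∧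
    (∀ C : FlexComp G b,
      (s.arr 6 (φ C) = 1 ↔ IsInconsistent G b C) ∧
      (s.arr 7 (φ C) = 1 ↔ IsHookedUp G b (A : Set (Fin n)) C) ∧
      (s.arr 8 (φ C) = 1 ↔ IsHookedUp G b (A : Set (Fin n))ᶜ C)) ∧
    s.reg 3 ≤ m ∧
    (∀ j < s.reg 3, s.arr 9 j < s.reg 2 ∧ s.arr 10 j < s.reg 2) ∧
    ∀ C D : FlexComp G b,
      flexOrder G b (A : Set (Fin n)) C D ↔
        Relation.ReflTransGen
          (fun x y : ℕ => ∃ j < s.reg 3, s.arr 9 j = x ∧ s.arr 10 j = y) (φ C) (φ D)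

end BDM

/-!
Fix a maximum `b`-matching `M` and direct each edge of `G` so that reversing a directed path changes
`M` along it: edges outside `M` leave the colour class `W`, edges of `M` enter it (`Res`). Call a
vertex hooked by `W` if it is reached from a loose vertex of `W` (`hooked`). The residual digraph of
the other class is the opposite one, so every fact about `W` has a mirror image.

*Structure.* Reversing a path or a cycle produces further maximum `b`-matchings (`exists_shift`).
Conversely, a set that is closed in the residual digraph and separates the loose vertices of `W`
from the other loose ones is a minimum cut, and all maximum `b`-matchings agree on the edges that
cross it (`agree_of_cut`). Together these determine the flexible edges: a residual arc `x → y` is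
flexible if and only if `y` reaches `x`, or `x` is hooked by `W` and `b y ≠ 0`, or `y` is hooked by
the other class and `b x ≠ 0`. Hence, adding the reversals of the arcs of the last two kinds to the
residual digraph (`Aug`) makes the flexible components its strongly connected components
(`mk_eq_iff`), and the order is generated by the residual arcs (`flexOrder_eq`). It is therefore
antisymmetric. A component is hooked up by `W` if and only if its vertices are hooked by `W`
(`isHookedUp_iff`), and it does not matter which of its vertices is tested.

*Algorithm.* The program orients the edges, finds the vertices hooked by either class by two
searches from the loose vertices, and finds the strongly connected components of `Aug` by
Kosaraju's algorithm, that is by two more searches. The residual arcs themselves are output as the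
list of pairs. All four searches run one program, an iterative depth-first search over linked lists
of arcs. Its correctness is proved for abstract configurations (`Config.Inv`), from which
`IsSearched.mark_eq_iff` derives Kosaraju's theorem. The program is a single loop with a loop-free
body, and each iteration but the last removes an arc from a list, finishes a vertex or takes a start
vertex, so that it runs in linear time (`runs_search`).
-/

namespace BDM

/-! ### Alternating paths and minimum cuts -/

section Theory

open Relation

theorem mem_iff_of_adj {V : Type*} {G : SimpleGraph V} {W : Set V}
    (hG : G.IsBipartiteWith W Wᶜ) {x y : V} (h : G.Adj x y) :
    x ∈ W ↔ y ∉ W := by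
  have := hG.mem_of_adj h
  simp only [Set.mem_compl_iff] at this
  tauto

theorem isBipartiteWith_compl {V : Type*} {G : SimpleGraph V} {W : Set V}
    (hG : G.IsBipartiteWith W Wᶜ) : G.IsBipartiteWith Wᶜ Wᶜᶜ := by
  rw [compl_compl]; exact hG.symm

/-- A path from `x` can be taken to leave `x` at once and never to return. -/
theorem exists_last_exit {α : Type*} {r : α → α → Prop} {x y : α} (h : ReflTransGen r x y) :
    x = y ∨ y ≠ x ∧ ∃ z, z ≠ x ∧ r x z ∧
      ReflTransGen (fun u v => r u v ∧ u ≠ x ∧ v ≠ x) z y := by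
  induction h with
  | refl => exact Or.inl rfl
  | @tail y y' _ hr ih =>
    by_cases hy : x = y'
    · exact Or.inl hy
    · refine Or.inr ⟨Ne.symm hy, ?_⟩
      rcases ih with rfl | ⟨hne, z, hz, hxz, hp⟩
      · exact ⟨y', Ne.symm hy, hr, .refl⟩
      · exact ⟨z, hz, hxz, hp.tail ⟨hr, hne, Ne.symm hy⟩⟩

/-- A path to `x` can be taken to visit `x` only at its end. -/
theorem exists_first_entry {α : Type*} {r : α → α → Prop} {x y : α} (h : ReflTransGen r y x) :
    y = x ∨ y ≠ x ∧ ∃ w, w ≠ x ∧ r w x ∧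
      ReflTransGen (fun u v => r u v ∧ u ≠ x ∧ v ≠ x) y w := by
  induction h using ReflTransGen.head_induction_on with
  | refl => exact Or.inl rfl
  | @head y' y hr _ ih =>
    by_cases hy : y' = x
    · exact Or.inl hy
    · refine Or.inr ⟨hy, ?_⟩
      rcases ih with rfl | ⟨hne, z, hz, hxz, hp⟩
      · exact ⟨y', hy, hr, .refl⟩
      · exact ⟨z, hz, hxz, hp.head ⟨hr, hy, hne⟩⟩

theorem reflTransGen_univ {V : Type*} [Fintype V] {r : V → V → Prop} {x y : V}
    (h : ReflTransGen r x y) :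
    ReflTransGen (fun u v => r u v ∧ u ∈ (Finset.univ : Finset V) ∧ v ∈ Finset.univ) x y :=
  ReflTransGen.mono (fun _ _ h => ⟨h, by simp, by simp⟩) _ _ h

variable {V : Type*} [DecidableEq V]

/-- The residual digraph of `M` with respect to the colour class `W`: an edge outside `M` is
directed from `W` to its complement, an edge of `M` is directed into `W`. -/
def Res (G : SimpleGraph V) (W : Set V) (M : Finset (Sym2 V)) (x y : V) : Prop :=
  G.Adj x y ∧ (x ∈ W ↔ s(x, y) ∉ M)

/-- Remove `e` from `M` if it is there, and add it otherwise. -/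
def toggle (M : Finset (Sym2 V)) (e : Sym2 V) : Finset (Sym2 V) :=
  if e ∈ M then M.erase e else insert e M

theorem mem_toggle_of_ne {M : Finset (Sym2 V)} {e f : Sym2 V} (h : f ≠ e) :
    f ∈ toggle M e ↔ f ∈ M := by
  unfold toggle; split <;> simp [h]

theorem mem_toggle_self {M : Finset (Sym2 V)} {e : Sym2 V} : e ∈ toggle M e ↔ e ∉ M := by
  unfold toggle; split <;> simp [*]

theorem matchDeg_insert {M : Finset (Sym2 V)} {e : Sym2 V} (h : e ∉ M) (v : V) :
    matchDeg (insert e M) v = matchDeg M v + if v ∈ e then 1 else 0 := by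
  unfold matchDeg
  rw [Finset.filter_insert]
  split
  · rw [Finset.card_insert_of_notMem (by simp [h])]
  · simp

theorem matchDeg_erase {M : Finset (Sym2 V)} {e : Sym2 V} (h : e ∈ M) (v : V) :
    matchDeg (M.erase e) v + (if v ∈ e then 1 else 0) = matchDeg M v := by
  conv_rhs => rw [← Finset.insert_erase h]
  rw [matchDeg_insert (by simp)]

theorem matchDeg_pos {M : Finset (Sym2 V)} {e : Sym2 V} {v : V} (h : e ∈ M) (hv : v ∈ e) :
    0 < matchDeg M v :=
  Finset.card_pos.2 ⟨e, by simp [h, hv]⟩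

open Classical in
/-- The degree in `M`, counted positively in `W` and negatively outside. Reversing a residual arc
`x → y` raises it by one at `x` and lowers it by one at `y`. -/
noncomputable def excess (W : Set V) (M : Finset (Sym2 V)) (v : V) : ℤ :=
  if v ∈ W then (matchDeg M v : ℤ) else -(matchDeg M v : ℤ)

/-- The unit vector at `x`. -/
def unitVec (x v : V) : ℤ := if v = x then 1 else 0

variable {G : SimpleGraph V} {W : Set V} {b : V → ℕ} {M : Finset (Sym2 V)}

theorem excess_toggle (hG : G.IsBipartiteWith W Wᶜ) {x y : V} {N : Finset (Sym2 V)}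
    (h : Res G W N x y) (v : V) :
    excess W (toggle N s(x, y)) v = excess W N v + unitVec x v - unitVec y v := by
  have hxy := mem_iff_of_adj hG h.1
  have hne := h.1.ne
  unfold excess toggle
  by_cases hx : x ∈ W
  · have hN := h.2.1 hx
    rw [if_neg hN, matchDeg_insert hN]
    have hy := hxy.1 hx
    unfold unitVec
    by_cases h1 : v = x
    · subst h1; simp [hx, hne]
    · by_cases h2 : v = y
      · subst h2; simp [hy, h1]; ring
      · simp [h1, h2]
  · have hN : s(x, y) ∈ N := by
      by_contra h'; exact hx (h.2.2 h')
    have hd := matchDeg_erase hN v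
    rw [if_pos hN]
    have hy : y ∈ W := by
      by_contra h'; exact hx (hxy.2 h')
    unfold unitVec
    by_cases h1 : v = x
    · subst h1; simp [hx, hne] at hd ⊢; omega
    · by_cases h2 : v = y
      · subst h2; simp [hy, h1] at hd ⊢; omega
      · simp [h1, h2] at hd ⊢; simp [hd]

/-- Reversing a residual path. The construction recurses on the vertex set `T` of the path: the
part after the last visit to `x` avoids `x`, so that it does not affect the first arc. -/
theorem exists_shift (hG : G.IsBipartiteWith W Wᶜ) (hM : ∀ e ∈ M, e ∈ G.edgeSet)
    (T : Finset V) {x y : V}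
    (h : ReflTransGen (fun u v => Res G W M u v ∧ u ∈ T ∧ v ∈ T) x y) :
    ∃ N : Finset (Sym2 V), (∀ e ∈ N, e ∈ G.edgeSet) ∧
      (∀ u v, (u ∉ T ∨ v ∉ T) → (s(u, v) ∈ N ↔ s(u, v) ∈ M)) ∧
      ∀ v, excess W N v = excess W M v + unitVec x v - unitVec y v := by
  induction T using Finset.strongInduction generalizing x y with
  | H T ih =>
    rcases exists_last_exit h with rfl | ⟨-, z, hz, ⟨hxz, hx, hzT⟩, hp⟩
    · exact ⟨M, hM, fun _ _ _ => Iff.rfl, fun v => by ring⟩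
    · obtain ⟨N, hN, hN1, hN2⟩ := ih (T.erase x) (Finset.erase_ssubset hx)
        (x := z) (y := y) (ReflTransGen.mono (fun u v huv => by
          simp only [Finset.mem_erase]; tauto) _ _ hp)
      have hm : s(x, z) ∈ N ↔ s(x, z) ∈ M := hN1 x z (by simp)
      have hr : Res G W N x z := ⟨hxz.1, by rw [hm]; exact hxz.2⟩
      refine ⟨toggle N s(x, z), ?_, ?_, ?_⟩
      · intro e he
        by_cases hee : e = s(x, z)
        · subst hee; exact hxz.1
        · exact hN e ((mem_toggle_of_ne hee).1 he)
      · intro u v huv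
        have : s(u, v) ≠ s(x, z) := by
          intro heq
          rcases Sym2.eq_iff.1 heq with ⟨rfl, rfl⟩ | ⟨rfl, rfl⟩ <;> tauto
        rw [mem_toggle_of_ne this]
        exact hN1 u v (by simp only [Finset.mem_erase]; tauto)
      · intro v
        rw [excess_toggle hG hr, hN2]; ring

theorem isMax_of_card (hM : IsMaxBMatching G b M) {N : Finset (Sym2 V)} (hN : IsBMatching G b N)
    (h : M.card ≤ N.card) : IsMaxBMatching G b N :=
  ⟨hN, fun N' hN' => (hM.2 N' hN').trans h⟩

theorem isFlexible_of_ne (hM : IsMaxBMatching G b M) {N : Finset (Sym2 V)}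
    (hN : IsMaxBMatching G b N) {e : Sym2 V} (h : e ∈ N ↔ e ∉ M) : IsFlexible G b e := by
  by_cases he : e ∈ M
  · exact ⟨⟨M, hM, he⟩, fun h' => (h.1 (h'.2 N hN)) he⟩
  · exact ⟨⟨N, hN, h.2 he⟩, fun h' => he (h'.2 M hM)⟩

theorem IsFlexible.mem_edgeSet {e : Sym2 V} (h : IsFlexible G b e) : e ∈ G.edgeSet := by
  obtain ⟨N, hN, he⟩ := h.1
  exact hN.1.1 e he

/-- The vertices that are reached in the residual digraph from loose vertices in `W`. -/
def hooked (G : SimpleGraph V) (W : Set V) (b : V → ℕ) (M : Finset (Sym2 V)) : Set V :=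
  {v | ∃ a ∈ W, IsLooseVertex b M a ∧ ReflTransGen (Res G W M) a v}

theorem hooked_closed {x y : V} (hx : x ∈ hooked G W b M) (h : Res G W M x y) :
    y ∈ hooked G W b M := by
  obtain ⟨a, ha, hl, hp⟩ := hx
  exact ⟨a, ha, hl, hp.tail h⟩

theorem le_of_excess {N : Finset (Sym2 V)} {v : V} {d : ℤ}
    (h : excess W N v = excess W M v + d) :
    (v ∈ W → (matchDeg N v : ℤ) = matchDeg M v + d) ∧
      (v ∉ W → (matchDeg N v : ℤ) = matchDeg M v - d) := by
  unfold excess at h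
  constructor <;> intro hv <;> simp [hv] at h <;> linarith

/-- The residual digraphs of the two colour classes are opposite to each other. -/
theorem res_compl (hG : G.IsBipartiteWith W Wᶜ) {x y : V} :
    Res G Wᶜ M x y ↔ Res G W M y x := by
  unfold Res
  rw [G.adj_comm y x, Sym2.eq_swap (a := y)]
  refine and_congr_right fun h => ?_
  have := mem_iff_of_adj hG h
  simp only [Set.mem_compl_iff]
  tauto

theorem not_isFlexible_of_zero {x y : V} (h : b x = 0) : ¬ IsFlexible G b s(x, y) := by
  rintro ⟨⟨N, hN, he⟩, -⟩
  have := matchDeg_pos he (Sym2.mem_mk_left x y)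
  have := hN.1.2 x
  omega

variable [Fintype V]

/-- Double counting of the ends that satisfy `κ`: an edge with two such ends is counted twice on the
right, and an edge with none is counted there once by the last term. -/
theorem card_add_card_filter (N : Finset (Sym2 V)) (hN : ∀ e ∈ N, e ∈ G.edgeSet) (κ : V → Prop)
    [DecidablePred κ] [DecidablePred fun e : Sym2 V => ∀ v ∈ e, κ v]
    [DecidablePred fun e : Sym2 V => ∀ v ∈ e, ¬ κ v] :
    N.card + (N.filter fun e => ∀ v ∈ e, κ v).card =
      ∑ v ∈ Finset.univ.filter κ, matchDeg N v + (N.filter fun e => ∀ v ∈ e, ¬ κ v).card := by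
  have h1 : ∑ v ∈ Finset.univ.filter κ, matchDeg N v =
      ∑ e ∈ N, ((Finset.univ.filter κ).filter fun v => v ∈ e).card := by
    unfold matchDeg
    exact Finset.sum_card_bipartiteAbove_eq_sum_card_bipartiteBelow (fun v e => v ∈ e)
  rw [h1, Finset.card_eq_sum_ones, Finset.card_filter, Finset.card_filter,
    ← Finset.sum_add_distrib, ← Finset.sum_add_distrib]
  refine Finset.sum_congr rfl fun e he => ?_
  have hadj := hN e he
  induction e using Sym2.ind with
  | _ x y =>
    have hne : x ≠ y := (G.mem_edgeSet.1 hadj).ne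
    have hf : ((Finset.univ.filter κ).filter fun v => v ∈ s(x, y)) =
        ({x, y} : Finset V).filter κ := by
      ext v; simp [and_comm]
    rw [hf, Finset.filter_insert, Finset.filter_singleton]
    by_cases hx : κ x <;> by_cases hy : κ y <;> simp [hx, hy, hne]

theorem card_eq_sum (hG : G.IsBipartiteWith W Wᶜ) {N : Finset (Sym2 V)}
    (hN : ∀ e ∈ N, e ∈ G.edgeSet) :
    (N.card : ℤ) = ∑ v ∈ (Set.toFinite W).toFinset, excess W N v := by
  classical
  have h := card_add_card_filter N hN (· ∈ W)
  have h1 : (N.filter fun e => ∀ v ∈ e, v ∈ W) = ∅ := by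
    refine Finset.filter_eq_empty_iff.2 fun e he => ?_
    have := hN e he
    induction e using Sym2.ind with
    | _ x y =>
      have := mem_iff_of_adj hG (G.mem_edgeSet.1 this)
      simp only [Sym2.mem_iff, forall_eq_or_imp, forall_eq]; tauto
  have h2 : (N.filter fun e => ∀ v ∈ e, ¬ v ∈ W) = ∅ := by
    refine Finset.filter_eq_empty_iff.2 fun e he => ?_
    have := hN e he
    induction e using Sym2.ind with
    | _ x y =>
      have := mem_iff_of_adj hG (G.mem_edgeSet.1 this)
      simp only [Sym2.mem_iff, forall_eq_or_imp, forall_eq]; tauto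
  rw [h1, h2] at h
  simp only [Finset.card_empty, add_zero] at h
  rw [h]
  push_cast
  refine Finset.sum_congr (by ext; simp) fun v hv => ?_
  simp only [Set.Finite.mem_toFinset] at hv
  simp [excess, hv]

/-- Reversing a path from `W` keeps the number of edges if the path ends in `W`, and otherwise
increases it by one. -/
theorem card_shift (hG : G.IsBipartiteWith W Wᶜ) {N N' : Finset (Sym2 V)}
    (hN : ∀ e ∈ N, e ∈ G.edgeSet) (hN' : ∀ e ∈ N', e ∈ G.edgeSet) {x y : V} (hx : x ∈ W)
    (h : ∀ v, excess W N' v = excess W N v + unitVec x v - unitVec y v) :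
    (y ∈ W → N'.card = N.card) ∧ (y ∉ W → N'.card = N.card + 1) := by
  classical
  have h1 := card_eq_sum hG hN
  have h2 := card_eq_sum hG hN'
  simp only [h, Finset.sum_add_distrib, Finset.sum_sub_distrib, ← h1, unitVec,
    Finset.sum_ite_eq', Set.Finite.mem_toFinset, hx, if_true] at h2
  constructor <;> intro hy <;> simp [hy] at h2 <;> omega

/-- Reversing a path from a loose vertex of `W` to a vertex of `W`. -/
theorem exists_max_shift (hG : G.IsBipartiteWith W Wᶜ) (hM : IsMaxBMatching G b M) (T : Finset V)
    {a x : V} (ha : a ∈ W) (hx : x ∈ W) (hl : IsLooseVertex b M a)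
    (h : ReflTransGen (fun u v => Res G W M u v ∧ u ∈ T ∧ v ∈ T) a x) :
    ∃ N, IsMaxBMatching G b N ∧ IsLooseVertex b N x ∧
      ∀ u v, (u ∉ T ∨ v ∉ T) → (s(u, v) ∈ N ↔ s(u, v) ∈ M) := by
  obtain ⟨N, hN, hN1, hN2⟩ := exists_shift hG hM.1.1 T h
  have hb := hM.1.2
  unfold IsLooseVertex at hl
  refine ⟨N, isMax_of_card hM ⟨hN, fun v => ?_⟩
    ((card_shift hG hM.1.1 hN ha hN2).1 hx).ge, ?_, hN1⟩
  · have := hN2 v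
    rw [add_sub_assoc] at this
    have h3 := le_of_excess this
    have hbv := hb v
    by_cases hv : v ∈ W
    · have h4 := h3.1 hv
      unfold unitVec at h4
      by_cases h5 : v = a
      · subst h5; split_ifs at h4 <;> simp at * <;> omega
      · rw [if_neg h5] at h4; split_ifs at h4 <;> omega
    · have h4 := h3.2 hv
      have h5 : v ≠ a := by rintro rfl; exact hv ha
      have h6 : v ≠ x := by rintro rfl; exact hv hx
      simp [unitVec, h5, h6] at h4; omega
  · have := hN2 x
    rw [add_sub_assoc] at this
    have h4 := (le_of_excess this).1 hx
    have hbx := hb x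
    unfold IsLooseVertex
    by_cases h5 : x = a
    · subst h5; simp [unitVec] at h4; omega
    · simp [unitVec, h5] at h4; omega

theorem exists_max_loose (hG : G.IsBipartiteWith W Wᶜ) (hM : IsMaxBMatching G b M)
    {x : V} (hx : x ∈ W) (h : x ∈ hooked G W b M) :
    ∃ N, IsMaxBMatching G b N ∧ IsLooseVertex b N x := by
  obtain ⟨a, ha, hl, hp⟩ := h
  obtain ⟨N, h1, h2, -⟩ := exists_max_shift hG hM Finset.univ ha hx hl (reflTransGen_univ hp)
  exact ⟨N, h1, h2⟩

/-- For a hooked vertex `x` outside `W`, stopping the path one step short of `x` yields a maximum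
`b`-matching with a loose vertex `w` next to `x`, in which the edges at `x` are still those of `M`. -/
theorem exists_max_shift_avoiding (hG : G.IsBipartiteWith W Wᶜ) (hM : IsMaxBMatching G b M)
    {x : V} (hx : x ∉ W) (h : x ∈ hooked G W b M) :
    ∃ N w, IsMaxBMatching G b N ∧ IsLooseVertex b N w ∧ Res G W M w x ∧
      ∀ u v, (u = x ∨ v = x) → (s(u, v) ∈ N ↔ s(u, v) ∈ M) := by
  obtain ⟨a, ha, hl, hp⟩ := h
  rcases exists_first_entry hp with rfl | ⟨-, w, hw, hwx, hq⟩
  · exact absurd ha hx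
  · have hwW : w ∈ W := (mem_iff_of_adj hG hwx.1).2 hx
    obtain ⟨N, h1, h2, h3⟩ := exists_max_shift hG hM (Finset.univ.erase x) ha hwW hl
      (ReflTransGen.mono (fun u v h => by simpa using h) _ _ hq)
    exact ⟨N, w, h1, h2, hwx, fun u v huv => h3 u v (by simpa using huv)⟩

/-- There is no augmenting path: a hooked vertex outside `W` is not loose. -/
theorem matchDeg_eq_of_hooked (hG : G.IsBipartiteWith W Wᶜ) (hM : IsMaxBMatching G b M)
    {x : V} (hx : x ∉ W) (h : x ∈ hooked G W b M) : matchDeg M x = b x := by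
  by_contra hne
  have hlt : matchDeg M x < b x := lt_of_le_of_ne (hM.1.2 x) hne
  obtain ⟨N, w, hN, hw, hwx, hNM⟩ := exists_max_shift_avoiding hG hM hx h
  have hwW : w ∈ W := (mem_iff_of_adj hG hwx.1).2 hx
  have he : s(w, x) ∉ N := by rw [hNM w x (Or.inr rfl)]; exact hwx.2.1 hwW
  have hd : matchDeg N x = matchDeg M x := by
    unfold matchDeg
    congr 1
    ext e
    simp only [Finset.mem_filter]
    refine and_congr_left fun hxe => ?_
    obtain ⟨y, rfl⟩ := hxe
    exact hNM x y (Or.inl rfl)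
  have hB : IsBMatching G b (insert s(w, x) N) := by
    refine ⟨fun e he => ?_, fun v => ?_⟩
    · rcases Finset.mem_insert.1 he with rfl | he
      · exact hwx.1
      · exact hN.1.1 e he
    · rw [matchDeg_insert he]
      have := hN.1.2 v
      unfold IsLooseVertex at hw
      split_ifs with h
      · rcases Sym2.mem_iff.1 h with rfl | rfl <;> omega
      · omega
  have := hN.2 _ hB
  rw [Finset.card_insert_of_notMem he] at this
  omega

open Classical in
/-- A set closed in the residual digraph that contains the loose vertices of `W` and none outside
`W` is a minimum cut: all maximum `b`-matchings agree on the edges that cross it, and no vertex of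
`W` outside it is ever loose. -/
theorem agree_of_cut (hG : G.IsBipartiteWith W Wᶜ) (hM : IsMaxBMatching G b M) {X : Set V}
    (hX : ∀ x y, x ∈ X → Res G W M x y → y ∈ X)
    (h1 : ∀ v ∈ W, IsLooseVertex b M v → v ∈ X) (h2 : ∀ v ∉ W, IsLooseVertex b M v → v ∉ X)
    {N : Finset (Sym2 V)} (hN : IsMaxBMatching G b N) :
    (∀ v ∈ W, v ∉ X → ¬ IsLooseVertex b N v) ∧
      ∀ x y, G.Adj x y → x ∉ X → y ∈ X → (s(x, y) ∈ N ↔ x ∉ W) := by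
  obtain ⟨κ, hκ⟩ : ∃ κ : V → Prop, ∀ v, κ v ↔ (v ∈ W ↔ v ∉ X) := ⟨_, fun _ => Iff.rfl⟩
  have iM := card_add_card_filter M hM.1.1 κ
  have iN := card_add_card_filter N hN.1.1 κ
  have hF : (M.filter fun e => ∀ v ∈ e, κ v) = ∅ := by
    refine Finset.filter_eq_empty_iff.2 fun e he => ?_
    have := hM.1.1 e he
    induction e using Sym2.ind with
    | _ x y =>
      have hadj := G.mem_edgeSet.1 this
      have := mem_iff_of_adj hG hadj
      have hr := hX x y
      have hr' := hX y x
      simp only [Res, hadj, hadj.symm, true_and, Sym2.eq_swap (a := y), he] at hr hr'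
      simp only [Sym2.mem_iff, forall_eq_or_imp, forall_eq, hκ]
      tauto
  have hC : (N.filter fun e => ∀ v ∈ e, ¬ κ v) ⊆ (M.filter fun e => ∀ v ∈ e, ¬ κ v) := by
    intro e he
    rw [Finset.mem_filter] at he ⊢
    refine ⟨?_, he.2⟩
    have hadj := hN.1.1 e he.1
    replace he := he.2
    induction e using Sym2.ind with
    | _ x y =>
      have hadj := G.mem_edgeSet.1 hadj
      have := mem_iff_of_adj hG hadj
      have hr := hX x y
      have hr' := hX y x
      simp only [Res, hadj, hadj.symm, true_and, Sym2.eq_swap (a := y)] at hr hr'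
      simp only [Sym2.mem_iff, forall_eq_or_imp, forall_eq, hκ] at he
      tauto
  have hMb : ∀ v ∈ Finset.univ.filter κ, matchDeg M v = b v := by
    intro v hv
    rw [Finset.mem_filter] at hv
    have hv := hv.2
    by_contra hne
    have hlt : IsLooseVertex b M v := lt_of_le_of_ne (hM.1.2 v) hne
    have h1 := h1 v
    have h2 := h2 v
    simp only [hκ] at hv
    tauto
  have hMs : ∑ v ∈ Finset.univ.filter κ, matchDeg M v = ∑ v ∈ Finset.univ.filter κ, b v :=
    Finset.sum_congr rfl hMb
  rw [hF, Finset.card_empty, add_zero, hMs] at iM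
  have hle : ∑ v ∈ Finset.univ.filter κ, matchDeg N v ≤ ∑ v ∈ Finset.univ.filter κ, b v :=
    Finset.sum_le_sum fun v _ => hN.1.2 v
  have hCc := Finset.card_le_card hC
  have hMN : M.card = N.card := le_antisymm (hN.2 M hM.1) (hM.2 N hN.1)
  have e1 : (N.filter fun e => ∀ v ∈ e, κ v).card = 0 := by omega
  have e2 : ∑ v ∈ Finset.univ.filter κ, matchDeg N v = ∑ v ∈ Finset.univ.filter κ, b v := by omega
  have e3 := Finset.eq_of_subset_of_card_le hC (by omega)
  have e4 := (Finset.sum_eq_sum_iff_of_le (fun v _ => hN.1.2 v)).1 e2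
  constructor
  · intro v hv hvX hl
    have := e4 v (by simp [hκ, hv, hvX])
    unfold IsLooseVertex at hl
    omega
  · intro x y hadj hx hy
    have hxy := mem_iff_of_adj hG hadj
    constructor
    · intro he hxW
      rw [Finset.card_eq_zero, Finset.filter_eq_empty_iff] at e1
      refine e1 he ?_
      simp only [Sym2.mem_iff, forall_eq_or_imp, forall_eq, hκ]
      tauto
    · intro hxW
      have : s(x, y) ∈ M.filter fun e => ∀ v ∈ e, ¬ κ v := by
        have hr := hX y x hy
        simp only [Res, hadj.symm, true_and, Sym2.eq_swap (a := y)] at hr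
        simp only [Finset.mem_filter, Sym2.mem_iff, forall_eq_or_imp, forall_eq, hκ]
        tauto
      rw [← e3] at this
      exact (Finset.mem_filter.1 this).1

theorem not_isFlexible_of_cut (hG : G.IsBipartiteWith W Wᶜ) (hM : IsMaxBMatching G b M) {X : Set V}
    (hX : ∀ x y, x ∈ X → Res G W M x y → y ∈ X)
    (h1 : ∀ v ∈ W, IsLooseVertex b M v → v ∈ X) (h2 : ∀ v ∉ W, IsLooseVertex b M v → v ∉ X)
    {x y : V} (hx : x ∉ X) (hy : y ∈ X) : ¬ IsFlexible G b s(x, y) := by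
  intro hf
  have hadj := G.mem_edgeSet.1 hf.mem_edgeSet
  obtain ⟨N, hN, he⟩ := hf.1
  have hxW := ((agree_of_cut hG hM hX h1 h2 hN).2 x y hadj hx hy).1 he
  exact hf.2 ⟨hf.1, fun N' hN' => ((agree_of_cut hG hM hX h1 h2 hN').2 x y hadj hx hy).2 hxW⟩

/-- The hooked vertices form a minimum cut, so that a vertex of `W` that is not hooked is
never loose. -/
theorem mem_looseSet_iff (hG : G.IsBipartiteWith W Wᶜ) (hM : IsMaxBMatching G b M) {v : V}
    (hv : v ∈ W) : v ∈ looseSet G b ↔ v ∈ hooked G W b M := by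
  constructor
  · rintro ⟨N, hN, hl⟩
    by_contra hX
    refine (agree_of_cut hG hM (X := hooked G W b M) (fun x y => hooked_closed)
      (fun u hu hul => ⟨u, hu, hul, .refl⟩) (fun u hu hul hX => ?_) hN).1 v hv hX hl
    have := matchDeg_eq_of_hooked hG hM hu hX
    unfold IsLooseVertex at hul
    omega
  · intro h
    exact exists_max_loose hG hM hv h

/-- Reversing a directed cycle changes no degree. -/
theorem isFlexible_of_cycle (hG : G.IsBipartiteWith W Wᶜ) (hM : IsMaxBMatching G b M) {x y : V}
    (h : Res G W M x y) (hp : ReflTransGen (Res G W M) y x) : IsFlexible G b s(x, y) := by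
  rcases exists_first_entry hp with rfl | ⟨-, w, hw, hwx, hq⟩
  · exact absurd rfl h.1.ne
  · obtain ⟨N, hN, hN1, hN2⟩ := exists_shift hG hM.1.1 (Finset.univ.erase x) (x := y) (y := w)
      (ReflTransGen.mono (fun u v h => by simpa using h) _ _ hq)
    have hwy : w ≠ y := by
      rintro rfl
      have := (res_compl hG).2 hwx
      have h' := h.2
      have h'' := this.2
      simp only [Set.mem_compl_iff] at h''
      tauto
    have r1 : Res G W N x y := ⟨h.1, by rw [hN1 x y (by simp)]; exact h.2⟩
    have hne : s(w, x) ≠ s(x, y) := by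
      intro heq
      rcases Sym2.eq_iff.1 heq with ⟨rfl, _⟩ | ⟨rfl, _⟩
      · exact hw rfl
      · exact hwy rfl
    have r2 : Res G W (toggle N s(x, y)) w x :=
      ⟨hwx.1, by rw [mem_toggle_of_ne hne, hN1 w x (by simp)]; exact hwx.2⟩
    have hex : ∀ v, excess W (toggle (toggle N s(x, y)) s(w, x)) v = excess W M v := by
      intro v
      rw [excess_toggle hG r2, excess_toggle hG r1, hN2]; ring
    have hE : ∀ e ∈ toggle (toggle N s(x, y)) s(w, x), e ∈ G.edgeSet := by
      intro e he
      by_cases h1 : e = s(w, x)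
      · subst h1; exact hwx.1
      · rw [mem_toggle_of_ne h1] at he
        by_cases h2 : e = s(x, y)
        · subst h2; exact h.1
        · rw [mem_toggle_of_ne h2] at he; exact hN e he
    refine isFlexible_of_ne hM (N := toggle (toggle N s(x, y)) s(w, x)) (isMax_of_card hM ⟨hE, ?_⟩ ?_) ?_
    · intro v
      have h3 := le_of_excess (d := 0) ((hex v).trans (add_zero _).symm)
      have := hM.1.2 v
      by_cases hv : v ∈ W
      · have := h3.1 hv; omega
      · have := h3.2 hv; omega
    · have h1 := card_eq_sum hG hE
      simp only [hex] at h1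
      rw [← card_eq_sum hG hM.1.1] at h1
      omega
    · rw [mem_toggle_of_ne hne.symm, mem_toggle_self, hN1 x y (by simp)]

theorem isFlexible_of_hooked (hG : G.IsBipartiteWith W Wᶜ) (hM : IsMaxBMatching G b M) {x y : V}
    (h : Res G W M x y) (hx : x ∈ hooked G W b M) (hy : 0 < b y) : IsFlexible G b s(x, y) := by
  have hxy := mem_iff_of_adj hG h.1
  by_cases hxW : x ∈ W
  · -- `x` is loose in some maximum `b`-matching; exchange an edge at `y` for `xy` there
    have he := h.2.1 hxW
    obtain ⟨N, hN, hl⟩ := exists_max_loose hG hM hxW hx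
    by_cases heN : s(x, y) ∈ N
    · exact isFlexible_of_ne hM hN (by tauto)
    have hyd : matchDeg N y = b y :=
      matchDeg_eq_of_hooked hG hN (hxy.1 hxW)
        ⟨x, hxW, hl, .single ⟨h.1, by tauto⟩⟩
    obtain ⟨f, hf⟩ := Finset.card_pos.1 (show 0 < (N.filter fun e => y ∈ e).card by
      unfold matchDeg at hyd; omega)
    obtain ⟨hfN, hyf⟩ := Finset.mem_filter.1 hf
    have hxf : x ∉ f := by
      intro hxf
      have := (Sym2.mem_and_mem_iff h.1.ne).1 ⟨hxf, hyf⟩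
      subst this; exact heN hfN
    have heN' : s(x, y) ∉ N.erase f := fun h' => heN (Finset.mem_of_mem_erase h')
    refine isFlexible_of_ne hM (N := insert s(x, y) (N.erase f)) (isMax_of_card hN ⟨?_, ?_⟩ ?_) ?_
    · intro e he
      rcases Finset.mem_insert.1 he with rfl | he
      · exact h.1
      · exact hN.1.1 e (Finset.mem_of_mem_erase he)
    · intro v
      rw [matchDeg_insert heN']
      have h1 := matchDeg_erase hfN v
      have h2 := hN.1.2 v
      unfold IsLooseVertex at hl
      split_ifs with h3
      · rcases Sym2.mem_iff.1 h3 with rfl | rfl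
        · simp only [hxf, if_false] at h1; omega
        · simp only [hyf, if_true] at h1; omega
      · omega
    · rw [Finset.card_insert_of_notMem heN', Finset.card_erase_of_mem hfN]; omega
    · simp [he]
  · have heM : s(x, y) ∈ M := by
      by_contra h'; exact hxW (h.2.2 h')
    obtain ⟨N, w, hN, hw, hwx, hNM⟩ := exists_max_shift_avoiding hG hM hxW hx
    have hwW : w ∈ W := (mem_iff_of_adj hG hwx.1).2 hxW
    have hwN : s(w, x) ∉ N := by rw [hNM w x (Or.inr rfl)]; exact hwx.2.1 hwW
    have heN : s(x, y) ∈ N := (hNM x y (Or.inl rfl)).2 heM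
    have hwy : s(x, y) ≠ s(w, x) := by rintro h'; rw [h'] at heN; exact hwN heN
    have hw' : s(w, x) ∉ N.erase s(x, y) := fun h' => hwN (Finset.mem_of_mem_erase h')
    refine isFlexible_of_ne hM (N := insert s(w, x) (N.erase s(x, y)))
      (isMax_of_card hN ⟨?_, ?_⟩ ?_) ?_
    · intro e he
      rcases Finset.mem_insert.1 he with rfl | he
      · exact hwx.1
      · exact hN.1.1 e (Finset.mem_of_mem_erase he)
    · intro v
      rw [matchDeg_insert hw']
      have h1 := matchDeg_erase heN v
      have h2 := hN.1.2 v
      unfold IsLooseVertex at hw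
      split_ifs with h3
      · rcases Sym2.mem_iff.1 h3 with rfl | rfl
        · omega
        · simp only [Sym2.mem_mk_left, if_true] at h1; omega
      · omega
    · rw [Finset.card_insert_of_notMem hw', Finset.card_erase_of_mem heN]; omega
    · simp [hwy, heM]

end Theory

/-! ### Flexible components and their order -/

section Components

open Relation

/-- The residual digraph of `M`, together with the reversals of those of its arcs that are flexible
because they can be reached from loose vertices. Its strongly connected components are the flexible
components. -/
def Aug {V : Type*} [DecidableEq V] (G : SimpleGraph V) (W : Set V) (b : V → ℕ)
    (M : Finset (Sym2 V)) (x y : V) : Prop :=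
  Res G W M x y ∨
    Res G W M y x ∧ ((y ∈ hooked G W b M ∧ 0 < b x) ∨ (x ∈ hooked G Wᶜ b M ∧ 0 < b y))

variable {V : Type*} [DecidableEq V] {G : SimpleGraph V} {W : Set V} {b : V → ℕ}
  {M : Finset (Sym2 V)}

theorem reflTransGen_res_compl (hG : G.IsBipartiteWith W Wᶜ) {x y : V}
    (h : ReflTransGen (Res G W M) x y) : ReflTransGen (Res G Wᶜ M) y x := by
  induction h with
  | refl => exact .refl
  | tail _ h ih => exact ih.head ((res_compl hG).2 h)

theorem res_or_res (hG : G.IsBipartiteWith W Wᶜ) {x y : V} (h : G.Adj x y) :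
    Res G W M x y ∨ Res G W M y x := by
  have := mem_iff_of_adj hG h
  simp only [Res, h, h.symm, true_and, Sym2.eq_swap (a := y)]
  tauto

theorem flexGraph_adj {x y : V} : (flexGraph G b).Adj x y ↔ IsFlexible G b s(x, y) := by
  unfold flexGraph
  rw [SimpleGraph.fromEdgeSet_adj]
  refine ⟨fun h => h.1, fun h => ⟨h, ?_⟩⟩
  exact (G.mem_edgeSet.1 h.mem_edgeSet).ne

theorem mem_of_reflTransGen {α : Type*} {r : α → α → Prop} {X : Set α}
    (hX : ∀ u v, u ∈ X → r u v → v ∈ X) {x y : α} (h : ReflTransGen r x y) (hx : x ∈ X) :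
    y ∈ X := by
  induction h with
  | refl => exact hx
  | tail _ h ih => exact hX _ _ ih h

/-- A vertex `v` with `b v = 0` lies on no flexible edge. -/
theorem supp_eq_singleton {v : V} (hv : b v = 0) :
    ((flexGraph G b).connectedComponentMk v).supp = {v} := by
  ext w
  simp only [SimpleGraph.ConnectedComponent.mem_supp_iff, Set.mem_singleton_iff,
    SimpleGraph.ConnectedComponent.eq]
  constructor
  · intro h
    rw [SimpleGraph.reachable_comm, SimpleGraph.reachable_iff_reflTransGen] at h
    refine mem_of_reflTransGen (X := {v}) ?_ h rfl
    rintro u w rfl h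
    exact absurd (flexGraph_adj.1 h) (not_isFlexible_of_zero hv)
  · rintro rfl; exact .refl _

theorem mem_iff_of_res_of_zero (hM : IsMaxBMatching G b M) {x y : V} (h : Res G W M x y) :
    (b x = 0 → x ∈ W) ∧ (b y = 0 → x ∈ W) := by
  have key : ∀ v ∈ s(x, y), b v = 0 → x ∈ W := by
    intro v hv h0
    by_contra hx
    have := matchDeg_pos (by_contra fun h' => hx (h.2.2 h') : s(x, y) ∈ M) hv
    have := hM.1.2 v
    omega
  exact ⟨key x (by simp), key y (by simp)⟩

theorem status_of_not_isFlexible (hM : IsMaxBMatching G b M) {e : Sym2 V} (he : e ∈ G.edgeSet)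
    (hf : ¬ IsFlexible G b e) : (e ∈ M → IsInevitable G b e) ∧ (e ∉ M → IsForbidden G b e) := by
  constructor
  · intro h
    by_contra h'
    exact hf ⟨⟨M, hM, h⟩, h'⟩
  · intro h
    refine ⟨he, fun h' => hf ⟨h', fun h'' => h (h''.2 M hM)⟩⟩

theorem isInconsistent_iff {C : FlexComp G b} :
    IsInconsistent G b C ↔ IsHookedUp G b W C ∨ IsHookedUp G b Wᶜ C := by
  unfold IsInconsistent IsHookedUp
  simp only [Set.mem_compl_iff]
  constructor
  · rintro (⟨v, h1, h2⟩ | ⟨v, h1, h2, w, h3, h4⟩)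
    · by_cases h : v ∈ W
      · exact Or.inl (Or.inl ⟨v, h1, h2, h⟩)
      · exact Or.inr (Or.inl ⟨v, h1, h2, h⟩)
    · by_cases h : w ∈ W
      · exact Or.inl (Or.inr ⟨v, h1, h2, w, h3, h, h4⟩)
      · exact Or.inr (Or.inr ⟨v, h1, h2, w, h3, h, h4⟩)
  · rintro ((⟨v, h1, h2, _⟩ | ⟨v, h1, h2, w, h3, _, h4⟩) |
      (⟨v, h1, h2, _⟩ | ⟨v, h1, h2, w, h3, _, h4⟩))
    · exact Or.inl ⟨v, h1, h2⟩
    · exact Or.inr ⟨v, h1, h2, w, h3, h4⟩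
    · exact Or.inl ⟨v, h1, h2⟩
    · exact Or.inr ⟨v, h1, h2, w, h3, h4⟩

/-- The arcs of the residual digraph, seen in the set of flexible components and reversed, generate
the same order as `flexStep`. -/
def compArc (G : SimpleGraph V) (b : V → ℕ) (W : Set V) (M : Finset (Sym2 V))
    (C D : FlexComp G b) : Prop :=
  ∃ x y, Res G W M x y ∧ (flexGraph G b).connectedComponentMk y = C ∧
    (flexGraph G b).connectedComponentMk x = D

theorem compArc_of_flexStep (hM : IsMaxBMatching G b M)
    {C D : FlexComp G b} (h : flexStep G b W C D) : C = D ∨ compArc G b W M C D := by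
  rcases h with h | ⟨u, hu, v, hv, h⟩ | ⟨u, hu, v, hv, h⟩
  · exact Or.inl h
  · refine Or.inr ⟨v, u, ?_, hu.1, hv.1⟩
    have hm := h.2 M hM
    have hadj := G.mem_edgeSet.1 (hM.1.1 _ hm)
    have := hv.2
    exact ⟨hadj.symm, by rw [Sym2.eq_swap]; tauto⟩
  · refine Or.inr ⟨u, v, ⟨h.1, ?_⟩, hv.1, hu.1⟩
    have h1 := hu.2
    have : s(u, v) ∉ M := fun h' => h.2 ⟨M, hM, h'⟩
    tauto

theorem flexStep_of_compArc (hG : G.IsBipartiteWith W Wᶜ) (hM : IsMaxBMatching G b M)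
    {C D : FlexComp G b} (h : compArc G b W M C D) : flexStep G b W C D := by
  obtain ⟨x, y, h, rfl, rfl⟩ := h
  have hxy := mem_iff_of_adj hG h.1
  by_cases hf : IsFlexible G b s(x, y)
  · exact Or.inl (SimpleGraph.ConnectedComponent.eq.2 (flexGraph_adj.2 hf).reachable.symm)
  have hst := status_of_not_isFlexible hM (G.mem_edgeSet.2 h.1) hf
  have hr := h.2
  by_cases hx : x ∈ W
  · exact Or.inr (Or.inr ⟨x, ⟨rfl, hx⟩, y, ⟨rfl, hxy.1 hx⟩, hst.2 (hr.1 hx)⟩)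
  · refine Or.inr (Or.inl ⟨y, ⟨rfl, by tauto⟩, x, ⟨rfl, hx⟩, ?_⟩)
    rw [Sym2.eq_swap]
    exact hst.1 (by tauto)

theorem flexOrder_eq (hG : G.IsBipartiteWith W Wᶜ) (hM : IsMaxBMatching G b M) :
    flexOrder G b W = ReflTransGen (compArc G b W M) := by
  funext C D
  refine propext ⟨fun h => ?_, fun h => ?_⟩
  · induction h with
    | refl => exact .refl
    | tail _ h ih =>
      rcases compArc_of_flexStep hM h with rfl | h
      · exact ih
      · exact ih.tail h
  · exact ReflTransGen.mono (fun _ _ h => flexStep_of_compArc hG hM h) _ _ h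

variable [Fintype V]

theorem isFlexible_of_aug_reverse (hG : G.IsBipartiteWith W Wᶜ) (hM : IsMaxBMatching G b M)
    {x y : V} (h : Res G W M y x)
    (h' : (y ∈ hooked G W b M ∧ 0 < b x) ∨ (x ∈ hooked G Wᶜ b M ∧ 0 < b y)) :
    IsFlexible G b s(x, y) := by
  rcases h' with h' | h'
  · rw [Sym2.eq_swap]; exact isFlexible_of_hooked hG hM h h'.1 h'.2
  · exact isFlexible_of_hooked (isBipartiteWith_compl hG) hM ((res_compl hG).2 h) h'.1 h'.2

/-- An arc of the residual digraph that is not flexible is a one-way passage in `Aug`. -/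
theorem exists_aug_closed (hG : G.IsBipartiteWith W Wᶜ) (hM : IsMaxBMatching G b M) {x y : V}
    (h : Res G W M x y) (hf : ¬ IsFlexible G b s(x, y)) :
    ∃ X : Set V, y ∈ X ∧ x ∉ X ∧ ∀ u v, u ∈ X → Aug G W b M u v → v ∈ X := by
  have hne := h.1.ne
  have hxy := mem_iff_of_adj hG h.1
  by_cases hy : b y = 0
  · refine ⟨{y}, rfl, hne, ?_⟩
    rintro u v rfl (h1 | ⟨h1, h2⟩)
    · have h3 := (mem_iff_of_res_of_zero hM h).2 hy
      have h4 := (mem_iff_of_res_of_zero hM h1).1 hy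
      tauto
    · exact absurd (isFlexible_of_aug_reverse hG hM h1 h2) (not_isFlexible_of_zero hy)
  by_cases hx : b x = 0
  · refine ⟨{x}ᶜ, hne.symm, by simp, ?_⟩
    rintro u v - h1 rfl
    rcases h1 with h1 | ⟨h1, h2⟩
    · have h3 := (mem_iff_of_res_of_zero hM h).1 hx
      have h4 := (mem_iff_of_res_of_zero hM h1).2 hx
      have h5 := mem_iff_of_adj hG h1.1
      tauto
    · have := isFlexible_of_aug_reverse hG hM h1 h2
      rw [Sym2.eq_swap] at this
      exact not_isFlexible_of_zero hx this
  have hxA : x ∉ hooked G W b M := fun h' =>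
    hf (isFlexible_of_hooked hG hM h h' (Nat.pos_of_ne_zero hy))
  have hyB : y ∉ hooked G Wᶜ b M := fun h' => hf <| by
    have := isFlexible_of_hooked (isBipartiteWith_compl hG) hM ((res_compl hG).2 h) h'
      (Nat.pos_of_ne_zero hx)
    rwa [Sym2.eq_swap]
  have hcyc : ¬ ReflTransGen (Res G W M) y x := fun h' => hf (isFlexible_of_cycle hG hM h h')
  refine ⟨hooked G W b M ∪ {v | ReflTransGen (Res G W M) y v}, Or.inr .refl, ?_, ?_⟩
  · rintro (h' | h')
    · exact hxA h'
    · exact hcyc h'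
  have hcl : ∀ u v, u ∈ hooked G W b M ∪ {v | ReflTransGen (Res G W M) y v} → Res G W M u v →
      v ∈ hooked G W b M ∪ {v | ReflTransGen (Res G W M) y v} := by
    rintro u v (hu | hu) h'
    · exact Or.inl (hooked_closed hu h')
    · exact Or.inr (ReflTransGen.tail hu h')
  rintro u v hu (h1 | ⟨h1, h2⟩)
  · exact hcl u v hu h1
  · by_contra hv
    refine not_isFlexible_of_cut hG hM hcl (fun w hw hl => Or.inl ⟨w, hw, hl, .refl⟩) ?_ hv hu ?_
    · rintro w hw hl (h' | h')
      · have := matchDeg_eq_of_hooked hG hM hw h'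
        unfold IsLooseVertex at hl
        omega
      · exact hyB ⟨w, hw, hl, reflTransGen_res_compl hG h'⟩
    · rw [Sym2.eq_swap]; exact isFlexible_of_aug_reverse hG hM h1 h2

/-- The head of a flexible residual arc reaches its tail in `Aug`; otherwise the vertices that are
hooked or reached from the head would form a cut that the arc crosses. -/
theorem aug_of_isFlexible (hG : G.IsBipartiteWith W Wᶜ) (hM : IsMaxBMatching G b M) {x y : V}
    (h : Res G W M x y) (hf : IsFlexible G b s(x, y)) :
    ReflTransGen (Aug G W b M) y x := by
  have hb := @not_isFlexible_of_zero V _ G b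
  have hx : b x ≠ 0 := fun h' => hb h' hf
  have hy : b y ≠ 0 := fun h' => hb h' (by rwa [Sym2.eq_swap] at hf)
  by_contra hcon
  have hxA : x ∉ hooked G W b M := fun h' =>
    hcon (.single (Or.inr ⟨h, Or.inl ⟨h', Nat.pos_of_ne_zero hy⟩⟩))
  have hyB : y ∉ hooked G Wᶜ b M := fun h' =>
    hcon (.single (Or.inr ⟨h, Or.inr ⟨h', Nat.pos_of_ne_zero hx⟩⟩))
  have hcyc : ¬ ReflTransGen (Res G W M) y x := fun h' =>
    hcon (ReflTransGen.mono (fun _ _ h => Or.inl h) _ _ h')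
  refine not_isFlexible_of_cut hG hM
    (X := hooked G W b M ∪ {v | ReflTransGen (Res G W M) y v}) (x := x) (y := y) ?_
    (fun w hw hl => Or.inl ⟨w, hw, hl, .refl⟩) ?_ ?_ (Or.inr .refl) hf
  · rintro u v (hu | hu) h'
    · exact Or.inl (hooked_closed hu h')
    · exact Or.inr (ReflTransGen.tail hu h')
  · rintro w hw hl (h' | h')
    · have := matchDeg_eq_of_hooked hG hM hw h'
      unfold IsLooseVertex at hl
      omega
    · exact hyB ⟨w, hw, hl, reflTransGen_res_compl hG h'⟩
  · rintro (h' | h')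
    · exact hxA h'
    · exact hcyc h'

theorem isFlexible_of_aug_cycle (hG : G.IsBipartiteWith W Wᶜ) (hM : IsMaxBMatching G b M) {x y : V}
    (h : Aug G W b M x y) (h' : ReflTransGen (Aug G W b M) y x) : IsFlexible G b s(x, y) := by
  rcases h with h | ⟨h1, h2⟩
  · by_contra hf
    obtain ⟨X, hy, hx, hX⟩ := exists_aug_closed hG hM h hf
    exact hx (mem_of_reflTransGen hX h' hy)
  · exact isFlexible_of_aug_reverse hG hM h1 h2

theorem mk_eq_iff (hG : G.IsBipartiteWith W Wᶜ) (hM : IsMaxBMatching G b M) {x y : V} :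
    (flexGraph G b).connectedComponentMk x = (flexGraph G b).connectedComponentMk y ↔
      ReflTransGen (Aug G W b M) x y ∧ ReflTransGen (Aug G W b M) y x := by
  rw [SimpleGraph.ConnectedComponent.eq, SimpleGraph.reachable_iff_reflTransGen]
  constructor
  · intro h
    induction h with
    | refl => exact ⟨.refl, .refl⟩
    | @tail u v _ h ih =>
      rw [flexGraph_adj] at h
      rcases res_or_res (M := M) hG (G.mem_edgeSet.1 h.mem_edgeSet) with hr | hr
      · exact ⟨ih.1.tail (Or.inl hr), (aug_of_isFlexible hG hM hr h).trans ih.2⟩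
      · rw [Sym2.eq_swap] at h
        exact ⟨ih.1.trans (aug_of_isFlexible hG hM hr h), ih.2.head (Or.inl hr)⟩
  · rintro ⟨h, h'⟩
    induction h with
    | refl => exact .refl
    | @tail u v huv h ih =>
      exact (ih (h'.head h)).tail
        (flexGraph_adj.2 (isFlexible_of_aug_cycle hG hM h (h'.trans huv)))

theorem aug_of_compArc (hG : G.IsBipartiteWith W Wᶜ) (hM : IsMaxBMatching G b M)
    {C D : FlexComp G b} (h : ReflTransGen (compArc G b W M) C D) {c d : V}
    (hc : (flexGraph G b).connectedComponentMk c = C)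
    (hd : (flexGraph G b).connectedComponentMk d = D) : ReflTransGen (Aug G W b M) d c := by
  induction h generalizing d with
  | refl => exact ((mk_eq_iff hG hM).1 (hc.trans hd.symm)).2
  | tail _ h ih =>
    obtain ⟨x, y, h, rfl, rfl⟩ := h
    exact ((mk_eq_iff hG hM).1 hd).1.trans ((ih rfl).head (Or.inl h))

theorem isPartialOrder_flexOrder (hG : G.IsBipartiteWith W Wᶜ) (hM : IsMaxBMatching G b M) :
    IsPartialOrder (FlexComp G b) (flexOrder G b W) where
  refl _ := .refl
  trans _ _ _ := ReflTransGen.trans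
  antisymm C D h h' := by
    rw [flexOrder_eq hG hM] at h h'
    induction C using SimpleGraph.ConnectedComponent.ind with
    | _ c =>
      induction D using SimpleGraph.ConnectedComponent.ind with
      | _ d =>
        exact (mk_eq_iff hG hM).2 ⟨aug_of_compArc hG hM h' rfl rfl, aug_of_compArc hG hM h rfl rfl⟩

theorem isHookedUp_of_mem (hG : G.IsBipartiteWith W Wᶜ) (hM : IsMaxBMatching G b M) {v : V}
    (h : v ∈ hooked G W b M) : IsHookedUp G b W ((flexGraph G b).connectedComponentMk v) := by
  by_cases hv : v ∈ W
  · exact Or.inl ⟨v, rfl, (mem_looseSet_iff hG hM hv).2 h, hv⟩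
  obtain ⟨a, ha, hl, hp⟩ := h
  obtain ⟨w, hw, hwv⟩ : ∃ w ∈ hooked G W b M, Res G W M w v := by
    rcases ReflTransGen.cases_tail hp with rfl | ⟨w, hw, hwv⟩
    · exact absurd ha hv
    · exact ⟨w, ⟨a, ha, hl, hw⟩, hwv⟩
  have hwW : w ∈ W := (mem_iff_of_adj hG hwv.1).2 hv
  have hwl := (mem_looseSet_iff hG hM hwW).2 hw
  by_cases hb : b v = 0
  · exact Or.inr ⟨v, supp_eq_singleton hb, hb, w, hwl, hwW, hwv.1.symm⟩
  · refine Or.inl ⟨w, ?_, hwl, hwW⟩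
    exact SimpleGraph.ConnectedComponent.eq.2 (flexGraph_adj.2
      (isFlexible_of_hooked hG hM hwv hw (Nat.pos_of_ne_zero hb))).reachable

/-- If a flexible component is hooked up by `W`, then all its vertices are reached from loose
vertices of `W`. -/
theorem mem_of_isHookedUp (hG : G.IsBipartiteWith W Wᶜ) (hM : IsMaxBMatching G b M) {v : V}
    (h : IsHookedUp G b W ((flexGraph G b).connectedComponentMk v)) : v ∈ hooked G W b M := by
  rcases h with ⟨w, hw, hwl, hwW⟩ | ⟨u, hu, hu0, w, hwl, hwW, hadj⟩
  · have hwh := (mem_looseSet_iff hG hM hwW).1 hwl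
    rw [SimpleGraph.ConnectedComponent.mem_supp_iff, mk_eq_iff hG hM] at hw
    -- the hooked vertices form a cut, which no flexible edge crosses
    refine mem_of_reflTransGen (fun x y hx hxy => ?_) hw.1 hwh
    rcases hxy with h1 | ⟨h1, h2⟩
    · exact hooked_closed hx h1
    · by_contra hy
      refine not_isFlexible_of_cut hG hM (X := hooked G W b M) (fun x y => hooked_closed)
        (fun u hu hul => ⟨u, hu, hul, .refl⟩) (fun u hu hul hX => ?_) hy hx
        (by rw [Sym2.eq_swap]; exact isFlexible_of_aug_reverse hG hM h1 h2)
      have := matchDeg_eq_of_hooked hG hM hu hX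
      unfold IsLooseVertex at hul
      omega
  · have hvu : v = u := by
      have : v ∈ ((flexGraph G b).connectedComponentMk v).supp := rfl
      rw [hu] at this
      exact this
    subst hvu
    have hwh := (mem_looseSet_iff hG hM hwW).1 hwl
    refine hooked_closed hwh ⟨hadj.symm, iff_of_true hwW fun h' => ?_⟩
    have := matchDeg_pos h' (Sym2.mem_mk_right w v)
    have := hM.1.2 v
    omega

theorem isHookedUp_iff (hG : G.IsBipartiteWith W Wᶜ) (hM : IsMaxBMatching G b M) {v : V} :
    IsHookedUp G b W ((flexGraph G b).connectedComponentMk v) ↔ v ∈ hooked G W b M :=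
  ⟨mem_of_isHookedUp hG hM, isHookedUp_of_mem hG hM⟩

end Components

/-! ### Depth-first search and Kosaraju's theorem -/

section Search

open Relation

/-- The digraph on the natural numbers with the arcs from `src j` to `dst j` for `j < N`. -/
def Edge (src dst : ℕ → ℕ) (N x y : ℕ) : Prop := ∃ j < N, src j = x ∧ dst j = y

/-- Reachability in the digraph `Edge src dst N`. -/
abbrev Reach (src dst : ℕ → ℕ) (N : ℕ) : ℕ → ℕ → Prop := ReflTransGen (Edge src dst N)

/-- The property of a list of vertices, most recently finished first, that depth-first search
ensures: if an earlier finished `x` reaches `y`, then something in the strongly connected component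
of `x` did not finish before `y`. -/
def FinishOrder (R : ℕ → ℕ → Prop) : List ℕ → Prop
  | [] => True
  | y :: T => FinishOrder R T ∧ ∀ x ∈ T, R x y → ∃ x', x' ∉ T ∧ R x x' ∧ R x' x

theorem FinishOrder.of_append {R : ℕ → ℕ → Prop} {l l' : List ℕ} (h : FinishOrder R (l ++ l')) :
    FinishOrder R l' := by
  induction l with
  | nil => exact h
  | cons _ _ ih => exact ih h.1

/-- A configuration of the depth-first search: the active vertices and the finished ones (both most
recent first), the processed and the remaining start vertices, the arcs not yet scanned at each
vertex, the labels (zero for vertices not yet visited) and the number of labels. The last two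
components are not stored by the program: the start vertex that received a label, and the start
vertices before it. -/
structure Config where
  active : List ℕ
  finished : List ℕ
  done : List ℕ
  todo : List ℕ
  rem : ℕ → List ℕ
  mark : ℕ → ℕ
  label : ℕ
  pre : ℕ → List ℕ
  root : ℕ → ℕ

/-- The invariant of the depth-first search with start vertices `o`. The field `back` is what makes
finishing a vertex `u` preserve `finishOrder`: a finished `x` that reaches `u` is strongly connected
to an active vertex, which is not finished before `u`. -/
structure Config.Inv (src dst : ℕ → ℕ) (n N : ℕ) (o : List ℕ) (c : Config) : Prop where
  nodup : (c.active ++ c.finished).Nodup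
  marked : ∀ v, c.mark v ≠ 0 ↔ v ∈ c.active ∨ v ∈ c.finished
  lt : ∀ v, c.mark v ≠ 0 → v < n
  chain : c.active.Pairwise fun x y => Reach src dst N y x
  rem_sound : ∀ u, ∀ j ∈ c.rem u, j < N ∧ src j = u
  rem_cover : ∀ j < N, j ∈ c.rem (src j) ∨ c.mark (dst j) ≠ 0
  rem_finished : ∀ u ∈ c.finished, c.rem u = []
  back : ∀ x ∈ c.finished, ∀ g ∈ c.active, Reach src dst N x g →
    ∃ g' ∈ c.active, Reach src dst N x g' ∧ Reach src dst N g' x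
  finishOrder : FinishOrder (Reach src dst N) c.finished
  split : c.done ++ c.todo = o
  done_marked : ∀ y ∈ c.done, c.mark y ≠ 0
  label_le : ∀ v, c.mark v ≤ c.label
  active_label : ∀ g ∈ c.active, c.mark g = c.label
  root_label : ∀ k, 1 ≤ k → k ≤ c.label →
    c.mark (c.root k) = k ∧ (c.pre k ++ [c.root k]) <+: c.done
  first : ∀ v, c.mark v ≠ 0 → Reach src dst N (c.root (c.mark v)) v ∧
    ∀ y ∈ c.pre (c.mark v), ¬ Reach src dst N y v

/-- A bound on the number of steps left. -/
def Config.fuel (n : ℕ) (c : Config) : ℕ :=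
  ∑ u ∈ Finset.range n, (c.rem u).length + (n - c.finished.length) + c.todo.length

variable {src dst : ℕ → ℕ} {n N : ℕ} {o : List ℕ} {c : Config}

/-- A path from a visited vertex meets an active vertex unless it stays among the finished ones. -/
theorem Config.Inv.exit (h : c.Inv src dst n N o) {x y : ℕ}
    (hx : c.mark x ≠ 0) (hp : Reach src dst N x y) :
    y ∈ c.finished ∨ ∃ g ∈ c.active, Reach src dst N x g ∧ Reach src dst N g y := by
  induction hp with
  | refl =>
    rcases (h.marked x).1 hx with hx | hx
    · exact Or.inr ⟨x, hx, .refl, .refl⟩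
    · exact Or.inl hx
  | @tail y z hxy hyz ih =>
    rcases ih with hy | ⟨g, hg, h1, h2⟩
    · obtain ⟨j, hj, rfl, rfl⟩ := hyz
      rcases h.rem_cover j hj with h' | h'
      · rw [h.rem_finished _ hy] at h'
        simp at h'
      · rcases (h.marked _).1 h' with h' | h'
        · exact Or.inr ⟨dst j, h', hxy.tail ⟨j, hj, rfl, rfl⟩, .refl⟩
        · exact Or.inl h'
    · exact Or.inr ⟨g, hg, h1, h2.tail hyz⟩

theorem Config.Inv.length_le (h : c.Inv src dst n N o) :
    c.active.length + c.finished.length ≤ n := by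
  have h1 : (c.active ++ c.finished).toFinset ⊆ Finset.range n := by
    intro v hv
    rw [List.mem_toFinset, List.mem_append, ← h.marked] at hv
    exact Finset.mem_range.2 (h.lt v hv)
  have h2 := Finset.card_le_card h1
  rw [List.toFinset_card_of_nodup h.nodup, List.length_append, Finset.card_range] at h2
  exact h2

/-- Finishing the top of the stack once all its arcs have been scanned. -/
theorem Config.Inv.pop (h : c.Inv src dst n N o) {u : ℕ} {S : List ℕ} (hS : c.active = u :: S)
    (hu : c.rem u = []) :
    ({c with active := S, finished := u :: c.finished} : Config).Inv src dst n N o := by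
  have hnd := h.nodup
  have hch := h.chain
  rw [hS, List.cons_append, List.nodup_cons, List.mem_append] at hnd
  rw [hS, List.pairwise_cons] at hch
  have hback : ∀ x ∈ c.finished, ∀ g ∈ S, Reach src dst N x g →
      ∃ g' ∈ S, Reach src dst N x g' ∧ Reach src dst N g' x := by
    intro x hx g hg hxg
    obtain ⟨g', hg', h1, h2⟩ := h.back x hx g (by simp [hS, hg]) hxg
    rw [hS, List.mem_cons] at hg'
    rcases hg' with rfl | hg'
    · exact ⟨g, hg, hxg, (hch.1 g hg).trans h2⟩
    · exact ⟨g', hg', h1, h2⟩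
  refine { h with
    nodup := ?_, marked := ?_, chain := hch.2, rem_finished := ?_, back := ?_
    finishOrder := ⟨h.finishOrder, ?_⟩, active_label := ?_ }
  · show (S ++ u :: c.finished).Nodup
    rw [List.nodup_middle, List.nodup_cons, List.mem_append]
    exact hnd
  · intro v
    rw [h.marked, hS]
    simp only [List.mem_cons]
    tauto
  · intro v hv
    rcases List.mem_cons.1 hv with rfl | hv
    · exact hu
    · exact h.rem_finished v hv
  · intro x hx g hg hxg
    rcases List.mem_cons.1 hx with rfl | hx
    · exact ⟨g, hg, hxg, hch.1 g hg⟩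
    · exact hback x hx g hg hxg
  · intro x hx hxu
    obtain ⟨g', hg', h1, h2⟩ := h.back x hx u (by simp [hS]) hxu
    refine ⟨g', fun hf => ?_, h1, h2⟩
    exact List.disjoint_of_nodup_append h.nodup hg' hf
  · intro g hg
    exact h.active_label g (by rw [hS]; simp [show g ∈ S from hg])

/-- Scanning an arc whose head has been visited already. -/
theorem Config.Inv.scan (h : c.Inv src dst n N o) {u j : ℕ} {l : List ℕ}
    (hu : c.rem u = j :: l) (hj : c.mark (dst j) ≠ 0) :
    ({c with rem := Function.update c.rem u l} : Config).Inv src dst n N o := by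
  refine { h with rem_sound := ?_, rem_cover := ?_, rem_finished := ?_ }
  · intro v i hi
    by_cases hv : v = u
    · subst hv
      simp only [Function.update_self] at hi
      exact h.rem_sound v i (by rw [hu]; simp [hi])
    · simp only [Function.update_of_ne hv] at hi
      exact h.rem_sound v i hi
  · intro i hi
    rcases h.rem_cover i hi with h' | h'
    · by_cases hv : src i = u
      · rw [hv, hu] at h'
        rcases List.mem_cons.1 h' with rfl | h'
        · exact Or.inr hj
        · left; simp [hv, h']
      · left; simp [Function.update_of_ne hv, h']
    · exact Or.inr h'
  · intro v hv
    have := h.rem_finished v hv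
    have hne : v ≠ u := by rintro rfl; rw [hu] at this; simp at this
    simp [Function.update_of_ne hne, this]

/-- Visiting an unmarked vertex `w` that is the head of an arc from the top of the stack. -/
theorem Config.Inv.push (h : c.Inv src dst n N o) {u w : ℕ} {S : List ℕ}
    (hS : c.active = u :: S) (huw : Edge src dst N u w) (hw : c.mark w = 0) (hwn : w < n) :
    ({c with active := w :: c.active, mark := Function.update c.mark w c.label} : Config).Inv
      src dst n N o := by
  have hum : c.mark u ≠ 0 := (h.marked u).2 (Or.inl (by simp [hS]))
  have hul : c.mark u = c.label := h.active_label u (by simp [hS])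
  have hw' : ¬ (w ∈ c.active ∨ w ∈ c.finished) := by rw [← h.marked]; simpa using hw
  have hmk : ∀ v, Function.update c.mark w c.label v ≠ 0 ↔ v = w ∨ c.mark v ≠ 0 := by
    intro v
    by_cases hv : v = w
    · subst hv; simp; omega
    · simp [hv]
  have hmk' : ∀ v, c.mark v ≠ 0 → Function.update c.mark w c.label v = c.mark v := by
    intro v hv
    exact Function.update_of_ne (by rintro rfl; exact hv hw) _ _
  refine { h with
    nodup := ?_, marked := ?_, lt := ?_, chain := ?_, rem_cover := ?_, back := ?_
    done_marked := ?_, label_le := ?_, active_label := ?_, root_label := ?_, first := ?_ }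
  · show (w :: (c.active ++ c.finished)).Nodup
    rw [List.nodup_cons, List.mem_append]
    exact ⟨hw', h.nodup⟩
  · intro v
    simp only [hmk, h.marked, List.mem_cons]
    tauto
  · intro v hv
    rcases (hmk v).1 hv with rfl | hv
    · exact hwn
    · exact h.lt v hv
  · refine List.pairwise_cons.2 ⟨fun g hg => ?_, h.chain⟩
    have hch := h.chain
    rw [hS, List.pairwise_cons] at hch
    rw [hS] at hg
    rcases List.mem_cons.1 hg with rfl | hg
    · exact .single huw
    · exact (hch.1 g hg).tail huw
  · intro j hj
    exact (h.rem_cover j hj).imp_right fun h' => (hmk _).2 (Or.inr h')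
  · intro x hx g hg hxg
    have : ∃ g ∈ c.active, Reach src dst N x g := by
      rcases List.mem_cons.1 hg with rfl | hg
      · rcases h.exit ((h.marked x).2 (Or.inr hx)) hxg with h' | ⟨g, h1, h2, -⟩
        · exact absurd (Or.inr h') hw'
        · exact ⟨g, h1, h2⟩
      · exact ⟨g, hg, hxg⟩
    obtain ⟨g, hg, hxg⟩ := this
    obtain ⟨g', hg', h1⟩ := h.back x hx g hg hxg
    exact ⟨g', List.mem_cons_of_mem _ hg', h1⟩
  · exact fun y hy => (hmk y).2 (Or.inr (h.done_marked y hy))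
  · intro v
    by_cases hv : v = w
    · subst hv; simp
    · simp [hv, h.label_le v]
  · intro g hg
    by_cases hv : g = w
    · subst hv; simp
    · simp only [Function.update_of_ne hv]
      exact h.active_label g ((List.mem_cons.1 hg).resolve_left hv)
  · intro k hk hk'
    have := h.root_label k hk hk'
    refine ⟨?_, this.2⟩
    simp only
    rw [hmk' _ (by rw [this.1]; omega), this.1]
  · intro v hv
    rcases (hmk v).1 hv with rfl | hv
    · have hf := h.first u hum
      rw [hul] at hf
      simp only [Function.update_self]
      refine ⟨hf.1.tail huw, fun y hy hyw => ?_⟩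
      -- a start vertex of an earlier label reaches `w` only through the active vertices
      have hyd : y ∈ c.done :=
        (h.root_label c.label (by omega) le_rfl).2.subset (List.mem_append_left _ hy)
      rcases h.exit (h.done_marked y hyd) hyw with h' | ⟨g, hg, h1, -⟩
      · exact hw' (Or.inr h')
      · have := (h.first g ((h.marked g).2 (Or.inl hg))).2
        rw [h.active_label g hg] at this
        exact this y hy h1
    · simp only [hmk' v hv]
      exact h.first v hv

theorem Config.Inv.skip_root (h : c.Inv src dst n N o) {v : ℕ} {O : List ℕ} (hO : c.todo = v :: O)
    (hv : c.mark v ≠ 0) :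
    ({c with done := c.done ++ [v], todo := O} : Config).Inv src dst n N o := by
  refine { h with split := ?_, done_marked := ?_, root_label := ?_ }
  · rw [← h.split, hO]; simp
  · intro y hy
    rcases List.mem_append.1 hy with hy | hy
    · exact h.done_marked y hy
    · rw [List.mem_singleton.1 hy]; exact hv
  · intro k hk hk'
    have := h.root_label k hk hk'
    exact ⟨this.1, this.2.trans (List.prefix_append _ _)⟩

/-- Starting at an unvisited start vertex. The stack is empty, so no start vertex so far reaches
it. -/
theorem Config.Inv.push_root (h : c.Inv src dst n N o) {v : ℕ} {O : List ℕ}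
    (hS : c.active = []) (hO : c.todo = v :: O) (hv : c.mark v = 0) (hvn : v < n) :
    ({c with
      active := [v], done := c.done ++ [v], todo := O
      mark := Function.update c.mark v (c.label + 1), label := c.label + 1
      pre := Function.update c.pre (c.label + 1) c.done
      root := Function.update c.root (c.label + 1) v } : Config).Inv src dst n N o := by
  have hv' : v ∉ c.finished := by
    intro h'; exact (h.marked v).2 (Or.inr h') hv
  have hex : ∀ x y, c.mark x ≠ 0 → Reach src dst N x y → y ∈ c.finished := by
    intro x y hx hxy
    rcases h.exit hx hxy with h' | ⟨g, hg, -⟩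
    · exact h'
    · rw [hS] at hg; simp at hg
  have hmk : ∀ x, Function.update c.mark v (c.label + 1) x ≠ 0 ↔ x = v ∨ c.mark x ≠ 0 := by
    intro x
    by_cases hx : x = v
    · subst hx; simp
    · simp [hx]
  have hmk' : ∀ x, c.mark x ≠ 0 → Function.update c.mark v (c.label + 1) x = c.mark x := by
    intro x hx
    exact Function.update_of_ne (by rintro rfl; exact hx hv) _ _
  have hnd := h.nodup
  rw [hS, List.nil_append] at hnd
  refine { h with
    nodup := ?_, marked := ?_, lt := ?_, chain := ?_, rem_cover := ?_, back := ?_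
    split := ?_, done_marked := ?_, label_le := ?_, active_label := ?_, root_label := ?_
    first := ?_ }
  · show (v :: c.finished).Nodup
    exact List.nodup_cons.2 ⟨hv', hnd⟩
  · intro x
    simp only [hmk, h.marked, hS, List.mem_cons, List.not_mem_nil]
    tauto
  · intro x hx
    rcases (hmk x).1 hx with rfl | hx
    · exact hvn
    · exact h.lt x hx
  · simp
  · intro j hj
    exact (h.rem_cover j hj).imp_right fun h' => (hmk _).2 (Or.inr h')
  · intro x hx g hg hxg
    rw [List.mem_singleton.1 hg] at hxg
    exact absurd (hex x v ((h.marked x).2 (Or.inr hx)) hxg) hv'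
  · rw [← h.split, hO]; simp
  · intro y hy
    rcases List.mem_append.1 hy with hy | hy
    · exact (hmk y).2 (Or.inr (h.done_marked y hy))
    · exact (hmk y).2 (Or.inl (List.mem_singleton.1 hy))
  · intro x
    by_cases hx : x = v
    · subst hx; simp
    · simp only [Function.update_of_ne hx]; exact (h.label_le x).trans (Nat.le_succ _)
  · intro g hg
    rw [List.mem_singleton.1 hg]; simp
  · intro k hk hk'
    by_cases hkl : k = c.label + 1
    · subst hkl; simp
    · have := h.root_label k hk (by simp only at hk'; omega)
      simp only [Function.update_of_ne hkl]
      exact ⟨by rw [hmk' _ (by rw [this.1]; omega), this.1],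
        this.2.trans (List.prefix_append _ _)⟩
  · intro x hx
    rcases (hmk x).1 hx with rfl | hx
    · simp only [Function.update_self]
      exact ⟨.refl, fun y hy hyx => hv' (hex y x (h.done_marked y hy) hyx)⟩
    · have hle := h.label_le x
      simp only [hmk' x hx]
      rw [Function.update_of_ne (by omega), Function.update_of_ne (by omega)]
      exact h.first x hx

/-- The outcome of the depth-first search with start vertices `o`: the list of the visited
vertices, most recently finished first, and a labelling in which each vertex has the label of the
first start vertex that reaches it. -/
structure IsSearched (src dst : ℕ → ℕ) (N : ℕ) (o : List ℕ) (mark : ℕ → ℕ) (label : ℕ)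
    (fin : List ℕ) : Prop where
  mem_fin : ∀ v, v ∈ fin ↔ mark v ≠ 0
  finishOrder : FinishOrder (Reach src dst N) fin
  reach : ∀ v, mark v ≠ 0 ↔ ∃ y ∈ o, Reach src dst N y v
  label_le : ∀ v, mark v ≤ label
  first : ∃ (pre : ℕ → List ℕ) (root : ℕ → ℕ),
    (∀ k, 1 ≤ k → k ≤ label → mark (root k) = k ∧ (pre k ++ [root k]) <+: o) ∧
    ∀ v, mark v ≠ 0 → Reach src dst N (root (mark v)) v ∧
      ∀ y ∈ pre (mark v), ¬ Reach src dst N y v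

theorem Config.Inv.isSearched (h : c.Inv src dst n N o) (hS : c.active = []) (hO : c.todo = []) :
    IsSearched src dst N o c.mark c.label c.finished := by
  have hd : c.done = o := by simpa [hO] using h.split
  refine ⟨fun v => ?_, h.finishOrder, fun v => ⟨fun hv => ?_, ?_⟩, h.label_le, c.pre, c.root, ?_,
    h.first⟩
  · rw [h.marked, hS]; simp
  · have := h.root_label (c.mark v) (by omega) (h.label_le v)
    refine ⟨_, ?_, (h.first v hv).1⟩
    rw [← hd]
    exact this.2.subset (by simp)
  · rintro ⟨y, hy, hyv⟩
    rw [← hd] at hy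
    rcases h.exit (h.done_marked y hy) hyv with h' | ⟨g, hg, -⟩
    · exact (h.marked v).2 (Or.inr h')
    · rw [hS] at hg; simp at hg
  · rw [← hd]; exact h.root_label

theorem reach_swap {x y : ℕ} : Reach dst src N x y ↔ Reach src dst N y x := by
  have : Edge dst src N = Function.swap (Edge src dst N) := by
    funext x y
    simp only [Edge, Function.swap, and_comm]
  unfold Reach
  rw [this, reflTransGen_swap]

/-- Kosaraju's theorem: searching the reversed digraph from the vertices in the order in which a
first search finished them, the last one first, labels the strongly connected components. -/
theorem IsSearched.mark_eq_iff {l : List ℕ} {mark mark' : ℕ → ℕ} {k k' : ℕ} {l' : List ℕ}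
    (h : IsSearched src dst N o mark k l) (h' : IsSearched dst src N l mark' k' l')
    {v w : ℕ} (hv : v ∈ l) (hw : w ∈ l) :
    mark' v = mark' w ↔ Reach src dst N v w ∧ Reach src dst N w v := by
  obtain ⟨pre, root, h1, h2⟩ := h'.first
  have hm : ∀ v ∈ l, mark' v ≠ 0 := fun v hv => (h'.reach v).2 ⟨v, hv, .refl⟩
  have key : ∀ v ∈ l, Reach src dst N v (root (mark' v)) ∧ Reach src dst N (root (mark' v)) v := by
    intro v hv
    have h3 := h2 v (hm v hv)
    simp only [reach_swap (src := src)] at h3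
    refine ⟨h3.1, ?_⟩
    have h4 := h1 (mark' v) (Nat.one_le_iff_ne_zero.2 (hm v hv)) (h'.label_le v)
    obtain ⟨T, hT⟩ := h4.2
    rw [List.append_assoc, List.singleton_append] at hT
    have h5 : v ∉ pre (mark' v) := fun hvp => h3.2 v hvp .refl
    have h6 := h.finishOrder
    rw [← hT] at h6 hv
    rcases List.mem_append.1 hv with hv | hv
    · exact absurd hv h5
    rcases List.mem_cons.1 hv with hv | hv
    · rw [← hv]
    obtain ⟨x', hx', h7, h8⟩ := h6.of_append.2 v hv h3.1
    have hx'l : x' ∈ l := by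
      rw [h.mem_fin]
      have hvl : v ∈ l := by rw [← hT]; simp [hv]
      rw [h.mem_fin, h.reach] at hvl
      obtain ⟨y, hy, hyv⟩ := hvl
      exact (h.reach x').2 ⟨y, hy, hyv.trans h7⟩
    rw [← hT] at hx'l
    rcases List.mem_append.1 hx'l with hx'l | hx'l
    · exact absurd h7 (h3.2 x' hx'l)
    rcases List.mem_cons.1 hx'l with hx'l | hx'l
    · rwa [← hx'l]
    · exact absurd hx'l hx'
  constructor
  · intro he
    have kv := key v hv
    have kw := key w hw
    rw [← he] at kw
    exact ⟨kv.1.trans kw.2, kw.1.trans kv.2⟩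
  · rintro ⟨hvw, hwv⟩
    -- neither start vertex precedes the other
    have aux : ∀ v ∈ l, ∀ w ∈ l, Reach src dst N v w → Reach src dst N w v →
        (pre (mark' v)).length ≤ (pre (mark' w)).length → mark' v = mark' w := by
      intro v hv w hw hvw hwv hle
      have hv1 := h1 (mark' v) (Nat.one_le_iff_ne_zero.2 (hm v hv)) (h'.label_le v)
      have hw1 := h1 (mark' w) (Nat.one_le_iff_ne_zero.2 (hm w hw)) (h'.label_le w)
      rcases hle.eq_or_lt with heq | hlt
      · have := List.prefix_of_prefix_length_le hv1.2 hw1.2 (by simp [heq])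
        have := this.eq_of_length (by simp [heq])
        have := List.append_inj' this rfl
        have h3 : root (mark' v) = root (mark' w) := by simpa using this.2
        rw [← hv1.1, h3, hw1.1]
      · have := List.prefix_of_prefix_length_le hv1.2
          ((List.prefix_append _ _).trans hw1.2) (by simp; omega)
        have hr : root (mark' v) ∈ pre (mark' w) := this.subset (by simp)
        refine absurd ?_ ((h2 w (hm w hw)).2 _ hr)
        rw [reach_swap]
        exact hwv.trans (key v hv).1
    rcases le_total (pre (mark' v)).length (pre (mark' w)).length with hle | hle
    · exact aux v hv w hw hvw hwv hle
    · exact (aux w hw v hv hwv hvw hle).symm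

end Search

/-! ### Running time and correctness of programs -/

section Machine

instance (s : State) (c : Test) : Decidable (c.holds s) := by
  cases c <;> unfold Test.holds <;> infer_instance

@[simp] theorem reg_setReg_self (s : State) (x z : ℕ) : (s.setReg x z).reg x = z := by
  simp [State.setReg]

theorem reg_setReg_of_ne (s : State) {x y : ℕ} (z : ℕ) (h : y ≠ x) :
    (s.setReg x z).reg y = s.reg y := by
  simp [State.setReg, h]

@[simp] theorem arr_setReg (s : State) (x z : ℕ) : (s.setReg x z).arr = s.arr := rfl

@[simp] theorem reg_setArr (s : State) (a i z : ℕ) : (s.setArr a i z).reg = s.reg := rfl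

@[simp] theorem arr_setArr_self (s : State) (a i z : ℕ) :
    (s.setArr a i z).arr a = Function.update (s.arr a) i z := by
  simp [State.setArr]

theorem arr_setArr_of_ne (s : State) {a a' : ℕ} (i z : ℕ) (h : a' ≠ a) :
    (s.setArr a i z).arr a' = s.arr a' := by
  simp [State.setArr, h]

/-- The effect of a program without loops. -/
def Prog.step : Prog → State → State
  | .skip, s => s
  | .assign x e, s => s.setReg x (e.eval s)
  | .store a i e, s => s.setArr a (i.eval s) (e.eval s)
  | .seq p q, s => q.step (p.step s)
  | .cond c p q, s => if c.holds s then p.step s else q.step s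
  | .loop _ _, s => s

/-- The program has no loops. -/
def Prog.LoopFree : Prog → Prop
  | .seq p q => p.LoopFree ∧ q.LoopFree
  | .cond _ p q => p.LoopFree ∧ q.LoopFree
  | .loop _ _ => False
  | _ => True

/-- A bound on the running time of a program without loops. -/
def Prog.bound : Prog → ℕ
  | .skip => 1
  | .assign _ e => e.cost + 1
  | .store _ i e => i.cost + e.cost + 1
  | .seq p q => p.bound + q.bound
  | .cond c p q => c.cost + (p.bound + q.bound)
  | .loop _ _ => 0

/-- The program may write into the register `x`. -/
def Prog.WritesReg (x : ℕ) : Prog → Prop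
  | .assign y _ => x = y
  | .seq p q => p.WritesReg x ∨ q.WritesReg x
  | .cond _ p q => p.WritesReg x ∨ q.WritesReg x
  | .loop _ p => p.WritesReg x
  | _ => False

/-- The program may write into the array `a`. -/
def Prog.WritesArr (a : ℕ) : Prog → Prop
  | .store a' _ _ => a = a'
  | .seq p q => p.WritesArr a ∨ q.WritesArr a
  | .cond _ p q => p.WritesArr a ∨ q.WritesArr a
  | .loop _ p => p.WritesArr a
  | _ => False

theorem exec_step {p : Prog} (hp : p.LoopFree) (s : State) :
    ∃ t ≤ p.bound, Exec p s (p.step s) t := by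
  induction p generalizing s with
  | skip => exact ⟨1, le_rfl, .skip s⟩
  | assign x e => exact ⟨_, le_rfl, .assign s x e⟩
  | store a i e => exact ⟨_, le_rfl, .store s a i e⟩
  | seq p q ihp ihq =>
    obtain ⟨t, ht, h⟩ := ihp hp.1 s
    obtain ⟨t', ht', h'⟩ := ihq hp.2 (p.step s)
    exact ⟨_, Nat.add_le_add ht ht', .seq h h'⟩
  | cond c p q ihp ihq =>
    unfold Prog.step Prog.bound
    split
    · next hc =>
      obtain ⟨t, ht, h⟩ := ihp hp.1 s
      exact ⟨_, by omega, .cond_true hc h⟩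
    · next hc =>
      obtain ⟨t, ht, h⟩ := ihq hp.2 s
      exact ⟨_, by omega, .cond_false hc h⟩
  | loop c p => exact hp.elim

theorem Exec.frame {p : Prog} {s s' : State} {t : ℕ} (h : Exec p s s' t) :
    (∀ x, ¬ p.WritesReg x → s'.reg x = s.reg x) ∧ ∀ a, ¬ p.WritesArr a → s'.arr a = s.arr a := by
  induction h with
  | skip => exact ⟨fun _ _ => rfl, fun _ _ => rfl⟩
  | assign s y e => exact ⟨fun x hx => reg_setReg_of_ne s _ hx, fun _ _ => rfl⟩
  | store s a i e => exact ⟨fun _ _ => rfl, fun a' ha => arr_setArr_of_ne s _ _ ha⟩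
  | seq _ _ ih ih' =>
    simp only [Prog.WritesReg, Prog.WritesArr, not_or]
    exact ⟨fun x hx => (ih'.1 x hx.2).trans (ih.1 x hx.1),
      fun a ha => (ih'.2 a ha.2).trans (ih.2 a ha.1)⟩
  | cond_true _ _ ih =>
    simp only [Prog.WritesReg, Prog.WritesArr, not_or]
    exact ⟨fun x hx => ih.1 x hx.1, fun a ha => ih.2 a ha.1⟩
  | cond_false _ _ ih =>
    simp only [Prog.WritesReg, Prog.WritesArr, not_or]
    exact ⟨fun x hx => ih.1 x hx.2, fun a ha => ih.2 a ha.2⟩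
  | loop_true _ _ _ ih ih' =>
    exact ⟨fun x hx => (ih'.1 x hx).trans (ih.1 x hx), fun a ha => (ih'.2 a ha).trans (ih.2 a ha)⟩
  | loop_false => exact ⟨fun _ _ => rfl, fun _ _ => rfl⟩

/-- Started in `s`, the program `p` halts within `T` steps, in a state that satisfies `Q`. -/
def Runs (p : Prog) (s : State) (T : ℕ) (Q : State → Prop) : Prop :=
  ∃ s' t, Exec p s s' t ∧ t ≤ T ∧ Q s'

theorem Runs.seq {p q : Prog} {s : State} {T T' : ℕ} {Q Q' : State → Prop} (h : Runs p s T Q)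
    (h' : ∀ s', Q s' → Runs q s' T' Q') : Runs (.seq p q) s (T + T') Q' := by
  obtain ⟨s', t, h1, h2, h3⟩ := h
  obtain ⟨s'', t', h1', h2', h3'⟩ := h' s' h3
  exact ⟨s'', t + t', .seq h1 h1', Nat.add_le_add h2 h2', h3'⟩

theorem Runs.weaken {p : Prog} {s : State} {T T' : ℕ} {Q Q' : State → Prop} (h : Runs p s T Q)
    (hT : T ≤ T') (hQ : ∀ s', Q s' → Q' s') : Runs p s T' Q' := by
  obtain ⟨s', t, h1, h2, h3⟩ := h
  exact ⟨s', t, h1, h2.trans hT, hQ s' h3⟩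

/-- The states agree on everything that `p` does not write. -/
def Agree (p : Prog) (s s' : State) : Prop :=
  (∀ x, ¬ p.WritesReg x → s'.reg x = s.reg x) ∧ ∀ a, ¬ p.WritesArr a → s'.arr a = s.arr a

theorem Runs.frame {p : Prog} {s : State} {T : ℕ} {Q : State → Prop} (h : Runs p s T Q) :
    Runs p s T fun s' => Q s' ∧ Agree p s s' := by
  obtain ⟨s', t, h1, h2, h3⟩ := h
  exact ⟨s', t, h1, h2, h3, h1.frame⟩

theorem runs_step {p : Prog} (hp : p.LoopFree) (s : State) :
    Runs p s p.bound fun s' => s' = p.step s := by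
  obtain ⟨t, ht, h⟩ := exec_step hp s
  exact ⟨_, t, h, ht, rfl⟩

/-- The rule for a loop with a loop-free body: the invariant carries a bound on the number of
iterations that remain. -/
theorem runs_loop {c : Test} {p : Prog} (hp : p.LoopFree) (Inv : ℕ → State → Prop)
    (h : ∀ k s, Inv k s → c.holds s → ∃ k' < k, Inv k' (p.step s)) {k : ℕ} {s : State}
    (hs : Inv k s) : Runs (.loop c p) s ((c.cost + p.bound) * k + c.cost)
      fun s' => (∃ k', Inv k' s') ∧ ¬ c.holds s' := by
  induction k using Nat.strong_induction_on generalizing s with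
  | _ k ih =>
    by_cases hc : c.holds s
    · obtain ⟨k', hk, hi⟩ := h k s hs hc
      obtain ⟨s', t', h1, h2, h3⟩ := ih k' hk hi
      obtain ⟨t, ht, he⟩ := exec_step hp s
      refine ⟨s', _, .loop_true hc he h1, ?_, h3⟩
      have : (c.cost + p.bound) * (k' + 1) ≤ (c.cost + p.bound) * k := Nat.mul_le_mul_left _ hk
      rw [Nat.mul_succ] at this
      omega
    · exact ⟨s, _, .loop_false hc, Nat.le_add_left _ _, ⟨k, hs⟩, hc⟩

/-- Run `p` for each value of the register `i` from zero up to the value of the register `r`. -/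
def forLoop (i r : ℕ) (p : Prog) : Prog :=
  .seq (.assign i (.const 0)) <|
    .loop (.lt (.reg i) (.reg r)) (.seq p (.assign i (.succ (.reg i))))

theorem runs_forLoop {i r : ℕ} {p : Prog} (hp : p.LoopFree) (hir : r ≠ i) (hi : ¬ p.WritesReg i)
    (hr : ¬ p.WritesReg r) {s : State} (Inv : ℕ → State → Prop)
    (h : ∀ k s', k < s.reg r → s'.reg i = k → Agree (forLoop i r p) s s' → Inv k s' →
      Inv (k + 1) ((p.step s').setReg i (k + 1))) (h0 : Inv 0 (s.setReg i 0)) :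
    Runs (forLoop i r p) s ((6 + p.bound) * s.reg r + 5) (Inv (s.reg r)) := by
  have hw : ∀ x, x ≠ i → ¬ p.WritesReg x → ¬ (forLoop i r p).WritesReg x := by
    intro x h1 h2; simp [forLoop, Prog.WritesReg, h1, h2]
  have hst : ∀ s' : State, Agree p s' (p.step s') := fun s' => by
    obtain ⟨t, -, he⟩ := exec_step hp s'
    exact he.frame
  have hrun := runs_loop (c := .lt (.reg i) (.reg r)) (p := .seq p (.assign i (.succ (.reg i))))
    ⟨hp, trivial⟩ (fun k s' => k ≤ s.reg r ∧ s'.reg i = s.reg r - k ∧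
      Agree (forLoop i r p) s s' ∧ Inv (s.reg r - k) s') ?_ (k := s.reg r) (s := s.setReg i 0)
    ⟨le_rfl, by simp, ⟨fun x hx => reg_setReg_of_ne _ _ fun hxi => hx (Or.inl hxi), fun _ _ => rfl⟩,
      by rwa [Nat.sub_self]⟩
  · refine Runs.weaken (T := 2 + _) (Runs.seq (runs_step (p := .assign i (.const 0)) trivial s)
      fun s' hs' => by subst hs'; exact hrun) ?_ ?_
    · show 2 + ((3 + (p.bound + 3)) * s.reg r + 3) ≤ _
      rw [show 3 + (p.bound + 3) = 6 + p.bound by omega]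
      omega
    · rintro s' ⟨⟨k, hk, h1, h2, h3⟩, hc⟩
      have hc' : ¬ (s'.reg i < s'.reg r) := hc
      have := h2.1 r (hw r hir hr)
      have hk0 : k = 0 := by omega
      subst hk0
      exact h3
  · rintro k s' ⟨hk, h1, h2, h3⟩ hc
    have hc' : s'.reg i < s'.reg r := hc
    have hrr := h2.1 r (hw r hir hr)
    have h4 := h (s.reg r - k) s' (by omega) h1 h2 h3
    have h5 : s.reg r - k + 1 = s.reg r - (k - 1) := by omega
    have h6 : (p.step s').reg i = s.reg r - k := by rw [(hst s').1 i hi, h1]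
    have h7 : Prog.step (.seq p (.assign i (.succ (.reg i)))) s' =
        (p.step s').setReg i (s.reg r - (k - 1)) := by
      simp only [Prog.step, Expr.eval, h6, h5]
    rw [h5] at h4
    rw [h7]
    refine ⟨k - 1, by omega, by omega, by simp, ⟨fun x hx => ?_, fun a ha => ?_⟩, h4⟩
    · have hxi : x ≠ i := fun hxi => hx (Or.inl hxi)
      rw [reg_setReg_of_ne _ _ hxi, (hst s').1 x fun h' => hx (Or.inr (Or.inl h')), h2.1 x hx]
    · rw [arr_setReg, (hst s').2 a fun h' => ha (Or.inr (Or.inl h')), h2.2 a ha]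

end Machine

/-! ### Stacks and linked lists in arrays -/

section ListsInArrays

/-- The first `k` cells of `f` hold the list, with its head last: a stack. -/
def StackRep (f : ℕ → ℕ) : List ℕ → ℕ → Prop
  | [], k => k = 0
  | x :: l, k => ∃ k', k = k' + 1 ∧ f k' = x ∧ StackRep f l k'

theorem StackRep.length {f : ℕ → ℕ} {l : List ℕ} {k : ℕ} (h : StackRep f l k) : k = l.length := by
  induction l generalizing k with
  | nil => exact h
  | cons x l ih =>
    obtain ⟨k', rfl, -, h⟩ := h
    rw [ih h]; rfl

theorem StackRep.congr {f g : ℕ → ℕ} {l : List ℕ} {k : ℕ} (h : StackRep f l k)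
    (hfg : ∀ i < k, g i = f i) : StackRep g l k := by
  induction l generalizing k with
  | nil => exact h
  | cons x l ih =>
    obtain ⟨k', rfl, h1, h2⟩ := h
    exact ⟨k', rfl, by rw [hfg k' (by omega), h1], ih h2 fun i hi => hfg i (by omega)⟩

theorem StackRep.push {f : ℕ → ℕ} {l : List ℕ} {k : ℕ} (h : StackRep f l k) (x : ℕ) :
    StackRep (Function.update f k x) (x :: l) (k + 1) :=
  ⟨k, rfl, by simp, h.congr fun i hi => by simp [show i ≠ k by omega]⟩

/-- The linked list that starts at `h`: zero ends it, and `j + 1` stands for the item `j`, which is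
followed by the list at `next j`. -/
def LinkRep (next : ℕ → ℕ) : ℕ → List ℕ → Prop
  | h, [] => h = 0
  | h, j :: l => h = j + 1 ∧ LinkRep next (next j) l

theorem LinkRep.congr {f g : ℕ → ℕ} {h : ℕ} {l : List ℕ} (hl : LinkRep f h l)
    (hfg : ∀ i ∈ l, g i = f i) : LinkRep g h l := by
  induction l generalizing h with
  | nil => exact hl
  | cons x l ih =>
    refine ⟨hl.1, ?_⟩
    rw [hfg x (by simp)]
    exact ih hl.2 fun i hi => hfg i (by simp [hi])

end ListsInArrays

/-! ### The search program -/

section SearchProgram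

/-- Put arc `i`, where `i` is register 18, at the front of the list of the arcs leaving its tail.
The lists start in the array `h` and are linked through the array `h + 1`. -/
def linkBody (src h : ℕ) : Prog :=
  .seq (.store (h + 1) (.reg 18) (.get h (.get src (.reg 18))))
    (.store h (.get src (.reg 18)) (.succ (.reg 18)))

/-- Mark the vertex in register 15 with the current label and push it. -/
def visitBody (h : ℕ) : Prog :=
  .seq (.store (h + 2) (.reg 15) (.reg 12)) <|
  .seq (.store (h + 3) (.reg 10) (.reg 15)) (.assign 10 (.succ (.reg 10)))

/-- One step of the depth-first search: finish the top of the stack or scan the next arc there; if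
the stack is empty, take the next start vertex, or stop if there is none left. The array `h + 2`
holds the labels, `h + 3` the stack and `h + 4` the finished vertices; registers 10, 11, 12, 16
and 17 hold the sizes of the last two, the current label, the number of start vertices left, and a
flag that ends the search. -/
def searchBody (dst ord h : ℕ) : Prog :=
  .cond (.lt (.const 0) (.reg 10))
    (.seq (.assign 13 (.get (h + 3) (.pred (.reg 10))))
      (.cond (.eq (.get h (.reg 13)) (.const 0))
        (.seq (.assign 10 (.pred (.reg 10))) <|
          .seq (.store (h + 4) (.reg 11) (.reg 13)) (.assign 11 (.succ (.reg 11))))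
        (.seq (.assign 14 (.pred (.get h (.reg 13)))) <|
          .seq (.store h (.reg 13) (.get (h + 1) (.reg 14))) <|
          .seq (.assign 15 (.get dst (.reg 14)))
            (.cond (.eq (.get (h + 2) (.reg 15)) (.const 0)) (visitBody h) .skip))))
    (.cond (.lt (.const 0) (.reg 16))
      (.seq (.assign 16 (.pred (.reg 16))) <|
        .seq (.assign 15 (.get ord (.reg 16)))
          (.cond (.eq (.get (h + 2) (.reg 15)) (.const 0))
            (.seq (.assign 12 (.succ (.reg 12))) (visitBody h)) .skip))
      (.assign 17 (.const 1)))

/-- Initialization of the registers of the search. -/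
def searchInit (rC : ℕ) : Prog :=
  .seq (.assign 10 (.const 0)) <| .seq (.assign 11 (.const 0)) <| .seq (.assign 12 (.const 0)) <|
  .seq (.assign 16 (.reg rC)) (.assign 17 (.const 0))

/-- Depth-first search in the digraph with tails in the array `src` and heads in the array `dst`,
the number of arcs being in the register `rN`, from the vertices in the array `ord`, their number
being in the register `rC`, the last one first. The arrays from `h` to `h + 4` are its work
space. -/
def search (src dst ord h rN rC : ℕ) : Prog :=
  .seq (searchInit rC) <|
  .seq (forLoop 18 rN (linkBody src h))
    (.loop (.lt (.reg 17) (.const 1)) (searchBody dst ord h))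

theorem linkBody_step (src h : ℕ) (hs : src < h) (s : State) :
    (linkBody src h).step s =
      (s.setArr (h + 1) (s.reg 18) (s.arr h (s.arr src (s.reg 18)))).setArr h
        (s.arr src (s.reg 18)) (s.reg 18 + 1) := by
  simp (disch := omega) only [linkBody, Prog.step, Expr.eval, reg_setArr, arr_setArr_of_ne]

/-- The arcs with index below `k` are linked into the lists `rem` of the arcs leaving a vertex. -/
structure Linked (src next head : ℕ → ℕ) (n k : ℕ) (rem : ℕ → List ℕ) : Prop where
  link : ∀ u, LinkRep next (head u) (rem u)
  sound : ∀ u, ∀ j ∈ rem u, j < k ∧ src j = u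
  cover : ∀ j < k, j ∈ rem (src j)
  length : ∑ u ∈ Finset.range n, (rem u).length = k

theorem sum_length_update {n u : ℕ} (hu : u < n) (rem : ℕ → List ℕ) (l : List ℕ) :
    ∑ v ∈ Finset.range n, (Function.update rem u l v).length + (rem u).length =
      ∑ v ∈ Finset.range n, (rem v).length + l.length := by
  rw [← Finset.add_sum_erase _ _ (Finset.mem_range.2 hu),
    ← Finset.add_sum_erase (Finset.range n) (fun v => (rem v).length) (Finset.mem_range.2 hu)]
  have : ∑ v ∈ (Finset.range n).erase u, (Function.update rem u l v).length =
      ∑ v ∈ (Finset.range n).erase u, (rem v).length :=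
    Finset.sum_congr rfl fun v hv => by rw [Function.update_of_ne (Finset.ne_of_mem_erase hv)]
  rw [this, Function.update_self]
  omega

theorem Linked.succ {src next head : ℕ → ℕ} {n k : ℕ} {rem : ℕ → List ℕ}
    (h : Linked src next head n k rem) (hk : src k < n) :
    Linked src (Function.update next k (head (src k))) (Function.update head (src k) (k + 1)) n
      (k + 1) (Function.update rem (src k) (k :: rem (src k))) := by
  have hc : ∀ u, LinkRep (Function.update next k (head (src k))) (head u) (rem u) := fun u =>
    (h.link u).congr fun i hi => Function.update_of_ne (by have := (h.sound u i hi).1; omega) _ _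
  refine ⟨fun u => ?_, fun u j hj => ?_, fun j hj => ?_, ?_⟩
  · by_cases hu : u = src k
    · subst hu
      simp only [Function.update_self]
      exact ⟨rfl, by simpa using hc (src k)⟩
    · simp only [Function.update_of_ne hu]; exact hc u
  · by_cases hu : u = src k
    · subst hu
      simp only [Function.update_self, List.mem_cons] at hj
      rcases hj with rfl | hj
      · exact ⟨by omega, rfl⟩
      · have := h.sound _ j hj; exact ⟨by omega, this.2⟩
    · simp only [Function.update_of_ne hu] at hj
      have := h.sound _ j hj; exact ⟨by omega, this.2⟩
  · rcases Nat.lt_succ_iff_lt_or_eq.1 hj with hj | rfl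
    · have := h.cover j hj
      by_cases hu : src j = src k
      · rw [hu] at this ⊢; simp [this]
      · rwa [Function.update_of_ne hu]
    · simp
  · have := sum_length_update hk rem (k :: rem (src k))
    have := h.length
    rw [List.length_cons] at *
    omega

theorem runs_link {src h rN : ℕ} (hs : src < h) (hN : rN ≠ 18) {n : ℕ} {s : State}
    (h0 : s.arr h = fun _ => 0) (hlt : ∀ j < s.reg rN, s.arr src j < n) :
    Runs (forLoop 18 rN (linkBody src h)) s
      ((6 + (linkBody src h).bound) * s.reg rN + 5)
      fun s' => ∃ rem, Linked (s.arr src) (s'.arr (h + 1)) (s'.arr h) n (s.reg rN) rem := by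
  refine runs_forLoop (i := 18) (r := rN) (p := linkBody src h) ⟨trivial, trivial⟩ hN
    (by simp [linkBody, Prog.WritesReg]) (by simp [linkBody, Prog.WritesReg])
    (fun k s' => ∃ rem, Linked (s.arr src) (s'.arr (h + 1)) (s'.arr h) n k rem) ?_
    ⟨fun _ => [], ⟨fun u => by rw [arr_setReg, h0]; rfl, by simp, by simp, by simp⟩⟩
  rintro k s' hk h1 h2 ⟨rem, h4⟩
  have h3 : s'.arr src = s.arr src := h2.2 src (by
    simp (disch := omega) only [forLoop, linkBody, Prog.WritesArr, false_or, or_false]; omega)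
  rw [linkBody_step src h hs]
  simp (disch := omega) only [arr_setReg, arr_setArr_of_ne, arr_setArr_self, h1, h3]
  exact ⟨_, h4.succ (hlt k hk)⟩

/-- The state of the machine represents the configuration `c`. -/
structure Represents (dst ord h : ℕ) (D : ℕ → ℕ) (c : Config) (s : State) : Prop where
  active : StackRep (s.arr (h + 3)) c.active (s.reg 10)
  finished : StackRep (s.arr (h + 4)) c.finished (s.reg 11)
  todo : StackRep (s.arr ord) c.todo (s.reg 16)
  label : s.reg 12 = c.label
  mark : s.arr (h + 2) = c.mark
  link : ∀ u, LinkRep (s.arr (h + 1)) (s.arr h u) (c.rem u)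
  dst : s.arr dst = D

theorem StackRep.pos_iff {f : ℕ → ℕ} {l : List ℕ} {k : ℕ} (h : StackRep f l k) :
    0 < k ↔ l ≠ [] := by
  rw [h.length, List.length_pos_iff]

/-- Each step of the search program is a step between configurations that satisfy the invariant,
until no active and no start vertices are left. -/
theorem searchBody_step {src : ℕ → ℕ} {D : ℕ → ℕ} {dst ord h n N : ℕ} {o : List ℕ} (hd : dst < h)
    (ho : ord < h) (hD : ∀ j < N, D j < n) (hon : ∀ v ∈ o, v < n) {c : Config} {s : State}
    (hc : c.Inv src D n N o) (hr : Represents dst ord h D c s) :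
    (c.active = [] ∧ c.todo = [] ∧
      (searchBody dst ord h).step s = s.setReg 17 1) ∨
    ∃ c' : Config, c'.Inv src D n N o ∧ c'.fuel n < c.fuel n ∧
      Represents dst ord h D c' ((searchBody dst ord h).step s) ∧
      ((searchBody dst ord h).step s).reg 17 = s.reg 17 := by
  have h1 := hr.active
  have h2 := hr.finished
  have h3 := hr.todo
  have h4 := hr.label
  have h5 := hr.mark
  have h6 := hr.link
  have h7 := hr.dst
  rcases hS : c.active with _ | ⟨u, S⟩
  · have e1 : ¬ (0 < s.reg 10) := by rw [h1.pos_iff, hS]; simp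
    have e10 : s.reg 10 = 0 := by omega
    rcases hO : c.todo with _ | ⟨v, O⟩
    · left
      have e2 : ¬ (0 < s.reg 16) := by rw [h3.pos_iff, hO]; simp
      refine ⟨rfl, rfl, ?_⟩
      have e20 : s.reg 16 = 0 := by omega
      simp [searchBody, Prog.step, Test.holds, Expr.eval, e10, e20]
    · right
      rw [hO] at h3
      obtain ⟨k, hk, hv, h3⟩ := h3
      have e2 : 0 < s.reg 16 := by omega
      have hvo : v ∈ o := by rw [← hc.split, hO]; simp
      by_cases hm : c.mark v = 0
      · refine ⟨_, hc.push_root hS hO hm (hon v hvo), ?_, ?_⟩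
        · simp only [Config.fuel, hO, List.length_cons]; omega
        · have hm' : s.arr (h + 2) v = 0 := by rw [h5, hm]
          have hst : (searchBody dst ord h).step s =
              (((((s.setReg 16 k).setReg 15 v).setReg 12 (c.label + 1)).setArr (h + 2) v
                (c.label + 1)).setArr (h + 3) 0 v).setReg 10 1 := by
            simp (disch := omega) [searchBody, visitBody, Prog.step, Test.holds, Expr.eval, e10,
              hk, reg_setReg_of_ne, hv, hm', h4]
          rw [hst]
          rw [hS, e10] at h1
          refine ⟨⟨?_, ?_, ?_, ?_, ?_, ?_, ?_⟩, ?_⟩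
          · simpa (disch := omega) [arr_setArr_of_ne] using h1.push v
          · simpa (disch := omega) [arr_setArr_of_ne, reg_setReg_of_ne] using h2
          · simpa (disch := omega) [arr_setArr_of_ne, reg_setReg_of_ne] using h3
          · simp (disch := omega) [reg_setReg_of_ne]
          · simp (disch := omega) [arr_setArr_of_ne, h5]
          · simpa (disch := omega) [arr_setArr_of_ne] using h6
          · simpa (disch := omega) [arr_setArr_of_ne] using h7
          · simp (disch := omega) [reg_setReg_of_ne]
      · refine ⟨_, hc.skip_root hO hm, ?_, ?_⟩
        · simp only [Config.fuel, hO, List.length_cons]; omega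
        · have hm' : s.arr (h + 2) v ≠ 0 := by rwa [h5]
          have hst : (searchBody dst ord h).step s = (s.setReg 16 k).setReg 15 v := by
            simp [searchBody, Prog.step, Test.holds, Expr.eval, e10, hk, hv, hm']
          rw [hst]
          refine ⟨⟨?_, ?_, ?_, ?_, ?_, ?_, ?_⟩, ?_⟩
          · simpa (disch := omega) [reg_setReg_of_ne] using h1
          · simpa (disch := omega) [reg_setReg_of_ne] using h2
          · simpa (disch := omega) [reg_setReg_of_ne] using h3
          · simpa (disch := omega) [reg_setReg_of_ne] using h4
          · simpa using h5
          · simpa using h6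
          · simpa using h7
          · simp (disch := omega) [reg_setReg_of_ne]
  · right
    have hle := hc.length_le
    have hum : c.mark u ≠ 0 := (hc.marked u).2 (Or.inl (by simp [hS]))
    rw [hS, List.length_cons] at hle
    have h1' := h1
    rw [hS] at h1
    obtain ⟨k, hk, hu, h1⟩ := h1
    have h6u := h6 u
    rcases hrem : c.rem u with _ | ⟨j, l⟩
    · rw [hrem] at h6u
      have hz : s.arr h u = 0 := h6u
      refine ⟨_, hc.pop hS hrem, ?_, ?_⟩
      · simp only [Config.fuel, List.length_cons]; omega
      · have hst : (searchBody dst ord h).step s =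
            (((s.setReg 13 u).setReg 10 k).setArr (h + 4) (s.reg 11) u).setReg 11
              (s.reg 11 + 1) := by
          simp (disch := omega) [searchBody, Prog.step, Test.holds, Expr.eval,
            hk, reg_setReg_of_ne, hu, hz]
        rw [hst]
        refine ⟨⟨?_, ?_, ?_, ?_, ?_, ?_, ?_⟩, ?_⟩
        · simpa (disch := omega) [arr_setArr_of_ne, reg_setReg_of_ne] using h1
        · simpa (disch := omega) [arr_setArr_of_ne] using h2.push u
        · simpa (disch := omega) [arr_setArr_of_ne, reg_setReg_of_ne] using h3
        · simpa (disch := omega) [reg_setReg_of_ne] using h4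
        · simpa (disch := omega) [arr_setArr_of_ne] using h5
        · simpa (disch := omega) [arr_setArr_of_ne] using h6
        · simpa (disch := omega) [arr_setArr_of_ne] using h7
        · simp (disch := omega) [reg_setReg_of_ne]
    · rw [hrem] at h6u
      obtain ⟨hz, hl⟩ := h6u
      obtain ⟨hjN, hju⟩ := hc.rem_sound u j (by simp [hrem])
      have hfuel : ∑ v ∈ Finset.range n, (Function.update c.rem u l v).length <
          ∑ v ∈ Finset.range n, (c.rem v).length := by
        have := sum_length_update (hc.lt u hum) c.rem l
        rw [hrem, List.length_cons] at this
        omega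
      have hD' : s.arr dst j = D j := by rw [h7]
      have hlink : ∀ v, LinkRep (s.arr (h + 1)) (Function.update (s.arr h) u (s.arr (h + 1) j) v)
          (Function.update c.rem u l v) := by
        intro v
        by_cases hv : v = u
        · subst hv; simpa using hl
        · simpa [Function.update_of_ne hv] using h6 v
      by_cases hm : c.mark (D j) = 0
      · -- push first and remove the arc from the list afterwards
        have hi1 := hc.push hS ⟨j, hjN, hju, rfl⟩ hm (hD j hjN)
        have hl0 : c.label ≠ 0 := by
          rw [← hc.active_label u (by simp [hS])]; exact hum
        refine ⟨_, hi1.scan (u := u) (j := j) (l := l) hrem (by simpa using hl0), ?_, ?_⟩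
        · simp only [Config.fuel]; omega
        · have hm' : s.arr (h + 2) (D j) = 0 := by rw [h5, hm]
          have hst : (searchBody dst ord h).step s =
              ((((((s.setReg 13 u).setReg 14 j).setArr h u (s.arr (h + 1) j)).setReg 15
                (D j)).setArr (h + 2) (D j) c.label).setArr (h + 3) (s.reg 10) (D j)).setReg 10
                (s.reg 10 + 1) := by
            simp (disch := omega) [searchBody, visitBody, Prog.step, Test.holds, Expr.eval,
              hk, reg_setReg_of_ne, arr_setArr_of_ne, hu, hz, hm', hD', h4]
          rw [hst]
          refine ⟨⟨?_, ?_, ?_, ?_, ?_, ?_, ?_⟩, ?_⟩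
          · simpa (disch := omega) [arr_setArr_of_ne] using h1'.push (D j)
          · simpa (disch := omega) [arr_setArr_of_ne, reg_setReg_of_ne] using h2
          · simpa (disch := omega) [arr_setArr_of_ne, reg_setReg_of_ne] using h3
          · simpa (disch := omega) [reg_setReg_of_ne] using h4
          · simp (disch := omega) [arr_setArr_of_ne, h5]
          · simpa (disch := omega) [arr_setArr_of_ne] using hlink
          · simpa (disch := omega) [arr_setArr_of_ne] using h7
          · simp (disch := omega) [reg_setReg_of_ne]
      · refine ⟨_, hc.scan hrem hm, ?_, ?_⟩
        · simp only [Config.fuel]; omega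
        · have hm' : s.arr (h + 2) (D j) ≠ 0 := by rwa [h5]
          have hst : (searchBody dst ord h).step s =
              (((s.setReg 13 u).setReg 14 j).setArr h u (s.arr (h + 1) j)).setReg 15 (D j) := by
            simp (disch := omega) [searchBody, visitBody, Prog.step, Test.holds, Expr.eval,
              hk, reg_setReg_of_ne, arr_setArr_of_ne, hu, hz, hm', hD']
          rw [hst]
          refine ⟨⟨?_, ?_, ?_, ?_, ?_, ?_, ?_⟩, ?_⟩
          · simpa (disch := omega) [arr_setArr_of_ne, reg_setReg_of_ne] using h1'
          · simpa (disch := omega) [arr_setArr_of_ne, reg_setReg_of_ne] using h2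
          · simpa (disch := omega) [arr_setArr_of_ne, reg_setReg_of_ne] using h3
          · simpa (disch := omega) [reg_setReg_of_ne] using h4
          · simpa (disch := omega) [arr_setArr_of_ne] using h5
          · simpa (disch := omega) [arr_setArr_of_ne] using hlink
          · simpa (disch := omega) [arr_setArr_of_ne] using h7
          · simp (disch := omega) [reg_setReg_of_ne]

theorem loopFree_searchBody (dst ord h : ℕ) : (searchBody dst ord h).LoopFree := by
  simp [searchBody, visitBody, Prog.LoopFree]

theorem runs_searchLoop {src : ℕ → ℕ} {D : ℕ → ℕ} {dst ord h n N : ℕ} {o : List ℕ} (hd : dst < h)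
    (ho : ord < h) (hD : ∀ j < N, D j < n) (hon : ∀ v ∈ o, v < n) {c : Config} {s : State}
    (hc : c.Inv src D n N o) (hr : Represents dst ord h D c s) (hs : s.reg 17 = 0) :
    Runs (.loop (.lt (.reg 17) (.const 1)) (searchBody dst ord h)) s
      ((3 + (searchBody dst ord h).bound) * (c.fuel n + 1) + 3)
      fun s' => ∃ fin, fin.length ≤ n ∧ StackRep (s'.arr (h + 4)) fin (s'.reg 11) ∧
        IsSearched src D N o (s'.arr (h + 2)) (s'.reg 12) fin := by
  refine (runs_loop (c := .lt (.reg 17) (.const 1)) (loopFree_searchBody dst ord h)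
    (fun k s => ∃ c : Config, c.Inv src D n N o ∧ Represents dst ord h D c s ∧
      ((s.reg 17 = 0 ∧ k = c.fuel n + 1) ∨ (s.reg 17 = 1 ∧ c.active = [] ∧ c.todo = [])))
    ?_ (k := c.fuel n + 1) (s := s) ⟨c, hc, hr, Or.inl ⟨hs, rfl⟩⟩).weaken le_rfl ?_
  · rintro k s ⟨c, hc, hr, h1⟩ hlt
    have hlt' : s.reg 17 < 1 := hlt
    rcases h1 with ⟨h1, rfl⟩ | ⟨h1, -⟩
    · rcases searchBody_step hd ho hD hon hc hr with ⟨hS, hO, hst⟩ | ⟨c', hc', hf, hr', h17⟩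
      · refine ⟨0, by omega, c, hc, ?_, Or.inr ⟨by rw [hst]; simp, hS, hO⟩⟩
        rw [hst]
        obtain ⟨h1, h2, h3, h4, h5, h6, h7⟩ := hr
        refine ⟨?_, ?_, ?_, ?_, ?_, ?_, ?_⟩
        · simpa (disch := omega) [reg_setReg_of_ne] using h1
        · simpa (disch := omega) [reg_setReg_of_ne] using h2
        · simpa (disch := omega) [reg_setReg_of_ne] using h3
        · simpa (disch := omega) [reg_setReg_of_ne] using h4
        · simpa using h5
        · simpa using h6
        · simpa using h7
      · exact ⟨c'.fuel n + 1, by omega, c', hc', hr', Or.inl ⟨by omega, rfl⟩⟩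
    · omega
  · rintro s' ⟨⟨k, c, hc, hr, h1⟩, hlt⟩
    have hlt' : ¬ s'.reg 17 < 1 := hlt
    rcases h1 with ⟨h1, -⟩ | ⟨-, hS, hO⟩
    · omega
    · refine ⟨c.finished, by have := hc.length_le; omega, hr.finished, ?_⟩
      rw [hr.mark, hr.label]
      exact hc.isSearched hS hO

theorem runs_search {src dst ord h rN rC n : ℕ} (hs : src < h) (hd : dst < h) (ho : ord < h)
    (hN : rN < 10 ∨ 18 < rN) (hC : rC < 10 ∨ 18 < rC) {s : State} {o : List ℕ}
    (h0 : ∀ i < 5, s.arr (h + i) = fun _ => 0)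
    (hlt : ∀ j < s.reg rN, s.arr src j < n ∧ s.arr dst j < n)
    (hrep : StackRep (s.arr ord) o (s.reg rC)) (hon : ∀ v ∈ o, v < n) :
    Runs (search src dst ord h rN rC) s (200 * (s.reg rN + n + o.length + 1))
      fun s' => ∃ fin, fin.length ≤ n ∧ StackRep (s'.arr (h + 4)) fin (s'.reg 11) ∧
        IsSearched (s.arr src) (s.arr dst) (s.reg rN) o (s'.arr (h + 2)) (s'.reg 12) fin := by
  have hinit : (searchInit rC).LoopFree := by simp [searchInit, Prog.LoopFree]
  refine Runs.weaken (T := (searchInit rC).bound + (((6 + (linkBody src h).bound) * s.reg rN + 5) +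
    ((3 + (searchBody dst ord h).bound) * ((s.reg rN + n + o.length) + 1) + 3)))
    (Runs.seq (runs_step hinit s) ?_) ?_ fun s' h => h
  · rintro s1 rfl
    have e1 : ∀ x, (x < 10 ∨ 18 < x) → ((searchInit rC).step s).reg x = s.reg x := by
      intro x hx
      simp (disch := omega) [searchInit, Prog.step, reg_setReg_of_ne]
    have e2 : ((searchInit rC).step s).arr = s.arr := by simp [searchInit, Prog.step]
    have e3 : ((searchInit rC).step s).reg 10 = 0 ∧ ((searchInit rC).step s).reg 11 = 0 ∧
        ((searchInit rC).step s).reg 12 = 0 ∧ ((searchInit rC).step s).reg 16 = s.reg rC ∧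
        ((searchInit rC).step s).reg 17 = 0 := by
      refine ⟨?_, ?_, ?_, ?_, ?_⟩ <;>
        simp (disch := omega) [searchInit, Prog.step, Expr.eval, reg_setReg_of_ne]
    generalize (searchInit rC).step s = s1 at e1 e2 e3
    obtain ⟨r10, r11, r12, r16, r17⟩ := e3
    have hlink := (runs_link (src := src) (h := h) (rN := rN) (n := n) (s := s1) hs (by omega)
      (by rw [e2]; exact h0 0 (by omega))
      (by rw [e1 rN hN, e2]; exact fun j hj => (hlt j hj).1)).frame
    rw [e1 rN hN] at hlink
    refine hlink.seq ?_
    rintro s2 ⟨⟨rem, hrem⟩, hr, ha⟩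
    have fr : ∀ x, x ≠ 18 → s2.reg x = s1.reg x := fun x hx =>
      hr x (by simpa [forLoop, Prog.WritesReg, linkBody] using hx)
    have fa : ∀ a, a ≠ h → a ≠ h + 1 → s2.arr a = s.arr a := fun a h1 h2 => by
      rw [ha a (by simp [forLoop, Prog.WritesArr, linkBody, h1, h2]), e2]
    rw [e2] at hrem
    have hrun := runs_searchLoop (src := s.arr src) (D := s.arr dst) (N := s.reg rN) (s := s2)
      hd ho (fun j hj => (hlt j hj).2) hon
      (c := ⟨[], [], [], o, rem, fun _ => 0, 0, fun _ => [], fun _ => 0⟩)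
      { nodup := List.nodup_nil
        marked := by simp
        lt := by simp
        chain := List.Pairwise.nil
        rem_sound := hrem.sound
        rem_cover := fun j hj => Or.inl (hrem.cover j hj)
        rem_finished := by simp
        back := by simp
        finishOrder := trivial
        split := rfl
        done_marked := by simp
        label_le := by simp
        active_label := by simp
        root_label := fun k hk hk' => by simp only at hk'; omega
        first := by simp }
      ⟨by rw [fr 10 (by omega), r10]; rfl, by rw [fr 11 (by omega), r11]; rfl,
        by rw [fr 16 (by omega), r16, fa ord (by omega) (by omega)]; exact hrep,
        by rw [fr 12 (by omega), r12],
        by rw [fa (h + 2) (by omega) (by omega)]; exact h0 2 (by omega),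
        hrem.link, fa dst (by omega) (by omega)⟩
      (by rw [fr 17 (by omega), r17])
    simpa [Config.fuel, hrem.length] using hrun
  · have b1 : (searchInit rC).bound = 10 := rfl
    have b2 : (linkBody src h).bound = 10 := rfl
    have b3 : (searchBody dst ord h).bound = 73 := rfl
    rw [b1, b2, b3]
    omega

end SearchProgram

/-! ### Orienting the edges -/

section Decompose

/-- The end in `A` of an edge with one end in `A`. -/
def inEnd {n : ℕ} (A : Finset (Fin n)) (p : Fin n × Fin n) : Fin n := if p.1 ∈ A then p.1 else p.2

/-- The end outside `A` of an edge with one end in `A`. -/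
def outEnd {n : ℕ} (A : Finset (Fin n)) (p : Fin n × Fin n) : Fin n := if p.1 ∈ A then p.2 else p.1

/-- The tail of an edge in the residual digraph. -/
def arcTail {n : ℕ} (A : Finset (Fin n)) (M : Finset (Sym2 (Fin n))) (p : Fin n × Fin n) : Fin n :=
  if s(p.1, p.2) ∈ M then outEnd A p else inEnd A p

/-- The head of an edge in the residual digraph. -/
def arcHead {n : ℕ} (A : Finset (Fin n)) (M : Finset (Sym2 (Fin n))) (p : Fin n × Fin n) : Fin n :=
  if s(p.1, p.2) ∈ M then inEnd A p else outEnd A p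

section Orientation

variable {n m : ℕ} {G : SimpleGraph (Fin n)} {A : Finset (Fin n)} {b : Fin n → ℕ}
  {M : Finset (Sym2 (Fin n))} {ends : Fin m → Fin n × Fin n}

theorem mk_inEnd_outEnd (A : Finset (Fin n)) (p : Fin n × Fin n) :
    s(inEnd A p, outEnd A p) = s(p.1, p.2) := by
  unfold inEnd outEnd; split
  · rfl
  · exact Sym2.eq_swap

theorem mk_arcTail_arcHead (A : Finset (Fin n)) (M : Finset (Sym2 (Fin n))) (p : Fin n × Fin n) :
    s(arcTail A M p, arcHead A M p) = s(p.1, p.2) := by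
  rw [← mk_inEnd_outEnd A p]
  unfold arcTail arcHead; split
  · exact Sym2.eq_swap
  · rfl

theorem IsEdgeList.adj (hE : IsEdgeList G ends) (k : Fin m) : G.Adj (ends k).1 (ends k).2 := by
  rw [← SimpleGraph.mem_edgeSet, ← hE.2]
  exact ⟨k, rfl⟩

theorem res_iff (hG : G.IsBipartiteWith (A : Set (Fin n)) (A : Set (Fin n))ᶜ)
    (hE : IsEdgeList G ends) {x y : Fin n} :
    Res G A M x y ↔ ∃ k, arcTail A M (ends k) = x ∧ arcHead A M (ends k) = y := by
  have hres : ∀ k, Res G A M (arcTail A M (ends k)) (arcHead A M (ends k)) := by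
    intro k
    have hadj := hE.adj k
    have hb := mem_iff_of_adj hG hadj
    rw [Finset.mem_coe, Finset.mem_coe] at hb
    refine ⟨?_, ?_⟩
    · rw [← SimpleGraph.mem_edgeSet, mk_arcTail_arcHead]; exact hadj
    · rw [mk_arcTail_arcHead, Finset.mem_coe]
      unfold arcTail inEnd outEnd
      split_ifs <;> simp_all
  constructor
  · intro h
    have : s(x, y) ∈ G.edgeSet := h.1
    rw [← hE.2] at this
    obtain ⟨k, hk⟩ := this
    simp only at hk
    rw [← mk_arcTail_arcHead A M] at hk
    rcases Sym2.eq_iff.1 hk with h' | ⟨h1, h2⟩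
    · exact ⟨k, h'⟩
    · have h3 := hres k
      rw [h1, h2] at h3
      have h4 := (res_compl hG).2 h3
      have h5 := h.2
      have h6 := h4.2
      rw [Set.mem_compl_iff] at h6
      tauto
  · rintro ⟨k, rfl, rfl⟩
    exact hres k

@[simp] theorem word_val (f : Fin n → ℕ) (v : Fin n) : word f v = f v := by simp [word]

/-- Load the ends of edge `i` inside and outside `A`, where `i` is register 19. -/
def loadEnds : Prog :=
  .cond (.eq (.get 0 (.get 2 (.reg 19))) (.const 1))
    (.seq (.assign 20 (.get 2 (.reg 19))) (.assign 21 (.get 3 (.reg 19))))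
    (.seq (.assign 20 (.get 3 (.reg 19))) (.assign 21 (.get 2 (.reg 19))))

/-- Store the residual arc of edge `i` in the arrays 20 and 21, and count the edges of the matching
at each vertex in the array 22. -/
def orientBody : Prog :=
  .seq loadEnds <|
    .cond (.eq (.get 4 (.reg 19)) (.const 1))
      (.seq (.store 22 (.reg 20) (.succ (.get 22 (.reg 20)))) <|
        .seq (.store 22 (.reg 21) (.succ (.get 22 (.reg 21)))) <|
        .seq (.store 20 (.reg 19) (.reg 21)) (.store 21 (.reg 19) (.reg 20)))
      (.seq (.store 20 (.reg 19) (.reg 20)) (.store 21 (.reg 19) (.reg 21)))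

theorem update_update_succ (d : ℕ → ℕ) {x y : ℕ} (hxy : x ≠ y) (v : ℕ) :
    Function.update (Function.update d x (d x + 1)) y (d y + 1) v =
      d v + if v = x ∨ v = y then 1 else 0 := by
  by_cases hy : v = y
  · subst hy; simp
  · by_cases hx : v = x
    · subst hx; simp [hy]
    · simp [hx, hy]

theorem runs_orient (hE : IsEdgeList G ends) (hM : ∀ e ∈ M, e ∈ G.edgeSet) :
    Runs (forLoop 19 1 orientBody) (inputState A b M ends) ((6 + orientBody.bound) * m + 5)
      fun s => (∀ k : Fin m, s.arr 20 k = arcTail A M (ends k) ∧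
        s.arr 21 k = arcHead A M (ends k)) ∧ ∀ v : Fin n, s.arr 22 v = matchDeg M v := by
  set e : Fin m → Sym2 (Fin n) := fun k => s((ends k).1, (ends k).2) with he
  refine (runs_forLoop (i := 19) (r := 1) (p := orientBody)
    (by simp [orientBody, loadEnds, Prog.LoopFree]) (by omega)
    (by simp [orientBody, loadEnds, Prog.WritesReg])
    (by simp [orientBody, loadEnds, Prog.WritesReg])
    (fun k s => (∀ j : Fin m, j.val < k → s.arr 20 j = arcTail A M (ends j) ∧
        s.arr 21 j = arcHead A M (ends j)) ∧
      ∀ v : Fin n, s.arr 22 v =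
        matchDeg ((Finset.univ.filter fun j : Fin m => j.val < k ∧ e j ∈ M).image e) v) ?_
    ?_).weaken le_rfl ?_
  · rintro k s hk hi ⟨hreg, harr⟩ ⟨h1, h2⟩
    have hk : k < m := hk
    have a0 : s.arr 0 = word fun v => if v ∈ A then 1 else 0 :=
      harr 0 (by simp [forLoop, orientBody, loadEnds, Prog.WritesArr])
    have a2 : s.arr 2 = word fun k => ((ends k).1 : ℕ) :=
      harr 2 (by simp [forLoop, orientBody, loadEnds, Prog.WritesArr])
    have a3 : s.arr 3 = word fun k => ((ends k).2 : ℕ) :=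
      harr 3 (by simp [forLoop, orientBody, loadEnds, Prog.WritesArr])
    have a4 : s.arr 4 = word fun k => if s((ends k).1, (ends k).2) ∈ M then 1 else 0 :=
      harr 4 (by simp [forLoop, orientBody, loadEnds, Prog.WritesArr])
    obtain ⟨κ, rfl⟩ : ∃ κ : Fin m, κ.val = k := ⟨⟨k, hk⟩, rfl⟩
    have hload : loadEnds.step s =
        (s.setReg 20 (inEnd A (ends κ))).setReg 21 (outEnd A (ends κ)) := by
      unfold inEnd outEnd
      by_cases hA : (ends κ).1 ∈ A <;>
        simp [loadEnds, Prog.step, Test.holds, Expr.eval, hi, a0, a2, a3, hA, reg_setReg_of_ne]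
    have hne : (inEnd A (ends κ)).val ≠ (outEnd A (ends κ)).val := by
      intro h
      have := mk_inEnd_outEnd A (ends κ)
      rw [Fin.ext h] at this
      have hadj := (hE.adj κ).ne
      rcases Sym2.eq_iff.1 this with ⟨h1, h2⟩ | ⟨h1, h2⟩
      · exact hadj (h1.symm.trans h2)
      · exact hadj (h2.symm.trans h1)
    have harcs : ∀ f g : ℕ → ℕ, (∀ j : Fin m, j.val < κ.val → f j = arcTail A M (ends j) ∧
        g j = arcHead A M (ends j)) → ∀ j : Fin m, j.val < κ.val + 1 →
        Function.update f κ (arcTail A M (ends κ)) j = arcTail A M (ends j) ∧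
          Function.update g κ (arcHead A M (ends κ)) j = arcHead A M (ends j) := by
      intro f g hfg j hj
      by_cases hjk : j = κ
      · subst hjk; simp
      · have : j.val ≠ κ.val := fun h => hjk (Fin.ext h)
        simp only [Function.update_of_ne this]
        exact hfg j (by omega)
    by_cases hm : e κ ∈ M
    · have hst : orientBody.step s = (((((s.setReg 20 (inEnd A (ends κ))).setReg 21
          (outEnd A (ends κ))).setArr 22 (inEnd A (ends κ))
          (s.arr 22 (inEnd A (ends κ)) + 1)).setArr 22 (outEnd A (ends κ))
          (s.arr 22 (outEnd A (ends κ)) + 1)).setArr 20 κ (outEnd A (ends κ))).setArr 21 κ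
          (inEnd A (ends κ)) := by
        have hm' : s((ends κ).1, (ends κ).2) ∈ M := hm
        simp [orientBody, Prog.step, hload, Test.holds, Expr.eval, hi, a4, reg_setReg_of_ne, hm',
          Function.update_of_ne hne.symm]
      have hins : (Finset.univ.filter fun j : Fin m => j.val < κ.val + 1 ∧ e j ∈ M).image e =
          insert (e κ)
            ((Finset.univ.filter fun j : Fin m => j.val < κ.val ∧ e j ∈ M).image e) := by
        rw [← Finset.image_insert]
        congr 1
        ext j
        simp only [Finset.mem_filter, Finset.mem_univ, true_and, Finset.mem_insert, Fin.ext_iff]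
        constructor
        · rintro ⟨h1, h2⟩
          by_cases h : j.val = κ.val
          · exact Or.inl h
          · exact Or.inr ⟨by omega, h2⟩
        · rintro (h | h)
          · rw [Fin.ext h]; exact ⟨by omega, hm⟩
          · exact ⟨by omega, h.2⟩
      have hnot : e κ ∉ (Finset.univ.filter fun j : Fin m => j.val < κ.val ∧ e j ∈ M).image e := by
        rw [Finset.mem_image]
        rintro ⟨j, hj, hjk⟩
        have := hE.1 hjk
        subst this
        simp at hj
      rw [hst]
      refine ⟨?_, fun v => ?_⟩
      · have hm' : s((ends κ).1, (ends κ).2) ∈ M := hm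
        have := harcs _ _ h1
        simp only [arcTail, arcHead, hm', if_true] at this
        simpa [arr_setArr_of_ne, arcTail, arcHead] using this
      · rw [hins, matchDeg_insert hnot, ← h2]
        have := update_update_succ (s.arr 22) hne v
        simp only [arr_setReg, arr_setArr_of_ne _ _ _ (show (22 : ℕ) ≠ 21 by omega),
          arr_setArr_of_ne _ _ _ (show (22 : ℕ) ≠ 20 by omega), arr_setArr_self]
        rw [this, he]
        simp only [← mk_inEnd_outEnd A (ends κ), Sym2.mem_iff, Fin.ext_iff]
    · have hst : orientBody.step s = (((s.setReg 20 (inEnd A (ends κ))).setReg 21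
          (outEnd A (ends κ))).setArr 20 κ (inEnd A (ends κ))).setArr 21 κ
          (outEnd A (ends κ)) := by
        have hm' : s((ends κ).1, (ends κ).2) ∉ M := hm
        simp [orientBody, Prog.step, hload, Test.holds, Expr.eval, hi, a4, reg_setReg_of_ne, hm']
      have hins : (Finset.univ.filter fun j : Fin m => j.val < κ.val + 1 ∧ e j ∈ M) =
          (Finset.univ.filter fun j : Fin m => j.val < κ.val ∧ e j ∈ M) := by
        ext j
        simp only [Finset.mem_filter, Finset.mem_univ, true_and]
        refine and_congr_left fun h2 => ?_
        have : j.val ≠ κ.val := fun h => hm (Fin.ext h ▸ h2)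
        omega
      rw [hst]
      refine ⟨?_, fun v => ?_⟩
      · have hm' : s((ends κ).1, (ends κ).2) ∉ M := hm
        have := harcs _ _ h1
        simp only [arcTail, arcHead, hm', if_false] at this
        simpa [arr_setArr_of_ne, arcTail, arcHead] using this
      · rw [hins, ← h2]
        simp [arr_setArr_of_ne]
  · refine ⟨fun j hj => absurd hj (by omega), fun v => ?_⟩
    simp [matchDeg, inputState]
  · rintro s ⟨h1, h2⟩
    refine ⟨fun k => h1 k k.2, fun v => ?_⟩
    rw [h2]
    congr 1
    ext f
    simp only [Finset.mem_image, Finset.mem_filter, Finset.mem_univ, true_and]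
    constructor
    · rintro ⟨j, hj, rfl⟩; exact hj.2
    · intro hf
      have := hM f hf
      rw [← hE.2] at this
      obtain ⟨j, rfl⟩ := this
      exact ⟨j, ⟨j.2, hf⟩, rfl⟩

end Orientation

end Decompose

/-! ### The remaining linear passes -/

section Phases

open Relation

variable {n m : ℕ} {G : SimpleGraph (Fin n)} {A : Finset (Fin n)} {b : Fin n → ℕ}
  {M : Finset (Sym2 (Fin n))} {ends : Fin m → Fin n × Fin n}

/-- List the vertex `i`, where `i` is register 19, in the array 25, and moreover in the array 23 or
24 if it is loose. The lengths of the three lists are in the registers 32, 30 and 31. -/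
def listBody : Prog :=
  .seq (.store 25 (.reg 32) (.reg 19)) <|
  .seq (.assign 32 (.succ (.reg 32)))
    (.cond (.lt (.get 22 (.reg 19)) (.get 1 (.reg 19)))
      (.cond (.eq (.get 0 (.reg 19)) (.const 1))
        (.seq (.store 23 (.reg 30) (.reg 19)) (.assign 30 (.succ (.reg 30))))
        (.seq (.store 24 (.reg 31) (.reg 19)) (.assign 31 (.succ (.reg 31)))))
      .skip)

/-- The list `l` consists of the vertices `v < k` that satisfy `P`. -/
structure Lists (P : Fin n → Prop) (k : ℕ) (l : List ℕ) : Prop where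
  length_le : l.length ≤ k
  mem_iff : ∀ x, x ∈ l ↔ ∃ v : Fin n, v.val = x ∧ v.val < k ∧ P v

theorem Lists.nil (P : Fin n → Prop) : Lists P 0 [] := ⟨le_rfl, by simp⟩

theorem Lists.push {P : Fin n → Prop} {v : Fin n} {l : List ℕ} (h : Lists P v l) (hv : P v) :
    Lists P (v + 1) (v :: l) := by
  refine ⟨Nat.succ_le_succ h.length_le, fun x => ?_⟩
  rw [List.mem_cons, h.mem_iff]
  constructor
  · rintro (rfl | ⟨w, rfl, h1, h2⟩)
    · exact ⟨v, rfl, by omega, hv⟩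
    · exact ⟨w, rfl, by omega, h2⟩
  · rintro ⟨w, rfl, h1, h2⟩
    by_cases h : w.val = v.val
    · exact Or.inl h
    · exact Or.inr ⟨w, rfl, by omega, h2⟩

theorem Lists.skip {P : Fin n → Prop} {v : Fin n} {l : List ℕ} (h : Lists P v l) (hv : ¬ P v) :
    Lists P (v + 1) l := by
  refine ⟨h.length_le.trans (Nat.le_succ _), fun x => ?_⟩
  rw [h.mem_iff]
  constructor
  · rintro ⟨w, rfl, h1, h2⟩
    exact ⟨w, rfl, by omega, h2⟩
  · rintro ⟨w, rfl, h1, h2⟩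
    have : w.val ≠ v.val := fun h => hv (Fin.ext h ▸ h2)
    exact ⟨w, rfl, by omega, h2⟩

theorem runs_list {s : State} (hn : s.reg 0 = n)
    (a0 : s.arr 0 = word fun v => if v ∈ A then 1 else 0) (a1 : s.arr 1 = word b)
    (a22 : ∀ v : Fin n, s.arr 22 v = matchDeg M v) (r30 : s.reg 30 = 0) (r31 : s.reg 31 = 0)
    (r32 : s.reg 32 = 0) :
    Runs (forLoop 19 0 listBody) s ((6 + listBody.bound) * n + 5) fun s' =>
      (∃ l, StackRep (s'.arr 23) l (s'.reg 30) ∧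
        Lists (fun v => v ∈ A ∧ IsLooseVertex b M v) n l) ∧
      (∃ l, StackRep (s'.arr 24) l (s'.reg 31) ∧
        Lists (fun v => v ∉ A ∧ IsLooseVertex b M v) n l) ∧
      ∃ l, StackRep (s'.arr 25) l (s'.reg 32) ∧ Lists (fun _ : Fin n => True) n l := by
  have key := runs_forLoop (i := 19) (r := 0) (p := listBody) (s := s)
    (by simp [listBody, Prog.LoopFree]) (by omega)
    (by simp [listBody, Prog.WritesReg]) (by simp [listBody, Prog.WritesReg])
    (fun k s' => (∃ l, StackRep (s'.arr 23) l (s'.reg 30) ∧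
        Lists (fun v => v ∈ A ∧ IsLooseVertex b M v) k l) ∧
      (∃ l, StackRep (s'.arr 24) l (s'.reg 31) ∧
        Lists (fun v => v ∉ A ∧ IsLooseVertex b M v) k l) ∧
      ∃ l, StackRep (s'.arr 25) l (s'.reg 32) ∧ Lists (fun _ : Fin n => True) k l) ?_
    ⟨⟨[], by simpa [reg_setReg_of_ne, StackRep] using r30, Lists.nil _⟩,
      ⟨[], by simpa [reg_setReg_of_ne, StackRep] using r31, Lists.nil _⟩,
      [], by simpa [reg_setReg_of_ne, StackRep] using r32, Lists.nil _⟩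
  · rwa [hn] at key
  · rintro k s' hk hi ⟨hreg, harr⟩ ⟨⟨la, ha, hla⟩, ⟨lb, hb, hlb⟩, l, hl, hll⟩
    rw [hn] at hk
    obtain ⟨v, rfl⟩ : ∃ v : Fin n, v.val = k := ⟨⟨k, hk⟩, rfl⟩
    have e0 : s'.arr 0 v = if v ∈ A then 1 else 0 := by
      rw [harr 0 (by simp [forLoop, listBody, Prog.WritesArr]), a0, word_val]
    have e1 : s'.arr 1 v = b v := by
      rw [harr 1 (by simp [forLoop, listBody, Prog.WritesArr]), a1, word_val]
    have e22 : s'.arr 22 v = matchDeg M v := by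
      rw [harr 22 (by simp [forLoop, listBody, Prog.WritesArr]), a22]
    by_cases hlt : matchDeg M v < b v
    · by_cases hA : v ∈ A
      · have hst : listBody.step s' = ((((s'.setArr 25 (s'.reg 32) v).setReg 32
            (s'.reg 32 + 1)).setArr 23 (s'.reg 30) v).setReg 30 (s'.reg 30 + 1)) := by
          simp [listBody, Prog.step, Test.holds, Expr.eval, hi, reg_setReg_of_ne,
            arr_setArr_of_ne, e0, e1, e22, hlt, hA]
        rw [hst]
        refine ⟨⟨_, ?_, hla.push ⟨hA, hlt⟩⟩, ⟨_, ?_, hlb.skip fun h => h.1 hA⟩, _, ?_,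
          hll.push trivial⟩
        · simpa [reg_setReg_of_ne, arr_setArr_of_ne] using ha.push v
        · simpa [reg_setReg_of_ne, arr_setArr_of_ne] using hb
        · simpa [reg_setReg_of_ne, arr_setArr_of_ne] using hl.push v
      · have hst : listBody.step s' = ((((s'.setArr 25 (s'.reg 32) v).setReg 32
            (s'.reg 32 + 1)).setArr 24 (s'.reg 31) v).setReg 31 (s'.reg 31 + 1)) := by
          simp [listBody, Prog.step, Test.holds, Expr.eval, hi, reg_setReg_of_ne,
            arr_setArr_of_ne, e0, e1, e22, hlt, hA]
        rw [hst]
        refine ⟨⟨_, ?_, hla.skip fun h => hA h.1⟩, ⟨_, ?_, hlb.push ⟨hA, hlt⟩⟩, _, ?_,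
          hll.push trivial⟩
        · simpa [reg_setReg_of_ne, arr_setArr_of_ne] using ha
        · simpa [reg_setReg_of_ne, arr_setArr_of_ne] using hb.push v
        · simpa [reg_setReg_of_ne, arr_setArr_of_ne] using hl.push v
    · have hst : listBody.step s' = (s'.setArr 25 (s'.reg 32) v).setReg 32 (s'.reg 32 + 1) := by
        simp [listBody, Prog.step, Test.holds, Expr.eval, hi, reg_setReg_of_ne,
          arr_setArr_of_ne, e1, e22, hlt]
      rw [hst]
      refine ⟨⟨_, ?_, hla.skip fun h => hlt h.2⟩, ⟨_, ?_, hlb.skip fun h => hlt h.2⟩, _, ?_,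
        hll.push trivial⟩
      · simpa [reg_setReg_of_ne, arr_setArr_of_ne] using ha
      · simpa [reg_setReg_of_ne, arr_setArr_of_ne] using hb
      · simpa [reg_setReg_of_ne, arr_setArr_of_ne] using hl.push v

/-- Append an arc between the vertices in the registers `x` and `y` to the arc list in the arrays 26
and 27, whose length is in the register 33. -/
def appendArc (x y : ℕ) : Prog :=
  .seq (.store 26 (.reg 33) (.reg x)) <|
  .seq (.store 27 (.reg 33) (.reg y)) (.assign 33 (.succ (.reg 33)))

/-- Append the residual arc `i`, where `i` is register 19, and its reversal if the arc is flexible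
because of loose vertices. The arrays 32 and 42 mark the vertices reached from loose vertices of the
two colour classes. -/
def augBody : Prog :=
  .seq (.assign 20 (.get 20 (.reg 19))) <|
  .seq (.assign 21 (.get 21 (.reg 19))) <|
  .seq (appendArc 20 21) <|
  .seq (.cond (.lt (.const 0) (.get 32 (.reg 20)))
      (.cond (.lt (.const 0) (.get 1 (.reg 21))) (appendArc 21 20) .skip) .skip)
    (.cond (.lt (.const 0) (.get 42 (.reg 21)))
      (.cond (.lt (.const 0) (.get 1 (.reg 20))) (appendArc 21 20) .skip) .skip)

theorem edge_update_iff {f g : ℕ → ℕ} {k x y u v : ℕ} :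
    Edge (Function.update f k x) (Function.update g k y) (k + 1) u v ↔
      Edge f g k u v ∨ (x = u ∧ y = v) := by
  unfold Edge
  constructor
  · rintro ⟨j, hj, h1, h2⟩
    by_cases h : j = k
    · subst h; simp only [Function.update_self] at h1 h2; exact Or.inr ⟨h1, h2⟩
    · rw [Function.update_of_ne h] at h1 h2
      exact Or.inl ⟨j, by omega, h1, h2⟩
  · rintro (⟨j, hj, h1, h2⟩ | ⟨rfl, rfl⟩)
    · refine ⟨j, by omega, ?_⟩
      rw [Function.update_of_ne (by omega), Function.update_of_ne (by omega)]
      exact ⟨h1, h2⟩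
    · exact ⟨k, by omega, by simp⟩

theorem appendArc_step (x y : ℕ) (s : State) :
    (∀ u v, Edge (((appendArc x y).step s).arr 26) (((appendArc x y).step s).arr 27)
      (((appendArc x y).step s).reg 33) u v ↔
      Edge (s.arr 26) (s.arr 27) (s.reg 33) u v ∨ (s.reg x = u ∧ s.reg y = v)) ∧
    ((appendArc x y).step s).reg 33 = s.reg 33 + 1 ∧
    (∀ z, z ≠ 33 → ((appendArc x y).step s).reg z = s.reg z) ∧
    ∀ a, a ≠ 26 → a ≠ 27 → ((appendArc x y).step s).arr a = s.arr a := by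
  refine ⟨fun u v => ?_, ?_, fun z hz => ?_, fun a h1 h2 => ?_⟩
  · simp [appendArc, Prog.step, Expr.eval, arr_setArr_of_ne, edge_update_iff]
  · simp [appendArc, Prog.step, Expr.eval]
  · simp [appendArc, Prog.step, Expr.eval, reg_setReg_of_ne _ _ hz]
  · simp [appendArc, Prog.step, arr_setArr_of_ne, h1, h2]

theorem runs_aug {s : State} (hm : s.reg 1 = m) (r33 : s.reg 33 = 0) :
    Runs (forLoop 19 1 augBody) s ((6 + augBody.bound) * m + 5) fun s' =>
      s'.reg 33 ≤ 3 * m ∧ ∀ x y, Edge (s'.arr 26) (s'.arr 27) (s'.reg 33) x y ↔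
        Edge (s.arr 20) (s.arr 21) m x y ∨ (Edge (s.arr 20) (s.arr 21) m y x ∧
          ((0 < s.arr 32 y ∧ 0 < s.arr 1 x) ∨ (0 < s.arr 42 x ∧ 0 < s.arr 1 y))) := by
  have key := runs_forLoop (i := 19) (r := 1) (p := augBody) (s := s)
    (by simp [augBody, appendArc, Prog.LoopFree]) (by omega)
    (by simp [augBody, appendArc, Prog.WritesReg]) (by simp [augBody, appendArc, Prog.WritesReg])
    (fun k s' => s'.reg 33 ≤ 3 * k ∧ ∀ x y, Edge (s'.arr 26) (s'.arr 27) (s'.reg 33) x y ↔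
        Edge (s.arr 20) (s.arr 21) k x y ∨ (Edge (s.arr 20) (s.arr 21) k y x ∧
          ((0 < s.arr 32 y ∧ 0 < s.arr 1 x) ∨ (0 < s.arr 42 x ∧ 0 < s.arr 1 y)))) ?_
    (by simp [Edge, reg_setReg_of_ne, r33])
  · rwa [hm] at key
  · rintro k s' hk hi ⟨hreg, harr⟩ ⟨h1, h2⟩
    have e1 : s'.arr 1 = s.arr 1 := harr 1 (by simp [forLoop, augBody, appendArc, Prog.WritesArr])
    have e20 : s'.arr 20 = s.arr 20 :=
      harr 20 (by simp [forLoop, augBody, appendArc, Prog.WritesArr])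
    have e21 : s'.arr 21 = s.arr 21 :=
      harr 21 (by simp [forLoop, augBody, appendArc, Prog.WritesArr])
    have e32 : s'.arr 32 = s.arr 32 :=
      harr 32 (by simp [forLoop, augBody, appendArc, Prog.WritesArr])
    have e42 : s'.arr 42 = s.arr 42 :=
      harr 42 (by simp [forLoop, augBody, appendArc, Prog.WritesArr])
    have hsucc : ∀ u v, Edge (s.arr 20) (s.arr 21) (k + 1) u v ↔
        Edge (s.arr 20) (s.arr 21) k u v ∨ (s.arr 20 k = u ∧ s.arr 21 k = v) := by
      intro u v
      have := @edge_update_iff (s.arr 20) (s.arr 21) k (s.arr 20 k) (s.arr 21 k) u v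
      simpa using this
    set x := s.arr 20 k
    set y := s.arr 21 k
    set s1 := (s'.setReg 20 x).setReg 21 y with hs1
    have r20 : s1.reg 20 = x := by simp [hs1, reg_setReg_of_ne]
    have r21 : s1.reg 21 = y := by simp [hs1]
    have r33' : s1.reg 33 = s'.reg 33 := by simp [hs1, reg_setReg_of_ne]
    have a1 : s1.arr = s'.arr := rfl
    have hA := appendArc_step 20 21 s1
    set s2 := (appendArc 20 21).step s1 with hs2
    have hst : augBody.step s' =
        (Prog.seq (.cond (.lt (.const 0) (.get 32 (.reg 20)))
          (.cond (.lt (.const 0) (.get 1 (.reg 21))) (appendArc 21 20) .skip) .skip)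
        (.cond (.lt (.const 0) (.get 42 (.reg 21)))
          (.cond (.lt (.const 0) (.get 1 (.reg 20))) (appendArc 21 20) .skip) .skip)).step s2 := by
      have : s1 = (Prog.assign 21 (.get 21 (.reg 19))).step
          ((Prog.assign 20 (.get 20 (.reg 19))).step s') := by
        simp [Prog.step, Expr.eval, hi, e20, e21, reg_setReg_of_ne, hs1, x, y]
      rw [hs2, this]
      rfl
    -- both tests append the same arc, so the order and the number of copies do not matter
    have hcond : ∀ (t : State) (a c d : ℕ), (c = 20 ∨ c = 21) → (d = 20 ∨ d = 21) →
        (a = 32 ∨ a = 42) → t.reg 20 = x → t.reg 21 = y →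
        (∀ a, a ≠ 26 → a ≠ 27 → t.arr a = s.arr a) →
        ∀ t', t' = (Prog.cond (.lt (.const 0) (.get a (.reg c)))
          (.cond (.lt (.const 0) (.get 1 (.reg d))) (appendArc 21 20) .skip) .skip).step t →
        (∀ u v, Edge (t'.arr 26) (t'.arr 27) (t'.reg 33) u v ↔
          Edge (t.arr 26) (t.arr 27) (t.reg 33) u v ∨ ((y = u ∧ x = v) ∧
            0 < s.arr a (t.reg c) ∧ 0 < s.arr 1 (t.reg d))) ∧
        t'.reg 33 ≤ t.reg 33 + 1 ∧ (∀ z, z ≠ 33 → t'.reg z = t.reg z) ∧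
        ∀ a, a ≠ 26 → a ≠ 27 → t'.arr a = t.arr a := by
      intro t a c d hc hd ha ht20 ht21 hta t' ht'
      have hap := appendArc_step 21 20 t
      have ta : t.arr a = s.arr a := hta a (by omega) (by omega)
      have tb : t.arr 1 = s.arr 1 := hta 1 (by omega) (by omega)
      simp only [Prog.step, Test.holds, Expr.eval, ta, tb] at ht'
      by_cases q1 : 0 < s.arr a (t.reg c)
      · by_cases q2 : 0 < s.arr 1 (t.reg d)
        · rw [if_pos q1, if_pos q2] at ht'
          rw [ht']
          refine ⟨fun u v => ?_, hap.2.1.le, hap.2.2⟩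
          rw [hap.1, ht20, ht21]
          simp [q1, q2]
        · rw [if_pos q1, if_neg q2] at ht'
          subst ht'
          exact ⟨fun u v => by simp [q2], by omega, fun _ _ => rfl, fun _ _ _ => rfl⟩
      · rw [if_neg q1] at ht'
        subst ht'
        exact ⟨fun u v => by simp [q1], by omega, fun _ _ => rfl, fun _ _ _ => rfl⟩
    have s2arr : ∀ a, a ≠ 26 → a ≠ 27 → s2.arr a = s.arr a := by
      intro a q1 q2
      rw [hA.2.2.2 a q1 q2, a1]
      exact harr a (by simp [forLoop, augBody, appendArc, Prog.WritesArr, q1, q2])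
    have s20 : s2.reg 20 = x := by rw [hA.2.2.1 20 (by omega), r20]
    have s21 : s2.reg 21 = y := by rw [hA.2.2.1 21 (by omega), r21]
    obtain ⟨c1, c2, c3, c4⟩ := hcond s2 32 20 21 (by omega) (by omega) (by omega) s20 s21 s2arr _ rfl
    obtain ⟨d1, d2, d3, d4⟩ := hcond _ 42 21 20 (by omega) (by omega) (by omega)
      ((c3 20 (by omega)).trans s20) ((c3 21 (by omega)).trans s21)
      (fun a q1 q2 => (c4 a q1 q2).trans (s2arr a q1 q2)) _ rfl
    rw [hst]
    simp only [arr_setReg, reg_setReg_of_ne _ _ (show (33 : ℕ) ≠ 19 by omega)]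
    have hr33 := hA.2.1
    refine ⟨d2.trans ?_, fun u v => ?_⟩
    · omega
    · refine (d1 u v).trans ?_
      rw [c1, hA.1, r33', a1, h2, hsucc, hsucc, c3 20 (by omega), c3 21 (by omega), s20, s21, r20,
        r21]
      constructor
      · rintro (((((h | h) | h) | ⟨⟨rfl, rfl⟩, h, h'⟩) | ⟨⟨rfl, rfl⟩, h, h'⟩))
        · exact Or.inl (Or.inl h)
        · exact Or.inr ⟨Or.inl h.1, h.2⟩
        · exact Or.inl (Or.inr h)
        · exact Or.inr ⟨Or.inr ⟨rfl, rfl⟩, Or.inl ⟨h, h'⟩⟩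
        · exact Or.inr ⟨Or.inr ⟨rfl, rfl⟩, Or.inr ⟨h, h'⟩⟩
      · rintro ((h | h) | ⟨h | ⟨rfl, rfl⟩, h'⟩)
        · exact Or.inl (Or.inl (Or.inl (Or.inl h)))
        · exact Or.inl (Or.inl (Or.inr h))
        · exact Or.inl (Or.inl (Or.inl (Or.inr ⟨h, h'⟩)))
        · rcases h' with h' | h'
          · exact Or.inl (Or.inr ⟨⟨rfl, rfl⟩, h'⟩)
          · exact Or.inr ⟨⟨rfl, rfl⟩, h'⟩

/-- Output the component of the vertex `i`, where `i` is register 19, and what the vertex says about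
the component. -/
def outputBody : Prog :=
  .seq (.assign 20 (.pred (.get 62 (.reg 19)))) <|
  .seq (.store 5 (.reg 19) (.reg 20)) <|
  .seq (.cond (.lt (.const 0) (.get 32 (.reg 19)))
      (.seq (.store 7 (.reg 20) (.const 1)) (.store 6 (.reg 20) (.const 1))) .skip)
    (.cond (.lt (.const 0) (.get 42 (.reg 19)))
      (.seq (.store 8 (.reg 20) (.const 1)) (.store 6 (.reg 20) (.const 1))) .skip)

theorem runs_output {s : State} (hn : s.reg 0 = n)
    (a6 : s.arr 6 = fun _ => 0) (a7 : s.arr 7 = fun _ => 0) (a8 : s.arr 8 = fun _ => 0) :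
    Runs (forLoop 19 0 outputBody) s ((6 + outputBody.bound) * n + 5) fun s' =>
      (∀ v < n, s'.arr 5 v = s.arr 62 v - 1) ∧
      (∀ c, s'.arr 6 c = 1 ↔ ∃ v < n, s.arr 62 v - 1 = c ∧ (0 < s.arr 32 v ∨ 0 < s.arr 42 v)) ∧
      (∀ c, s'.arr 7 c = 1 ↔ ∃ v < n, s.arr 62 v - 1 = c ∧ 0 < s.arr 32 v) ∧
      ∀ c, s'.arr 8 c = 1 ↔ ∃ v < n, s.arr 62 v - 1 = c ∧ 0 < s.arr 42 v := by
  have key := runs_forLoop (i := 19) (r := 0) (p := outputBody) (s := s)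
    (by simp [outputBody, Prog.LoopFree]) (by omega)
    (by simp [outputBody, Prog.WritesReg]) (by simp [outputBody, Prog.WritesReg])
    (fun k s' => (∀ v < k, s'.arr 5 v = s.arr 62 v - 1) ∧
      (∀ c, s'.arr 6 c = 1 ↔ ∃ v < k, s.arr 62 v - 1 = c ∧ (0 < s.arr 32 v ∨ 0 < s.arr 42 v)) ∧
      (∀ c, s'.arr 7 c = 1 ↔ ∃ v < k, s.arr 62 v - 1 = c ∧ 0 < s.arr 32 v) ∧
      ∀ c, s'.arr 8 c = 1 ↔ ∃ v < k, s.arr 62 v - 1 = c ∧ 0 < s.arr 42 v) ?_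
    (by simp [a6, a7, a8])
  · rwa [hn] at key
  · rintro k s' hk hi ⟨hreg, harr⟩ ⟨h5, h6, h7, h8⟩
    have e62 : s'.arr 62 = s.arr 62 := harr 62 (by simp [forLoop, outputBody, Prog.WritesArr])
    have e32 : s'.arr 32 = s.arr 32 := harr 32 (by simp [forLoop, outputBody, Prog.WritesArr])
    have e42 : s'.arr 42 = s.arr 42 := harr 42 (by simp [forLoop, outputBody, Prog.WritesArr])
    have hupd : ∀ (f : ℕ → ℕ) (P : ℕ → Prop), (∀ c, f c = 1 ↔ ∃ v < k, s.arr 62 v - 1 = c ∧ P v) →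
        (P k → ∀ c, Function.update f (s.arr 62 k - 1) 1 c = 1 ↔
          ∃ v < k + 1, s.arr 62 v - 1 = c ∧ P v) ∧
        (¬ P k → ∀ c, f c = 1 ↔ ∃ v < k + 1, s.arr 62 v - 1 = c ∧ P v) := by
      intro f P hf
      have hs : ∀ c, (∃ v < k + 1, s.arr 62 v - 1 = c ∧ P v) ↔
          (∃ v < k, s.arr 62 v - 1 = c ∧ P v) ∨ (s.arr 62 k - 1 = c ∧ P k) := by
        intro c
        constructor
        · rintro ⟨v, hv, h⟩
          rcases Nat.lt_succ_iff_lt_or_eq.1 hv with hv | rfl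
          · exact Or.inl ⟨v, hv, h⟩
          · exact Or.inr h
        · rintro (⟨v, hv, h⟩ | h)
          · exact ⟨v, by omega, h⟩
          · exact ⟨k, by omega, h⟩
      constructor
      · intro hP c
        rw [hs, ← hf]
        by_cases hc : c = s.arr 62 k - 1
        · subst hc; simp [hP]
        · simp [Function.update_of_ne hc, Ne.symm hc]
      · intro hP c
        rw [hs, ← hf]; simp [hP]
    have q6 := hupd _ _ h6
    have q7 := hupd _ _ h7
    have q8 := hupd _ _ h8
    have q5 : ∀ v < k + 1, Function.update (s'.arr 5) k (s.arr 62 k - 1) v = s.arr 62 v - 1 := by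
      intro v hv
      by_cases h : v = k
      · subst h; simp
      · rw [Function.update_of_ne h]; exact h5 v (by omega)
    have e32' : s'.arr 32 k = s.arr 32 k := by rw [e32]
    have e42' : s'.arr 42 k = s.arr 42 k := by rw [e42]
    by_cases hA : 0 < s.arr 32 k <;> by_cases hB : 0 < s.arr 42 k
    · have hst : outputBody.step s' = ((((((s'.setReg 20 (s.arr 62 k - 1)).setArr 5 k
          (s.arr 62 k - 1)).setArr 7 (s.arr 62 k - 1) 1).setArr 6 (s.arr 62 k - 1) 1).setArr 8
          (s.arr 62 k - 1) 1).setArr 6 (s.arr 62 k - 1) 1) := by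
        simp [outputBody, Prog.step, Test.holds, Expr.eval, hi, reg_setReg_of_ne,
          arr_setArr_of_ne, e62, e32', e42', hA, hB]
      rw [hst]
      have q := And.intro q5 (And.intro (q6.1 (Or.inl hA)) (And.intro (q7.1 hA) (q8.1 hB)))
      simpa [arr_setArr_of_ne] using q
    · have hst : outputBody.step s' = ((((s'.setReg 20 (s.arr 62 k - 1)).setArr 5 k
          (s.arr 62 k - 1)).setArr 7 (s.arr 62 k - 1) 1).setArr 6 (s.arr 62 k - 1) 1) := by
        simp [outputBody, Prog.step, Test.holds, Expr.eval, hi, reg_setReg_of_ne,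
          arr_setArr_of_ne, e62, e32', e42', hA, hB]
      rw [hst]
      have q := And.intro q5 (And.intro (q6.1 (Or.inl hA)) (And.intro (q7.1 hA) (q8.2 hB)))
      simpa [arr_setArr_of_ne] using q
    · have hst : outputBody.step s' = ((((s'.setReg 20 (s.arr 62 k - 1)).setArr 5 k
          (s.arr 62 k - 1)).setArr 8 (s.arr 62 k - 1) 1).setArr 6 (s.arr 62 k - 1) 1) := by
        simp [outputBody, Prog.step, Test.holds, Expr.eval, hi, reg_setReg_of_ne,
          arr_setArr_of_ne, e62, e32', e42', hA, hB]
      rw [hst]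
      have q := And.intro q5 (And.intro (q6.1 (Or.inr hB)) (And.intro (q7.2 hA) (q8.1 hB)))
      simpa [arr_setArr_of_ne] using q
    · have hst : outputBody.step s' = (s'.setReg 20 (s.arr 62 k - 1)).setArr 5 k
          (s.arr 62 k - 1) := by
        simp [outputBody, Prog.step, Test.holds, Expr.eval, hi, reg_setReg_of_ne,
          arr_setArr_of_ne, e62, e32', e42', hA, hB]
      rw [hst]
      have q := And.intro q5 (And.intro (q6.2 (not_or.2 ⟨hA, hB⟩)) (And.intro (q7.2 hA) (q8.2 hB)))
      simpa [arr_setArr_of_ne] using q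

/-- Output the pair of components that the residual arc `i` contributes to the order, where `i` is
register 19. -/
def pairBody : Prog :=
  .seq (.store 9 (.reg 19) (.get 5 (.get 21 (.reg 19))))
    (.store 10 (.reg 19) (.get 5 (.get 20 (.reg 19))))

theorem runs_pair {s : State} (hm : s.reg 1 = m) :
    Runs (forLoop 19 1 pairBody) s ((6 + pairBody.bound) * m + 5) fun s' =>
      ∀ j < m, s'.arr 9 j = s.arr 5 (s.arr 21 j) ∧ s'.arr 10 j = s.arr 5 (s.arr 20 j) := by
  have key := runs_forLoop (i := 19) (r := 1) (p := pairBody) (s := s)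
    (by simp [pairBody, Prog.LoopFree]) (by omega)
    (by simp [pairBody, Prog.WritesReg]) (by simp [pairBody, Prog.WritesReg])
    (fun k s' => ∀ j < k, s'.arr 9 j = s.arr 5 (s.arr 21 j) ∧ s'.arr 10 j = s.arr 5 (s.arr 20 j))
    ?_ (by simp)
  · rwa [hm] at key
  · rintro k s' hk hi ⟨hreg, harr⟩ h1 j hj
    have e5 : s'.arr 5 = s.arr 5 := harr 5 (by simp [forLoop, pairBody, Prog.WritesArr])
    have e20 : s'.arr 20 = s.arr 20 := harr 20 (by simp [forLoop, pairBody, Prog.WritesArr])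
    have e21 : s'.arr 21 = s.arr 21 := harr 21 (by simp [forLoop, pairBody, Prog.WritesArr])
    have hst : pairBody.step s' = (s'.setArr 9 k (s.arr 5 (s.arr 21 k))).setArr 10 k
        (s.arr 5 (s.arr 20 k)) := by
      simp [pairBody, Prog.step, Expr.eval, hi, arr_setArr_of_ne, e5, e20, e21]
    rw [hst]
    by_cases h : j = k
    · subst h; simp [arr_setArr_of_ne]
    · simpa [arr_setArr_of_ne, Function.update_of_ne h] using h1 j (by omega)

end Phases

/-! ### The whole program -/

section Main

open Relation

variable {n m : ℕ} {G : SimpleGraph (Fin n)} {A : Finset (Fin n)} {b : Fin n → ℕ}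
  {M : Finset (Sym2 (Fin n))} {ends : Fin m → Fin n × Fin n}

/-- The digraph on the natural numbers with the arcs `Edge src dst N` is the digraph `R`. -/
def IsArcList (src dst : ℕ → ℕ) (N : ℕ) (R : Fin n → Fin n → Prop) : Prop :=
  ∀ x y, Edge src dst N x y ↔ ∃ u v : Fin n, u.val = x ∧ v.val = y ∧ R u v

theorem IsArcList.reach_iff {src dst : ℕ → ℕ} {N : ℕ} {R : Fin n → Fin n → Prop}
    (h : IsArcList src dst N R) {u v : Fin n} : Reach src dst N u v ↔ ReflTransGen R u v := by
  constructor
  · have key : ∀ x, Reach src dst N u x → ∃ v : Fin n, v.val = x ∧ ReflTransGen R u v := by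
      intro x hx
      induction hx with
      | refl => exact ⟨u, rfl, .refl⟩
      | tail _ hxy ih =>
        obtain ⟨v, rfl, hv⟩ := ih
        obtain ⟨v', w, h1, rfl, h2⟩ := (h _ _).1 hxy
        rw [Fin.ext h1] at h2
        exact ⟨w, rfl, hv.tail h2⟩
    intro huv
    obtain ⟨w, hw, h1⟩ := key v huv
    rwa [Fin.ext hw] at h1
  · intro huv
    induction huv with
    | refl => exact .refl
    | tail _ hxy ih => exact ih.tail ((h _ _).2 ⟨_, _, rfl, rfl, hxy⟩)

theorem IsArcList.lt {src dst : ℕ → ℕ} {N : ℕ} {R : Fin n → Fin n → Prop}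
    (h : IsArcList src dst N R) : ∀ j < N, src j < n ∧ dst j < n := by
  intro j hj
  obtain ⟨u, v, h1, h2, -⟩ := (h (src j) (dst j)).1 ⟨j, hj, rfl, rfl⟩
  exact ⟨h1 ▸ u.2, h2 ▸ v.2⟩

theorem IsArcList.swap {src dst : ℕ → ℕ} {N : ℕ} {R R' : Fin n → Fin n → Prop}
    (h : IsArcList src dst N R) (hR : ∀ u v, R' u v ↔ R v u) : IsArcList dst src N R' := by
  intro x y
  have : Edge dst src N x y ↔ Edge src dst N y x := by simp only [Edge, and_comm]
  rw [this, h]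
  constructor
  · rintro ⟨u, v, h1, h2, h3⟩; exact ⟨v, u, h2, h1, (hR _ _).2 h3⟩
  · rintro ⟨u, v, h1, h2, h3⟩; exact ⟨v, u, h2, h1, (hR _ _).1 h3⟩

theorem search_writesReg {src dst ord h rN rC x : ℕ} (hx : x < 10 ∨ 18 < x) :
    ¬ (search src dst ord h rN rC).WritesReg x := by
  simp only [search, searchInit, forLoop, linkBody, searchBody, visitBody, Prog.WritesReg, or_false, false_or]
  omega

theorem search_writesArr {src dst ord h rN rC a : ℕ} (ha : a < h ∨ h + 4 < a) :
    ¬ (search src dst ord h rN rC).WritesArr a := by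
  simp only [search, searchInit, forLoop, linkBody, searchBody, visitBody, Prog.WritesArr, or_false, false_or]
  omega

/-- Find the residual digraph and the vertices reached from loose vertices of either colour class,
following the arcs for the one and opposing them for the other. -/
def hookProg : Prog :=
  .seq (forLoop 19 1 orientBody) <|
  .seq (forLoop 19 0 listBody) <|
  .seq (search 20 21 23 30 1 30) (search 21 20 24 40 1 31)

theorem hookProg_writesReg {x : ℕ} (hx : x < 10 ∨ 32 < x) : ¬ hookProg.WritesReg x := by
  simp only [hookProg, forLoop, orientBody, loadEnds, listBody, Prog.WritesReg, or_false, false_or, not_or]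
  have h1 := @search_writesReg 20 21 23 30 1 30 x (by omega)
  have h2 := @search_writesReg 21 20 24 40 1 31 x (by omega)
  refine ⟨?_, ?_, h1, h2⟩ <;> omega

theorem hookProg_writesArr {a : ℕ} (ha : a < 20 ∨ (25 < a ∧ a < 30) ∨ 44 < a) :
    ¬ hookProg.WritesArr a := by
  simp only [hookProg, forLoop, orientBody, loadEnds, listBody, Prog.WritesArr, or_false, false_or, not_or]
  have h1 := @search_writesArr 20 21 23 30 1 30 a (by omega)
  have h2 := @search_writesArr 21 20 24 40 1 31 a (by omega)
  refine ⟨?_, ?_, h1, h2⟩ <;> omega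

/-- The outcome of `hookProg`. -/
structure HookData (G : SimpleGraph (Fin n)) (A : Finset (Fin n)) (b : Fin n → ℕ)
    (M : Finset (Sym2 (Fin n))) (m : ℕ) (s : State) : Prop where
  arcs : IsArcList (s.arr 20) (s.arr 21) m (Res G A M)
  inside : ∀ v : Fin n, s.arr 32 v ≠ 0 ↔ v ∈ hooked G (A : Set (Fin n)) b M
  outside : ∀ v : Fin n, s.arr 42 v ≠ 0 ↔ v ∈ hooked G (A : Set (Fin n))ᶜ b M
  vertices : ∃ l, StackRep (s.arr 25) l (s.reg 32) ∧ Lists (fun _ : Fin n => True) n l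

theorem runs_hookProg (hG : G.IsBipartiteWith (A : Set (Fin n)) (A : Set (Fin n))ᶜ)
    (hE : IsEdgeList G ends) (hM : IsMaxBMatching G b M) :
    Runs hookProg (inputState A b M ends) (2000 * (n + m + 1)) fun s => HookData G A b M m s := by
  have hT : ((6 + orientBody.bound) * m + 5) + (((6 + listBody.bound) * n + 5) +
      (200 * (m + n + n + 1) + 200 * (m + n + n + 1))) ≤ 2000 * (n + m + 1) := by
    have h1 : orientBody.bound = 43 := rfl
    have h2 : listBody.bound = 28 := rfl
    rw [h1, h2]
    omega
  refine Runs.weaken ?_ hT fun s h => h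
  refine (runs_orient hE hM.1.1).frame.seq ?_
  rintro s1 ⟨⟨h1, h2⟩, f1, g1⟩
  have arcs1 : IsArcList (s1.arr 20) (s1.arr 21) m (Res G A M) := by
    intro x y
    constructor
    · rintro ⟨j, hj, rfl, rfl⟩
      have := h1 ⟨j, hj⟩
      exact ⟨_, _, this.1.symm, this.2.symm, (res_iff hG hE).2 ⟨_, rfl, rfl⟩⟩
    · rintro ⟨u, v, rfl, rfl, h⟩
      obtain ⟨k, rfl, rfl⟩ := (res_iff hG hE).1 h
      exact ⟨k, k.2, (h1 k).1, (h1 k).2⟩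
  have w1 : ∀ x, x ≠ 19 → x ≠ 20 → x ≠ 21 → s1.reg x = (inputState A b M ends).reg x :=
    fun x q1 q2 q3 => f1 x (by
      simp [forLoop, orientBody, loadEnds, Prog.WritesReg, q1, q2, q3])
  have w1' : ∀ a, a < 20 ∨ 22 < a → s1.arr a = (inputState A b M ends).arr a :=
    fun a ha => g1 a (by
      simp only [forLoop, orientBody, loadEnds, Prog.WritesArr, or_false, false_or]; omega)
  refine (runs_list (s := s1) (A := A) (b := b) (M := M) (w1 0 (by omega) (by omega) (by omega))
    (w1' 0 (by omega)) (w1' 1 (by omega)) h2 (w1 30 (by omega) (by omega) (by omega))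
    (w1 31 (by omega) (by omega) (by omega)) (w1 32 (by omega) (by omega) (by omega))).frame.seq ?_
  rintro s2 ⟨⟨⟨la, ha, hla⟩, ⟨lb, hb, hlb⟩, hl⟩, f2, g2⟩
  have w2' : ∀ a, a < 23 ∨ 25 < a → s2.arr a = s1.arr a :=
    fun a ha => g2 a (by simp only [forLoop, listBody, Prog.WritesArr, or_false, false_or]; omega)
  have m2 : s2.reg 1 = m := (f2 1 (by simp [forLoop, listBody, Prog.WritesReg])).trans
    (w1 1 (by omega) (by omega) (by omega))
  have arcs2 : IsArcList (s2.arr 20) (s2.arr 21) m (Res G A M) := by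
    rw [w2' 20 (by omega), w2' 21 (by omega)]; exact arcs1
  have z2 : ∀ a, 25 < a → s2.arr a = fun _ => 0 := by
    intro a ha
    rw [w2' a (by omega), w1' a (by omega)]
    match a, ha with
    | a + 5, _ => rfl
  have hlt : ∀ {P : Fin n → Prop} {l : List ℕ}, Lists P n l → ∀ v ∈ l, v < n := by
    intro P l hl v hv
    obtain ⟨w, rfl, -⟩ := (hl.mem_iff v).1 hv
    exact w.2
  have S1 := runs_search (src := 20) (dst := 21) (ord := 23) (h := 30) (rN := 1) (rC := 30)
    (n := n) (s := s2) (o := la) (by omega) (by omega) (by omega) (by omega) (by omega)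
    (fun i hi => z2 _ (by omega)) (by rw [m2]; exact arcs2.lt) ha (hlt hla)
  rw [m2] at S1
  have hlal := hla.length_le
  have hlbl := hlb.length_le
  refine (S1.frame.weaken (Nat.mul_le_mul_left _ (by omega)) fun s h => h).seq ?_
  rintro s3 ⟨⟨fin3, -, -, hs3⟩, f3, g3⟩
  have f3' : ∀ x, x < 10 ∨ 18 < x → s3.reg x = s2.reg x := fun x hx => f3 x (search_writesReg hx)
  have g3' : ∀ a, a < 30 ∨ 30 + 4 < a → s3.arr a = s2.arr a := fun a ha =>
    g3 a (search_writesArr ha)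
  have arcs3 : IsArcList (s3.arr 20) (s3.arr 21) m (Res G A M) := by
    rw [g3' 20 (by omega), g3' 21 (by omega)]; exact arcs2
  have arcs3' : IsArcList (s3.arr 21) (s3.arr 20) m (Res G (A : Set (Fin n))ᶜ M) :=
    arcs3.swap fun u v => res_compl hG
  have m3 : s3.reg 1 = m := (f3' 1 (by omega)).trans m2
  have S2 := runs_search (src := 21) (dst := 20) (ord := 24) (h := 40) (rN := 1) (rC := 31)
    (n := n) (s := s3) (o := lb) (by omega) (by omega) (by omega) (by omega) (by omega)
    (fun i hi => by rw [g3' _ (by omega)]; exact z2 _ (by omega)) (by rw [m3]; exact arcs3'.lt)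
    (by rw [g3' 24 (by omega), f3' 31 (by omega)]; exact hb) (hlt hlb)
  rw [m3] at S2
  refine S2.frame.weaken (Nat.mul_le_mul_left _ (by omega)) ?_
  rintro s4 ⟨⟨fin4, -, -, hs4⟩, f4, g4⟩
  have g4' : ∀ a, a < 40 ∨ 40 + 4 < a → s4.arr a = s3.arr a := fun a ha =>
    g4 a (search_writesArr ha)
  refine ⟨?_, fun v => ?_, fun v => ?_, ?_⟩
  · rw [g4' 20 (by omega), g4' 21 (by omega)]; exact arcs3
  · rw [g4' 32 (by omega), hs3.reach]
    constructor
    · rintro ⟨y, hy, hyv⟩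
      obtain ⟨a, rfl, -, h3, h4⟩ := (hla.mem_iff y).1 hy
      exact ⟨a, h3, h4, arcs2.reach_iff.1 hyv⟩
    · rintro ⟨a, h3, h4, h5⟩
      exact ⟨a, (hla.mem_iff _).2 ⟨a, rfl, a.2, h3, h4⟩, arcs2.reach_iff.2 h5⟩
  · rw [hs4.reach]
    constructor
    · rintro ⟨y, hy, hyv⟩
      obtain ⟨a, rfl, -, h3, h4⟩ := (hlb.mem_iff y).1 hy
      exact ⟨a, by simpa using h3, h4, arcs3'.reach_iff.1 hyv⟩
    · rintro ⟨a, h3, h4, h5⟩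
      exact ⟨a, (hlb.mem_iff _).2 ⟨a, rfl, a.2, by simpa using h3, h4⟩, arcs3'.reach_iff.2 h5⟩
  · rw [g4' 25 (by omega), f4 32 (search_writesReg (by omega)), g3' 25 (by omega),
      f3' 32 (by omega)]
    exact hl

/-- Find the strongly connected components of the augmented residual digraph. -/
def compProg : Prog :=
  .seq (forLoop 19 1 augBody) <|
  .seq (search 26 27 25 50 33 32) <|
  .seq (.assign 34 (.reg 11)) (search 27 26 54 60 33 34)

theorem compProg_writesReg {x : ℕ} (hx : x < 10 ∨ (21 < x ∧ x < 33) ∨ 34 < x) : ¬ compProg.WritesReg x := by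
  simp only [compProg, forLoop, augBody, appendArc, Prog.WritesReg, or_false, false_or, not_or]
  have h1 := @search_writesReg 26 27 25 50 33 32 x (by omega)
  have h2 := @search_writesReg 27 26 54 60 33 34 x (by omega)
  refine ⟨?_, h1, ?_, h2⟩ <;> omega

theorem compProg_writesArr {a : ℕ} (ha : a < 26 ∨ (27 < a ∧ a < 50)) :
    ¬ compProg.WritesArr a := by
  simp only [compProg, forLoop, augBody, appendArc, Prog.WritesArr, or_false, false_or, not_or]
  have h1 := @search_writesArr 26 27 25 50 33 32 a (by omega)
  have h2 := @search_writesArr 27 26 54 60 33 34 a (by omega)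
  refine ⟨?_, h1, h2⟩; omega

/-- The values of `mark` at the vertices are `1, …, k`, and `mark` labels the flexible
components. -/
structure Labels (G : SimpleGraph (Fin n)) (b : Fin n → ℕ) (mark : ℕ → ℕ) (k : ℕ) : Prop where
  eq_iff : ∀ v w : Fin n, mark v = mark w ↔
    (flexGraph G b).connectedComponentMk v = (flexGraph G b).connectedComponentMk w
  pos : ∀ v : Fin n, 1 ≤ mark v
  le : ∀ v : Fin n, mark v ≤ k
  surj : ∀ j, 1 ≤ j → j ≤ k → ∃ v : Fin n, mark v = j

theorem runs_compProg (hG : G.IsBipartiteWith (A : Set (Fin n)) (A : Set (Fin n))ᶜ)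
    (hM : IsMaxBMatching G b M) {s : State} (hs : HookData G A b M m s) (hm : s.reg 1 = m)
    (h33 : s.reg 33 = 0) (hb : s.arr 1 = word b) (hz : ∀ a, 44 < a → s.arr a = fun _ => 0) :
    Runs compProg s (4000 * (n + m + 1)) fun s' => Labels G b (s'.arr 62) (s'.reg 12) := by
  obtain ⟨l, hrep, hl⟩ := hs.vertices
  have hT : ((6 + augBody.bound) * m + 5) + (200 * (3 * m + n + n + 1) +
      (2 + 200 * (3 * m + n + n + 1))) ≤ 4000 * (n + m + 1) := by
    have h1 : augBody.bound = 53 := rfl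
    rw [h1]
    omega
  refine Runs.weaken ?_ hT fun s h => h
  refine (runs_aug hm h33).frame.seq ?_
  rintro s1 ⟨⟨h1, h2⟩, f1, g1⟩
  have arcs1 : IsArcList (s1.arr 26) (s1.arr 27) (s1.reg 33) (Aug G A b M) := by
    intro x y
    rw [h2, hs.arcs, hs.arcs, hb]
    have hb0 : ∀ v : Fin n, 0 < word b v ↔ 0 < b v := fun v => by rw [word_val]
    constructor
    · rintro (⟨u, v, rfl, rfl, h⟩ | ⟨⟨u, v, rfl, rfl, h⟩, h'⟩)
      · exact ⟨u, v, rfl, rfl, Or.inl h⟩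
      · refine ⟨v, u, rfl, rfl, Or.inr ⟨h, ?_⟩⟩
        rw [hb0, hb0, Nat.pos_iff_ne_zero, Nat.pos_iff_ne_zero (n := s.arr 42 v), hs.inside,
          hs.outside] at h'
        exact h'
    · rintro ⟨u, v, rfl, rfl, h | ⟨h, h'⟩⟩
      · exact Or.inl ⟨u, v, rfl, rfl, h⟩
      · refine Or.inr ⟨⟨v, u, rfl, rfl, h⟩, ?_⟩
        rw [hb0, hb0, Nat.pos_iff_ne_zero, Nat.pos_iff_ne_zero (n := s.arr 42 u), hs.inside,
          hs.outside]
        exact h'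
  have g1' : ∀ a, a < 26 ∨ 27 < a → s1.arr a = s.arr a := fun a ha => g1 a (by
    simp only [forLoop, augBody, appendArc, Prog.WritesArr, or_false, false_or]; omega)
  have f1' : s1.reg 32 = s.reg 32 := f1 32 (by
    simp only [forLoop, augBody, appendArc, Prog.WritesReg, or_false, false_or]; omega)
  have hmem : ∀ v, v ∈ l ↔ v < n := by
    intro v
    rw [hl.mem_iff]
    exact ⟨fun ⟨w, h, _⟩ => h ▸ w.2, fun h => ⟨⟨v, h⟩, rfl, h, trivial⟩⟩
  have S1 := runs_search (src := 26) (dst := 27) (ord := 25) (h := 50) (rN := 33) (rC := 32)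
    (n := n) (s := s1) (o := l) (by omega) (by omega) (by omega) (by omega) (by omega)
    (fun i hi => by rw [g1' _ (by omega)]; exact hz _ (by omega)) arcs1.lt
    (by rw [g1' 25 (by omega), f1']; exact hrep) fun v hv => (hmem v).1 hv
  have hll := hl.length_le
  refine (S1.frame.weaken (Nat.mul_le_mul_left _ (by omega)) fun s h => h).seq ?_
  rintro s2 ⟨⟨fin, hfl, hfr, hfs⟩, f2, g2⟩
  refine (runs_step (p := .assign 34 (.reg 11)) trivial s2).seq ?_
  rintro s3 rfl
  have g2' : ∀ a, a < 50 ∨ 50 + 4 < a → s2.arr a = s1.arr a := fun a ha =>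
    g2 a (search_writesArr ha)
  have r33 : ((Prog.assign 34 (.reg 11)).step s2).reg 33 = s1.reg 33 := by
    rw [← f2 33 (search_writesReg (by omega))]
    simp [Prog.step, reg_setReg_of_ne]
  have r34 : ((Prog.assign 34 (.reg 11)).step s2).reg 34 = s2.reg 11 := by
    simp [Prog.step, Expr.eval]
  have a3 : ((Prog.assign 34 (.reg 11)).step s2).arr = s2.arr := rfl
  generalize (Prog.assign 34 (.reg 11)).step s2 = s3 at r33 r34 a3
  have arcs3 : IsArcList (s3.arr 26) (s3.arr 27) (s3.reg 33) (Aug G A b M) := by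
    rw [a3, g2' 26 (by omega), g2' 27 (by omega), r33]; exact arcs1
  have hfin : ∀ v, v ∈ fin ↔ v < n := by
    intro v
    rw [hfs.mem_fin, hfs.reach]
    constructor
    · rintro ⟨y, hy, hyv⟩
      rcases ReflTransGen.cases_tail hyv with rfl | ⟨w, -, hw⟩
      · exact (hmem _).1 hy
      · obtain ⟨-, v', -, h', -⟩ := (arcs1 _ _).1 hw
        exact h' ▸ v'.2
    · intro hv
      exact ⟨v, (hmem v).2 hv, .refl⟩
  have S2 := runs_search (src := 27) (dst := 26) (ord := 54) (h := 60) (rN := 33) (rC := 34)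
    (n := n) (s := s3) (o := fin) (by omega) (by omega) (by omega) (by omega) (by omega)
    (fun i hi => by rw [a3, g2' _ (by omega), g1' _ (by omega)]; exact hz _ (by omega))
    (fun j hj => (arcs3.lt j hj).symm) (by rw [a3, r34]; exact hfr) fun v hv => (hfin v).1 hv
  rw [a3, r33, g2' 26 (by omega), g2' 27 (by omega)] at S2
  refine S2.weaken (Nat.mul_le_mul_left _ (by omega)) ?_
  rintro s4 ⟨fin', hfl', -, hfs'⟩
  have hne : ∀ v : Fin n, s4.arr 62 v ≠ 0 := fun v =>
    (hfs'.reach v).2 ⟨v, (hfin v).2 v.2, .refl⟩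
  refine ⟨fun v w => ?_, fun v => Nat.one_le_iff_ne_zero.2 (hne v), fun v => hfs'.label_le v, ?_⟩
  · rw [hfs.mark_eq_iff hfs' ((hfin v).2 v.2) ((hfin w).2 w.2), arcs1.reach_iff,
      arcs1.reach_iff, mk_eq_iff hG hM]
  · intro j hj hjk
    obtain ⟨pre, root, hr, -⟩ := hfs'.first
    have := hr j hj hjk
    have hmem : root j ∈ fin := this.2.subset (by simp)
    exact ⟨⟨root j, (hfin _).1 hmem⟩, this.1⟩

/-- Output the decomposition. -/
def outProg : Prog :=
  .seq (.assign 2 (.reg 12)) <|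
  .seq (.assign 3 (.reg 1)) <|
  .seq (forLoop 19 0 outputBody) (forLoop 19 1 pairBody)

/-- The components are numbered in the order of their labels, from zero. -/
theorem Labels.exists_equiv {mark : ℕ → ℕ} {k : ℕ} (h : Labels G b mark k) :
    ∃ φ : FlexComp G b ≃ Fin k, ∀ v : Fin n,
      (φ ((flexGraph G b).connectedComponentMk v) : ℕ) = mark v - 1 := by
  have hrep : ∀ C : FlexComp G b, ∃ v, (flexGraph G b).connectedComponentMk v = C :=
    fun C => C.exists_rep
  choose rep hr using hrep
  have hlt : ∀ v : Fin n, mark v - 1 < k := fun v => by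
    have := h.pos v
    have := h.le v
    omega
  let F : FlexComp G b → Fin k := fun C => ⟨mark (rep C) - 1, hlt _⟩
  have hF : ∀ v : Fin n, (F ((flexGraph G b).connectedComponentMk v) : ℕ) = mark v - 1 := by
    intro v
    show mark (rep _) - 1 = _
    rw [(h.eq_iff _ v).2 (hr _)]
  have hinj : Function.Injective F := by
    intro C D hCD
    have h1 : mark (rep C) - 1 = mark (rep D) - 1 := congrArg Fin.val hCD
    have := h.pos (rep C)
    have := h.pos (rep D)
    rw [← hr C, ← hr D, ← h.eq_iff]
    omega
  have hsurj : Function.Surjective F := by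
    intro j
    obtain ⟨v, hv⟩ := h.surj (j + 1) (by omega) (by omega)
    exact ⟨(flexGraph G b).connectedComponentMk v, Fin.ext (by rw [hF, hv]; omega)⟩
  exact ⟨Equiv.ofBijective F ⟨hinj, hsurj⟩, hF⟩

theorem runs_outProg (hG : G.IsBipartiteWith (A : Set (Fin n)) (A : Set (Fin n))ᶜ)
    (hM : IsMaxBMatching G b M) {s : State} (hs : HookData G A b M m s)
    (hl : Labels G b (s.arr 62) (s.reg 12)) (hn : s.reg 0 = n) (hm : s.reg 1 = m)
    (a6 : s.arr 6 = fun _ => 0) (a7 : s.arr 7 = fun _ => 0) (a8 : s.arr 8 = fun _ => 0) :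
    Runs outProg s (2000 * (n + m + 1)) (IsDecomposition m G A b) := by
  have hT : 2 + (2 + (((6 + outputBody.bound) * n + 5) + ((6 + pairBody.bound) * m + 5))) ≤
      2000 * (n + m + 1) := by
    have h1 : outputBody.bound = 29 := rfl
    have h2 : pairBody.bound = 10 := rfl
    rw [h1, h2]
    omega
  refine Runs.weaken ?_ hT fun s h => h
  refine (runs_step (p := .assign 2 (.reg 12)) trivial s).seq ?_
  rintro s1 rfl
  refine (runs_step (p := .assign 3 (.reg 1)) trivial _).seq ?_
  rintro s2 rfl
  have r2 : ((Prog.assign 3 (.reg 1)).step ((Prog.assign 2 (.reg 12)).step s)).reg 2 = s.reg 12 := by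
    simp [Prog.step, Expr.eval, reg_setReg_of_ne]
  have r3 : ((Prog.assign 3 (.reg 1)).step ((Prog.assign 2 (.reg 12)).step s)).reg 3 = m := by
    simp [Prog.step, Expr.eval, reg_setReg_of_ne, hm]
  have r0 : ((Prog.assign 3 (.reg 1)).step ((Prog.assign 2 (.reg 12)).step s)).reg 0 = n := by
    simp [Prog.step, reg_setReg_of_ne, hn]
  have r1 : ((Prog.assign 3 (.reg 1)).step ((Prog.assign 2 (.reg 12)).step s)).reg 1 = m := by
    simp [Prog.step, reg_setReg_of_ne, hm]
  have e2 : ((Prog.assign 3 (.reg 1)).step ((Prog.assign 2 (.reg 12)).step s)).arr = s.arr := rfl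
  generalize (Prog.assign 3 (.reg 1)).step ((Prog.assign 2 (.reg 12)).step s) = s2
    at r0 r1 r2 r3 e2
  refine (runs_output (s := s2) r0 (by rw [e2, a6]) (by rw [e2, a7]) (by rw [e2, a8])).frame.seq ?_
  rintro s3 ⟨⟨h5, h6, h7, h8⟩, f3, g3⟩
  rw [e2] at h5 h6 h7 h8
  have f3' : ∀ x, x < 19 → s3.reg x = s2.reg x := fun x hx => f3 x (by
    simp only [forLoop, outputBody, Prog.WritesReg, or_false]; omega)
  have g3' : ∀ a, 8 < a → s3.arr a = s.arr a := fun a ha => by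
    rw [g3 a (by simp only [forLoop, outputBody, Prog.WritesArr, or_false, false_or]; omega), e2]
  refine (runs_pair (s := s3) ((f3' 1 (by omega)).trans r1)).frame.weaken le_rfl ?_
  rintro s4 ⟨h9, f4, g4⟩
  have f4' : ∀ x, x < 19 → s4.reg x = s2.reg x := fun x hx => by
    rw [f4 x (by simp only [forLoop, pairBody, Prog.WritesReg, or_false, false_or]; omega), f3' x hx]
  have g4' : ∀ a, a < 9 → s4.arr a = s3.arr a := fun a ha =>
    g4 a (by simp only [forLoop, pairBody, Prog.WritesArr, or_false, false_or]; omega)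
  rw [g3' 20 (by omega), g3' 21 (by omega)] at h9
  have k2 : s4.reg 2 = s.reg 12 := (f4' 2 (by omega)).trans r2
  have k3 : s4.reg 3 = m := (f4' 3 (by omega)).trans r3
  obtain ⟨φ, hφ⟩ := hl.exists_equiv
  have h5' : ∀ v : Fin n, s3.arr 5 v = φ ((flexGraph G b).connectedComponentMk v) := fun v => by
    rw [h5 v v.2, hφ]
  have hmark : ∀ (P : ℕ → Prop) (v : Fin n),
      (∀ u w : Fin n, (flexGraph G b).connectedComponentMk u =
        (flexGraph G b).connectedComponentMk w → P u → P w) →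
      ((∃ u < n, s.arr 62 u - 1 = φ ((flexGraph G b).connectedComponentMk v) ∧ P u) ↔ P v) := by
    intro P v hP
    constructor
    · rintro ⟨u, hu, h1, h2⟩
      refine hP ⟨u, hu⟩ v ?_ h2
      rw [hφ] at h1
      rw [← hl.eq_iff]
      have := hl.pos ⟨u, hu⟩
      have := hl.pos v
      simp only at *
      omega
    · intro h
      exact ⟨v, v.2, (hφ v).symm, h⟩
  have hA : ∀ v : Fin n, 0 < s.arr 32 v ↔
      IsHookedUp G b (A : Set (Fin n)) ((flexGraph G b).connectedComponentMk v) := fun v => by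
    rw [Nat.pos_iff_ne_zero, hs.inside, isHookedUp_iff hG hM]
  have hB : ∀ v : Fin n, 0 < s.arr 42 v ↔
      IsHookedUp G b (A : Set (Fin n))ᶜ ((flexGraph G b).connectedComponentMk v) := fun v => by
    rw [Nat.pos_iff_ne_zero, hs.outside, isHookedUp_iff (isBipartiteWith_compl hG) hM]
  rw [IsDecomposition, k2, k3, g4' 5 (by omega), g4' 6 (by omega), g4' 7 (by omega),
    g4' 8 (by omega)]
  refine ⟨φ, h5', ?_, le_rfl, ?_, ?_⟩
  · intro C
    induction C using SimpleGraph.ConnectedComponent.ind with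
    | _ v =>
      refine ⟨?_, ?_, ?_⟩
      · rw [h6, hmark _ v, hA, hB, ← isInconsistent_iff]
        intro u w huw
        rw [hA, hB, hA, hB, huw]
        exact id
      · rw [h7, hmark (fun v => 0 < s.arr 32 v) v, hA]
        intro u w huw
        rw [hA, hA, huw]
        exact id
      · rw [h8, hmark (fun v => 0 < s.arr 42 v) v, hB]
        intro u w huw
        rw [hB, hB, huw]
        exact id
  · intro j hj
    obtain ⟨u, v, h1, h2, -⟩ := (hs.arcs _ _).1 ⟨j, hj, rfl, rfl⟩
    rw [(h9 j hj).1, (h9 j hj).2, ← h1, ← h2, h5', h5']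
    exact ⟨Fin.is_lt _, Fin.is_lt _⟩
  · have hpair : ∀ x y : ℕ, (∃ j < m, s4.arr 9 j = x ∧ s4.arr 10 j = y) ↔
        ∃ C D, (φ C : ℕ) = x ∧ (φ D : ℕ) = y ∧ compArc G b A M C D := by
      intro x y
      constructor
      · rintro ⟨j, hj, rfl, rfl⟩
        obtain ⟨u, v, h1, h2, h3⟩ := (hs.arcs _ _).1 ⟨j, hj, rfl, rfl⟩
        rw [(h9 j hj).1, (h9 j hj).2, ← h1, ← h2, h5', h5']
        exact ⟨_, _, rfl, rfl, u, v, h3, rfl, rfl⟩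
      · rintro ⟨_, _, rfl, rfl, u, v, h3, rfl, rfl⟩
        obtain ⟨j, hj, h1, h2⟩ := (hs.arcs u v).2 ⟨u, v, rfl, rfl, h3⟩
        refine ⟨j, hj, ?_⟩
        rw [(h9 j hj).1, (h9 j hj).2, h1, h2, h5', h5']
        exact ⟨rfl, rfl⟩
    intro C D
    rw [flexOrder_eq hG hM]
    constructor
    · intro h
      induction h with
      | refl => exact .refl
      | tail _ h ih => exact ih.tail ((hpair _ _).2 ⟨_, _, rfl, rfl, h⟩)
    · have key : ∀ y, ReflTransGen (fun x y : ℕ => ∃ j < m, s4.arr 9 j = x ∧ s4.arr 10 j = y)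
          (φ C) y → ∃ D, (φ D : ℕ) = y ∧ ReflTransGen (compArc G b A M) C D := by
        intro y hy
        induction hy with
        | refl => exact ⟨C, rfl, .refl⟩
        | tail _ h ih =>
          obtain ⟨D, rfl, hD⟩ := ih
          obtain ⟨D', E, h1, rfl, h2⟩ := (hpair _ _).1 h
          rw [φ.injective (Fin.ext h1)] at h2
          exact ⟨E, rfl, hD.tail h2⟩
      intro h
      obtain ⟨E, h1, h2⟩ := key _ h
      rwa [φ.injective (Fin.ext h1)] at h2

/-- The program that computes the Dulmage–Mendelsohn decomposition. Besides input and output, the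
arrays hold the residual arcs (20, 21), the degrees in the matching (22), the loose vertices in `A`,
those outside `A` and all vertices (23, 24, 25), the augmented arcs (26, 27), and the work space of
the four searches (from 30, 40, 50 and 60). The searches use the registers from 10 to 18; the others
are a loop counter (19), two scratch registers (20, 21) and the lengths of the lists (30 to 34). -/
def decompProg : Prog := .seq hookProg (.seq compProg outProg)

theorem runs_decompProg (hG : G.IsBipartiteWith (A : Set (Fin n)) (A : Set (Fin n))ᶜ)
    (hE : IsEdgeList G ends) (hM : IsMaxBMatching G b M) :
    Runs decompProg (inputState A b M ends) (8000 * (n + m + 1)) (IsDecomposition m G A b) := by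
  refine Runs.weaken (T := 2000 * (n + m + 1) + (4000 * (n + m + 1) + 2000 * (n + m + 1)))
    ?_ (by omega) fun s h => h
  refine (runs_hookProg hG hE hM).frame.seq ?_
  rintro s1 ⟨h1, f1, g1⟩
  have f1' : ∀ x, x < 10 ∨ 32 < x → s1.reg x = (inputState A b M ends).reg x := fun x hx =>
    f1 x (hookProg_writesReg hx)
  have g1' : ∀ a, (a < 20 ∨ (25 < a ∧ a < 30) ∨ 44 < a) →
      s1.arr a = (inputState A b M ends).arr a := fun a ha => g1 a (hookProg_writesArr ha)
  have z1 : ∀ a, 44 < a → s1.arr a = fun _ => 0 := by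
    intro a ha
    rw [g1' a (by omega)]
    match a, ha with
    | a + 5, _ => rfl
  refine (runs_compProg hG hM h1 (f1' 1 (by omega)) (f1' 33 (by omega)) (g1' 1 (by omega))
    z1).frame.seq ?_
  rintro s2 ⟨h2, f2, g2⟩
  have g2' : ∀ a, (a < 26 ∨ (27 < a ∧ a < 50)) → s2.arr a = s1.arr a := fun a ha =>
    g2 a (compProg_writesArr ha)
  have f2' : ∀ x, x < 10 → s2.reg x = s1.reg x := fun x hx =>
    f2 x (compProg_writesReg (by omega))
  have h1' : HookData G A b M m s2 :=
    ⟨by rw [g2' 20 (by omega), g2' 21 (by omega)]; exact h1.arcs,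
      by rw [g2' 32 (by omega)]; exact h1.inside,
      by rw [g2' 42 (by omega)]; exact h1.outside,
      by rw [g2' 25 (by omega), f2 32 (compProg_writesReg (by omega))]; exact h1.vertices⟩
  exact runs_outProg hG hM h1' h2 ((f2' 0 (by omega)).trans (f1' 0 (by omega)))
    ((f2' 1 (by omega)).trans (f1' 1 (by omega)))
    ((g2' 6 (by omega)).trans (g1' 6 (by omega))) ((g2' 7 (by omega)).trans (g1' 7 (by omega)))
    ((g2' 8 (by omega)).trans (g1' 8 (by omega)))

end Main

end BDM


theorem mainTheorem6 :
    ∃ (p : BDM.Prog) (c : ℕ),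
      ∀ (n m : ℕ) (G : SimpleGraph (Fin n)) (A : Finset (Fin n)) (b : Fin n → ℕ)
        (M : Finset (Sym2 (Fin n))) (ends : Fin m → Fin n × Fin n),
        G.IsBipartiteWith (A : Set (Fin n)) (A : Set (Fin n))ᶜ →
        BDM.IsEdgeList G ends →
        BDM.IsMaxBMatching G b M →
        IsPartialOrder (BDM.FlexComp G b) (BDM.flexOrder G b (A : Set (Fin n))) ∧
        ∃ (s : BDM.State) (t : ℕ),
          BDM.Exec p (BDM.inputState A b M ends) s t ∧ t ≤ c * (n + m + 1) ∧
          BDM.IsDecomposition m G A b s :=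
  ⟨BDM.decompProg, 8000, fun _ _ _ _ _ _ _ hG hE hM =>
    ⟨BDM.isPartialOrder_flexOrder hG hM, BDM.runs_decompProg hG hE hM⟩⟩
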